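/- Let $d\ge 3$ and let $\mathcal Z$ be a standard (unit intensity) Poisson point process in $\mathbb R^d$. For a bounded Borel set $A\subset\mathbb R^d$ and $x\in\mathbb R^d$ define the centered force $$F(x\,|\,A):=\sum_{z\in\mathcal Z\cap A}\frac{z-x}{|z-x|^d}-\int_A\frac{z-x}{|z-x|^d}\,dz .$$ Fix $0<\varepsilon<\frac1{2(d-2)}$. For $R>0$ let $p_1:=\lceil \log R/\log 2\rceil$ and $p_2:=\lceil \varepsilon\log R/\log 2\rceil$, and define $$V_0:=\{x\in\mathbb R^d : |x_1|\le 2^{p_1},\ |x_i|\le 2^{2p_2}\text{ for } 2\le i\le d\},$$ $$V_+:=\{x\in\mathbb R^d : |x_i|\le 2^{p_1+1}\text{ for } 1\le i\le d\}.$$ Then there exists a constant $C(\varepsilon)>0$, depending only on $d$ and $\varepsilon$, such that for all $R\ge C(\varepsilon)$, $$\mathbb P\Big(\max_{x\in V_0}\big|F(x\,|\,V_+\setminus 2V_0)\big|\le \frac1{R^d}\Big)\ \ge\ \exp\big(-C(\varepsilon)\,R^{1+(d-2)\varepsilon}\log R\big),$$ where $2V_0=\{2x : x\in V_0\}$ and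 $|\cdot|$ is the Euclidean norm. -/

import Mathlib

open MeasureTheory ProbabilityTheory
open scoped Pointwise

noncomputable section

namespace GravSmallBall

/-- The Euclidean space `ℝ^d`. -/
abbrev Space (d : ℕ) : Type := EuclideanSpace ℝ (Fin d)

/-- The number of points of a configuration `s` lying in `A` (used for locally finite `s` and
bounded `A`, where the intersection is finite). -/
def count {d : ℕ} (s A : Set (Space d)) : ℕ := (s ∩ A).ncard

/-- `Z` is a standard (unit intensity) Poisson point process in `ℝ^d` on `(Ω, P)`: a random locally
finite set of points such that the number of points in a bounded Borel set is a random variable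
with the Poisson law whose mean is the volume of that set, and the numbers of points in pairwise
disjoint bounded Borel sets are jointly independent. -/
structure IsStandardPoissonProcess {d : ℕ} {Ω : Type*} [MeasurableSpace Ω] (P : Measure Ω)
    (Z : Ω → Set (Space d)) : Prop where
  locallyFinite : ∀ (ω : Ω) (A : Set (Space d)), Bornology.IsBounded A → (Z ω ∩ A).Finite
  measurable_count : ∀ A : Set (Space d), MeasurableSet A → Bornology.IsBounded A →
    Measurable (fun ω => count (Z ω) A)
  map_count : ∀ A : Set (Space d), MeasurableSet A → Bornology.IsBounded A →
    P.map (fun ω => count (Z ω) A) = poissonMeasure (volume A).toNNReal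
  iIndepFun_count : ∀ (k : ℕ) (A : Fin k → Set (Space d)), (∀ i, MeasurableSet (A i)) →
    (∀ i, Bornology.IsBounded (A i)) → Pairwise (fun i j => Disjoint (A i) (A j)) →
    iIndepFun (fun i ω => count (Z ω) (A i)) P

/-- The vector `(z - x) / |z - x|^d`, the force exerted at `x` by a unit mass at `z`. -/
def pull {d : ℕ} (x z : Space d) : Space d := (‖z - x‖ ^ d)⁻¹ • (z - x)

/-- The centered force `F(x | A)` at `x` exerted by the points of the configuration `s` lying in a
bounded set `A`: the sum of their forces minus the integral of the force over `A`. -/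
def force {d : ℕ} (s A : Set (Space d)) (x : Space d) : Space d :=
  (∑ᶠ z ∈ s ∩ A, pull x z) - ∫ z in A, pull x z

/-- The box of all `x` with `|x_1| ≤ L` and `|x_i| ≤ W` for `2 ≤ i ≤ d` (the first coordinate has
index `0` here). -/
def box (d : ℕ) (L W : ℝ) : Set (Space d) :=
  {x | ∀ i : Fin d, |x i| ≤ if i.val = 0 then L else W}

/-- `p₁ = ⌈log R / log 2⌉`. -/
def p₁ (R : ℝ) : ℤ := ⌈Real.log R / Real.log 2⌉

/-- `p₂ = ⌈ε log R / log 2⌉`. -/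
def p₂ (ε R : ℝ) : ℤ := ⌈ε * Real.log R / Real.log 2⌉

/-- The long thin box `V₀`, with half-side `2 ^ p₁` in the first coordinate direction and half-sides
`2 ^ (2 p₂)` in all others. -/
def V₀ (d : ℕ) (ε R : ℝ) : Set (Space d) := box d ((2 : ℝ) ^ p₁ R) ((2 : ℝ) ^ (2 * p₂ ε R))

/-- The cube `V₊` with half-side `2 ^ (p₁ + 1)`. -/
def Vplus (d : ℕ) (R : ℝ) : Set (Space d) := box d ((2 : ℝ) ^ (p₁ R + 1)) ((2 : ℝ) ^ (p₁ R + 1))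

end GravSmallBall

end

/-! Write `n` for `p₁` and `m` for `p₂`, so that `R ≈ 2 ^ n` and `R ^ ε ≈ 2 ^ m`. The region `V₊ \
2V₀` is cut into shells, on which the largest transversal coordinate is between `2 ^ k` and `2 ^ (k
+ 1)` with `2m < k ≤ n`, and the `k`-th shell is cut into cubes of side `2 ^ (k - j)` with `j = m /
4`. Seen from `V₀`, the ratio of side to distance of every cube is at most `2 / 2 ^ j ≈ R ^ (-ε /
4)`. A Taylor expansion of the kernel of a fixed order `M ~ 1 / ε` is therefore exact up to any
prescribed negative power of `R`. Hence the centered force of a cube is negligible on all of `V₀` as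
soon as finitely many moments of its points agree, up to a negative power of `R`, with those of
Lebesgue measure (`exists_force_cube_bound`). Distinct cubes are independent, so it remains to bound
the probability of this agreement from below in one cube and to multiply.

The one-cube estimate is `exists_uniform_match`: with `N` expected points the moments match with
probability at least `exp (-C N ^ s log R)`, where `s` is as small as desired. It is a bootstrap
that needs no local limit theorem. Moments fluctuate by `√N`. Change the uniform intensity by an
amount of total mass of order `√N`: remove part of it and reserve a new part for correction. By
Chebyshev and the pigeonhole principle, the moments of the main part fall within `δ` of one fixed
vector, at distance `O(√N)` from their mean, with probability polynomial in `δ / N`. The reserved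
part must then meet a prescribed vector with about `√N` points, which is the same problem with `√N`
in place of `N`. After finitely many rounds one explicit configuration of `T` points is used, at
cost `exp (-C T log R)`. The change of intensity costs only a constant factor, its `χ²` being of
order `(√N)² / N` (`sq_poisProd_le`). That prescribed moments can be met at all is polynomial
algebra: a polynomial of degree at most `m` in each variable is determined by its values on a grid
with `m + 1` nodes per coordinate.

With `s = 2 ^ (-(d + 1)) ≤ 1 / d` a cube costs at most a multiple of its side times `log R`. The
sides in one shell add up to at most a constant times `2 ^ n * 2 ^ (j d)`, and there are `O(log R)`
shells. The total is of order `R ^ (1 + ε d / 4) (log R)²`, and one logarithm is absorbed in `R ^ (ε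
/ 4)`. Since `(d + 1) / 4 ≤ d - 2` for `d ≥ 3`, this is the claimed cost. -/

namespace GravSmallBall

open scoped NNReal ENNReal

/-! ### Moments and the `χ²` integral of Poisson laws -/

section PoissonMoments

open scoped Nat

lemma poisson_weight_succ (r : ℝ) (n : ℕ) :
    Real.exp (-r) * r ^ (n + 1) / (n + 1)! * ((n : ℝ) + 1) = r * (Real.exp (-r) * r ^ n / n !) := by
  rw [Nat.factorial_succ, pow_succ]
  push_cast
  have h1 : (n ! : ℝ) ≠ 0 := by positivity
  have h2 : (n : ℝ) + 1 ≠ 0 := by positivity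
  field_simp

lemma hasSum_poisson_mean (r : ℝ≥0) :
    HasSum (fun n : ℕ => Real.exp (-r) * (r : ℝ) ^ n / n ! * (n : ℝ)) r := by
  rw [← hasSum_nat_add_iff' 1]
  have h := (hasSum_one_poissonMeasure r).mul_left (r : ℝ)
  simp only [Nat.cast_add, Nat.cast_one, poisson_weight_succ]
  simpa using h

lemma hasSum_poisson_sq (r : ℝ≥0) :
    HasSum (fun n : ℕ => Real.exp (-r) * (r : ℝ) ^ n / n ! * (n : ℝ) ^ 2) (r * (r + 1)) := by
  rw [← hasSum_nat_add_iff' 1]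
  have h := ((hasSum_poisson_mean r).add (hasSum_one_poissonMeasure r)).mul_left (r : ℝ)
  have e : ∀ n : ℕ, Real.exp (-r) * (r : ℝ) ^ (n + 1) / (n + 1)! * (((n + 1 : ℕ) : ℝ)) ^ 2 =
      r * (Real.exp (-r) * (r : ℝ) ^ n / n ! * (n : ℝ) + Real.exp (-r) * (r : ℝ) ^ n / n !) := by
    intro n
    have := poisson_weight_succ r n
    push_cast
    rw [pow_two, ← mul_assoc, this]
    ring
  simp only [e]
  simpa using h

lemma memLp_natCast_poisson (r : ℝ≥0) : MemLp (fun n : ℕ => (n : ℝ)) 2 (poissonMeasure r) := by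
  rw [memLp_two_iff_integrable_sq (by fun_prop), integrable_poissonMeasure_iff]
  refine (hasSum_poisson_sq r).summable.congr fun n => ?_
  simp

lemma integral_natCast_poisson (r : ℝ≥0) : ∫ n : ℕ, (n : ℝ) ∂poissonMeasure r = r := by
  rw [integral_poissonMeasure]
  exact (hasSum_poisson_mean r).tsum_eq

lemma variance_natCast_poisson (r : ℝ≥0) : Var[fun n : ℕ => (n : ℝ); poissonMeasure r] = r := by
  rw [variance_eq_sub (memLp_natCast_poisson r), integral_natCast_poisson]
  have : ∫ n : ℕ, ((fun n : ℕ => (n : ℝ)) ^ 2) n ∂poissonMeasure r = r * (r + 1) := by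
    rw [integral_poissonMeasure]
    exact (hasSum_poisson_sq r).tsum_eq
  rw [this]
  ring

/-- The `χ²` integral of two Poisson laws. -/
lemma hasSum_poisson_chiSq (h l : ℝ≥0) (hl : 0 < l) :
    HasSum (fun n : ℕ => Real.exp (-l) * (l : ℝ) ^ n / n ! *
      (Real.exp (l - h) * ((h : ℝ) / l) ^ n) ^ 2) (Real.exp ((h - l) ^ 2 / l)) := by
  have hl' : (l : ℝ) ≠ 0 := by positivity
  have := (hasSum_one_poissonMeasure (h ^ 2 / l)).mul_left (Real.exp (((h : ℝ) - l) ^ 2 / l))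
  rw [mul_one] at this
  -- Completing the square in the exponent turns each term into a constant times a Poisson weight of
  -- mean `h ^ 2 / l`.
  have key : ∀ n : ℕ, Real.exp (-l) * (l : ℝ) ^ n / n ! *
      (Real.exp (l - h) * ((h : ℝ) / l) ^ n) ^ 2 = Real.exp (((h : ℝ) - l) ^ 2 / l) *
        (Real.exp (-((h ^ 2 / l : ℝ≥0) : ℝ)) * ((h ^ 2 / l : ℝ≥0) : ℝ) ^ n / n !) := by
    intro n
    push_cast
    have e1 : Real.exp (-l) * (Real.exp (l - h)) ^ 2 =
        Real.exp (((h : ℝ) - l) ^ 2 / l) * Real.exp (-((h : ℝ) ^ 2 / l)) := by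
      rw [← Real.exp_add, pow_two, ← Real.exp_add, ← Real.exp_add]
      congr 1
      field_simp
      ring
    have e2 : (l : ℝ) ^ n * (((h : ℝ) / l) ^ n) ^ 2 = ((h : ℝ) ^ 2 / l) ^ n := by
      rw [← pow_mul, mul_comm n 2, pow_mul, ← mul_pow]
      congr 1
      field_simp
    calc _ = (Real.exp (-l) * (Real.exp (l - h)) ^ 2) *
        ((l : ℝ) ^ n * (((h : ℝ) / l) ^ n) ^ 2) / n ! := by ring
      _ = _ := by rw [e1, e2]; ring
  simpa only [key] using this

end PoissonMoments

/-! ### Independent Poisson counts: superposition and change of intensity -/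

section Product

open scoped Nat

variable {ι : Type*} [Fintype ι]

/-- The law of independent Poisson counts with means `h c`. -/
noncomputable def poisProd (h : ι → ℝ≥0) : Measure (ι → ℕ) := Measure.pi fun c => poissonMeasure (h c)

instance (h : ι → ℝ≥0) : IsProbabilityMeasure (poisProd h) := by
  unfold poisProd; infer_instance

lemma poisProd_add (h h' : ι → ℝ≥0) :
    ((poisProd h).prod (poisProd h')).map (fun p => p.1 + p.2) = poisProd (h + h') := by
  unfold poisProd
  rw [← (measurePreserving_arrowProdEquivProdArrow ℕ ℕ ι (fun c => poissonMeasure (h c))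
    (fun c => poissonMeasure (h' c))).map_eq,
    Measure.map_map .of_discrete (MeasurableEquiv.measurable _)]
  have := Measure.pi_map_pi (μ := fun c => (poissonMeasure (h c)).prod (poissonMeasure (h' c)))
    (f := fun _ p => p.1 + p.2) (fun i => Measurable.of_discrete.aemeasurable)
    (hμ := fun i => by
      have := Measure.isProbabilityMeasure_map (μ := (poissonMeasure (h i)).prod (poissonMeasure (h' i))) (f := fun p => p.1 + p.2) Measurable.of_discrete.aemeasurable
      infer_instance)
  have e : (fun c => poissonMeasure ((h + h') c)) =
      fun c => Measure.map (fun p => p.1 + p.2) ((poissonMeasure (h c)).prod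
        (poissonMeasure (h' c))) := by
    funext c
    rw [Pi.add_apply, ← poissonMeasure_conv_poissonMeasure]
    rfl
  rw [e]
  exact this

/-- By superposition the counts of intensity `h + h'` split into two independent parts. This is what
allows a large fluctuating part to be corrected by a small one. -/
lemma mul_le_poisProd_add (h h' : ι → ℝ≥0) {S S' T : Set (ι → ℕ)}
    (hT : ∀ n ∈ S, ∀ n' ∈ S', n + n' ∈ T) :
    (poisProd h).real S * (poisProd h').real S' ≤ (poisProd (h + h')).real T := by
  rw [← poisProd_add, map_measureReal_apply .of_discrete (.of_discrete),
    ← measureReal_prod_prod]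
  exact measureReal_mono fun p hp => hT _ hp.1 _ hp.2

lemma poisProd_real_singleton (h : ι → ℝ≥0) (n : ι → ℕ) :
    (poisProd h).real {n} = ∏ c, (Real.exp (-h c) * (h c : ℝ) ^ n c / (n c)!) := by
  rw [measureReal_def, poisProd, Measure.pi_singleton, ENNReal.toReal_prod]
  exact Finset.prod_congr rfl fun c _ => poissonMeasure_real_singleton _ _

lemma poisProd_real_eq_integral (h l : ι → ℝ≥0) (hl : ∀ c, 0 < l c) (S : Set (ι → ℕ)) :
    (poisProd h).real S = ∫ n in S, ∏ c, (Real.exp (l c - h c) * ((h c : ℝ) / l c) ^ n c)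
      ∂poisProd l := by
  set ρ : (ι → ℕ) → ℝ := fun n => ∏ c, (Real.exp (l c - h c) * ((h c : ℝ) / l c) ^ n c) with hρ
  have hρ0 : ∀ n, 0 ≤ ρ n := fun n => Finset.prod_nonneg fun c _ => by positivity
  have key : poisProd h = (poisProd l).withDensity (fun n => ENNReal.ofReal (ρ n)) := by
    refine Measure.ext_of_singleton fun n => ?_
    rw [withDensity_apply _ (MeasurableSet.singleton n), lintegral_singleton,
      ← ofReal_measureReal (μ := poisProd h), ← ofReal_measureReal (μ := poisProd l),
      ← ENNReal.ofReal_mul (hρ0 n), poisProd_real_singleton, poisProd_real_singleton, hρ,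
      ← Finset.prod_mul_distrib]
    congr 1
    refine Finset.prod_congr rfl fun c _ => ?_
    have h0 : (l c : ℝ) ≠ 0 := by have := hl c; positivity
    have e : Real.exp (-(h c : ℝ)) = Real.exp (l c - h c) * Real.exp (-l c) := by
      rw [← Real.exp_add]; congr 1; ring
    rw [e, div_pow]
    field_simp
  rw [measureReal_def, key, withDensity_apply _ .of_discrete,
    integral_eq_lintegral_of_nonneg_ae (Filter.Eventually.of_forall hρ0)
      (Measurable.of_discrete.aestronglyMeasurable)]

/-- Change of intensity: an event that is likely for Poisson counts with means `h` is not too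
unlikely for Poisson counts with means `l`. -/
lemma sq_poisProd_le (h l : ι → ℝ≥0) (hl : ∀ c, 0 < l c) (S : Set (ι → ℕ)) :
    (poisProd h).real S ^ 2 ≤
      Real.exp (∑ c, ((h c : ℝ) - l c) ^ 2 / l c) * (poisProd l).real S := by
  set ρ : (ι → ℕ) → ℝ := fun n => ∏ c, (Real.exp (l c - h c) * ((h c : ℝ) / l c) ^ n c) with hρ
  have hρ0 : ∀ n, 0 ≤ ρ n := fun n => Finset.prod_nonneg fun c _ => by positivity
  have hsq : ∀ n, ρ n ^ 2 = ∏ c, (Real.exp (l c - h c) * ((h c : ℝ) / l c) ^ n c) ^ 2 :=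
    fun n => by rw [hρ, Finset.prod_pow]
  have hint1 : ∀ c, Integrable (fun n : ℕ => (Real.exp (l c - h c) * ((h c : ℝ) / l c) ^ n) ^ 2)
      (poissonMeasure (l c)) := fun c => by
    rw [integrable_poissonMeasure_iff]
    refine (hasSum_poisson_chiSq (h c) (l c) (hl c)).summable.congr fun n => ?_
    rw [Real.norm_of_nonneg (by positivity)]
  have hI2 : Integrable (fun n => ρ n ^ 2) (poisProd l) := by
    simp only [hsq]
    exact Integrable.fintype_prod hint1
  have hI : Integrable ρ (poisProd l) :=
    ((memLp_two_iff_integrable_sq (Measurable.of_discrete.aestronglyMeasurable)).2 hI2).integrable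
      (by norm_num)
  have hE : ∫ n, ρ n ^ 2 ∂poisProd l = Real.exp (∑ c, ((h c : ℝ) - l c) ^ 2 / l c) := by
    simp only [hsq]
    rw [poisProd, integral_fintype_prod_eq_prod (fun c (n : ℕ) =>
      (Real.exp (l c - h c) * ((h c : ℝ) / l c) ^ n) ^ 2), Real.exp_sum]
    refine Finset.prod_congr rfl fun c _ => ?_
    rw [integral_poissonMeasure]
    exact (hasSum_poisson_chiSq (h c) (l c) (hl c)).tsum_eq
  set E := Real.exp (∑ c, ((h c : ℝ) - l c) ^ 2 / l c) with hEd
  have hEpos : 0 < E := Real.exp_pos _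
  set p := (poisProd h).real S with hp
  set q := (poisProd l).real S with hq
  -- Cauchy–Schwarz for `∫_S ρ`, obtained by integrating `2 c ρ ≤ c ^ 2 ρ ^ 2 + 1` over `S` with the
  -- optimal `c = p / E`.
  have main : p * (2 * (p / E)) ≤ (p / E) ^ 2 * E + q := by
    have h1 : p * (2 * (p / E)) = ∫ n in S, ρ n * (2 * (p / E)) ∂poisProd l := by
      rw [hp, poisProd_real_eq_integral h l hl S, integral_mul_const]
    rw [h1]
    calc ∫ n in S, ρ n * (2 * (p / E)) ∂poisProd l
        ≤ ∫ n in S, ((p / E) ^ 2 * ρ n ^ 2 + 1) ∂poisProd l := by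
          refine integral_mono ((hI.mul_const _).integrableOn)
            (((hI2.const_mul _).add (integrable_const 1)).integrableOn) fun n => ?_
          nlinarith [sq_nonneg (p / E * ρ n - 1)]
      _ = (p / E) ^ 2 * (∫ n in S, ρ n ^ 2 ∂poisProd l) + q := by
          rw [integral_add (hI2.const_mul _).integrableOn (integrable_const 1),
            integral_const_mul]
          simp [hq]
      _ ≤ (p / E) ^ 2 * E + q := by
          rw [← hE]
          refine add_le_add_left (mul_le_mul_of_nonneg_left ?_ (sq_nonneg _)) _
          exact setIntegral_le_integral hI2 (Filter.Eventually.of_forall fun n => sq_nonneg _)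
  have e1 : p * (2 * (p / E)) = 2 * (p ^ 2 / E) := by ring
  have e2 : (p / E) ^ 2 * E = p ^ 2 / E := by field_simp
  rw [e1, e2] at main
  have h3 : p ^ 2 / E ≤ q := by linarith
  rw [div_le_iff₀ hEpos] at h3
  linarith

end Product

/-! ### Concentration of total moments near a single value -/

section Concentration

/-- Pigeonhole form of Chebyshev's inequality: a random vector with small variances is within `δ`
of one of its values, close to its mean, with a probability of order `δ ^ dim`. -/
lemma exists_concentrated {Ω κ : Type*} [MeasurableSpace Ω] (μ : Measure Ω) [IsProbabilityMeasure μ]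
    [Fintype κ] [Nonempty κ] (X : Ω → κ → ℝ) (hX : ∀ α, MemLp (fun ω => X ω α) 2 μ)
    (hXm : ∀ α, Measurable (fun ω => X ω α))
    (m : κ → ℝ) (hm : ∀ α, ∫ ω, X ω α ∂μ = m α) (V : ℝ) (hV : 0 < V)
    (hVar : ∀ α, Var[fun ω => X ω α; μ] ≤ V) (δ : ℝ) (hδ : 0 < δ) :
    ∃ ω₀, ‖X ω₀ - m‖ ≤ √(2 * Fintype.card κ * V) ∧
      1 / 2 * (1 / (2 * √(2 * Fintype.card κ * V) / δ + 3)) ^ Fintype.card κ ≤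
        μ.real {ω | ‖X ω - X ω₀‖ ≤ δ} := by
  classical
  set D := Fintype.card κ with hD
  have hD1 : (1 : ℝ) ≤ D := by exact_mod_cast Fintype.card_pos
  -- With this radius, Chebyshev and a union bound over the `D` coordinates lose at most half of the
  -- mass.
  set r := √(2 * D * V) with hr
  have hr0 : 0 < r := Real.sqrt_pos.2 (by positivity)
  have hr2 : r ^ 2 = 2 * D * V := Real.sq_sqrt (by positivity)
  set B : Set Ω := {ω | ∀ α, |X ω α - m α| < r} with hB
  have hBc : μ.real Bᶜ ≤ 1 / 2 := by
    have hsub : Bᶜ ⊆ ⋃ α, {ω | r ≤ |X ω α - m α|} := by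
      intro ω hω
      simp only [hB, Set.mem_compl_iff, Set.mem_ofPred_eq, not_forall, not_lt] at hω
      simpa using hω
    calc μ.real Bᶜ ≤ μ.real (⋃ α, {ω | r ≤ |X ω α - m α|}) := measureReal_mono hsub
      _ ≤ ∑ α, μ.real {ω | r ≤ |X ω α - m α|} := measureReal_iUnion_fintype_le _
      _ ≤ ∑ _α : κ, V / r ^ 2 := by
          refine Finset.sum_le_sum fun α _ => ?_
          have := meas_ge_le_variance_div_sq (hX α) hr0
          rw [hm α] at this
          refine (ENNReal.toReal_mono ENNReal.ofReal_ne_top this).trans ?_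
          rw [ENNReal.toReal_ofReal (div_nonneg (variance_nonneg _ _) (by positivity))]
          gcongr
          exact hVar α
      _ = 1 / 2 := by
          rw [Finset.sum_const, Finset.card_univ, nsmul_eq_mul, hr2, ← hD]
          field_simp
  have hBm : MeasurableSet B := by
    have : B = ⋂ α, {ω | |X ω α - m α| < r} := by ext; simp [hB]
    rw [this]
    exact MeasurableSet.iInter fun α =>
      measurableSet_lt (((hXm α).sub_const _).abs) measurable_const
  have hB2 : 1 / 2 ≤ μ.real B := by
    have := probReal_compl_eq_one_sub (μ := μ) hBm
    linarith
  -- Cells of side `δ` indexed from `-k` to `k` in each coordinate cover the box of radius `r`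
  -- around the mean.
  set k : ℤ := ⌈r / δ⌉ with hk
  have hk0 : 0 ≤ k := Int.ceil_nonneg (by positivity)
  set F : Finset (κ → ℤ) := Fintype.piFinset fun _ => Finset.Icc (-k) k with hF
  have hFcard : (F.card : ℝ) ≤ (2 * r / δ + 3) ^ D := by
    rw [hF, Fintype.card_piFinset]
    simp only [Int.card_Icc, Finset.prod_const, Finset.card_univ, Nat.cast_pow]
    rw [← hD]
    have e : ((k + 1 - -k).toNat : ℝ) = 2 * (k : ℝ) + 1 := by
      have : (((k + 1 - -k).toNat : ℤ) : ℝ) = ((k + 1 - -k : ℤ) : ℝ) := by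
        rw [Int.toNat_of_nonneg (by omega)]
      rw [Int.cast_natCast] at this
      rw [this]; push_cast; ring
    rw [e]
    have h1 : (k : ℝ) < r / δ + 1 := Int.ceil_lt_add_one _
    have h2 : (0 : ℝ) ≤ k := by exact_mod_cast hk0
    have h3 : 2 * r / δ = 2 * (r / δ) := by ring
    refine pow_le_pow_left₀ (by positivity) ?_ _
    linarith
  let cell : Ω → κ → ℤ := fun ω α => ⌊(X ω α - m α) / δ⌋
  have hcover : B ⊆ ⋃ f ∈ F, (B ∩ {ω | cell ω = f}) := by
    intro ω hω
    simp only [Set.mem_iUnion, Set.mem_inter_iff, Set.mem_ofPred_eq, exists_prop]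
    refine ⟨cell ω, ?_, hω, rfl⟩
    rw [hF, Fintype.mem_piFinset]
    intro α
    have h1 := abs_lt.1 (hω α)
    have h2 : r / δ ≤ k := Int.le_ceil _
    rw [Finset.mem_Icc]
    constructor
    · rw [Int.le_floor]
      push_cast
      have : -(r / δ) ≤ (X ω α - m α) / δ := by
        rw [← neg_div]; exact div_le_div_of_nonneg_right h1.1.le hδ.le
      linarith
    · have : (X ω α - m α) / δ ≤ r / δ := div_le_div_of_nonneg_right h1.2.le hδ.le
      exact_mod_cast (Int.floor_le _).trans (this.trans h2)
  have hFpos : (0 : ℝ) < F.card := by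
    have : (0 : κ → ℤ) ∈ F := by
      rw [hF, Fintype.mem_piFinset]; intro α; simp [hk0]
    exact_mod_cast Finset.card_pos.2 ⟨_, this⟩
  obtain ⟨f, hf, hfB⟩ : ∃ f ∈ F, 1 / (2 * F.card) ≤ μ.real (B ∩ {ω | cell ω = f}) := by
    by_contra! hcon
    have h1 : μ.real B ≤ ∑ f ∈ F, μ.real (B ∩ {ω | cell ω = f}) :=
      (measureReal_mono hcover (measure_ne_top _ _)).trans (measureReal_biUnion_finset_le _ _)
    have h2 : ∑ f ∈ F, μ.real (B ∩ {ω | cell ω = f}) < ∑ f ∈ F, 1 / (2 * (F.card : ℝ)) :=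
      Finset.sum_lt_sum_of_nonempty (Finset.card_pos.1 (by exact_mod_cast hFpos)) hcon
    rw [Finset.sum_const, nsmul_eq_mul] at h2
    have h3 : (F.card : ℝ) * (1 / (2 * F.card)) = 1 / 2 := by field_simp
    linarith
  have hne : (B ∩ {ω | cell ω = f}).Nonempty := by
    by_contra hcon
    rw [Set.not_nonempty_iff_eq_empty] at hcon
    rw [hcon, measureReal_empty] at hfB
    have : 0 < 1 / (2 * (F.card : ℝ)) := by positivity
    linarith
  obtain ⟨ω₀, hω₀B, hω₀⟩ := hne
  refine ⟨ω₀, ?_, ?_⟩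
  · rw [pi_norm_le_iff_of_nonneg hr0.le]
    intro α
    exact (hω₀B α).le
  · calc 1 / 2 * (1 / (2 * r / δ + 3)) ^ D ≤ 1 / (2 * F.card) := by
          rw [one_div_pow, ← one_div_mul_one_div_rev, mul_comm]
          gcongr
      _ ≤ μ.real (B ∩ {ω | cell ω = f}) := hfB
      _ ≤ _ := by
          refine measureReal_mono fun ω hω => ?_
          rw [Set.mem_ofPred_eq, pi_norm_le_iff_of_nonneg hδ.le]
          intro α
          have h1 : cell ω α = cell ω₀ α := by
            rw [show cell ω = f from hω.2, show cell ω₀ = f from hω₀]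
          have h2 := Int.abs_sub_lt_one_of_floor_eq_floor h1
          rw [← sub_div, abs_div, abs_of_pos hδ, div_lt_one hδ] at h2
          rw [Pi.sub_apply, Real.norm_eq_abs]
          have h3 : X ω α - m α - (X ω₀ α - m α) = X ω α - X ω₀ α := by ring
          rw [h3] at h2
          exact h2.le

variable {ι κ : Type*} [Fintype ι]

/-- The total moment `∑ n_c φ(c)` of a configuration with `n_c` points in the cell `c`. -/
def load (φ : ι → κ → ℝ) (n : ι → ℕ) : κ → ℝ := ∑ c, (n c : ℝ) • φ c

lemma load_apply (φ : ι → κ → ℝ) (n : ι → ℕ) (α : κ) : load φ n α = ∑ c, (n c : ℝ) * φ c α := by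
  simp [load, Finset.sum_apply]

lemma load_add (φ : ι → κ → ℝ) (n n' : ι → ℕ) : load φ (n + n') = load φ n + load φ n' := by
  simp [load, add_smul, Finset.sum_add_distrib]

/-- A Poisson variance equals its mean and `|φ c α| ≤ 1`, so each coordinate of the load has
variance at most the total intensity. -/
lemma exists_concentrated_load [Fintype κ] [Nonempty κ] (h : ι → ℝ≥0) (φ : ι → κ → ℝ)
    (hφ : ∀ c α, |φ c α| ≤ 1) (V : ℝ) (hV : 0 < V) (hhV : ∑ c, (h c : ℝ) ≤ V) (δ : ℝ)
    (hδ : 0 < δ) :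
    ∃ n₀, ‖load φ n₀ - ∑ c, (h c : ℝ) • φ c‖ ≤ √(2 * Fintype.card κ * V) ∧
      1 / 2 * (1 / (2 * √(2 * Fintype.card κ * V) / δ + 3)) ^ Fintype.card κ ≤
        (poisProd h).real {n | ‖load φ n - load φ n₀‖ ≤ δ} := by
  have hL : ∀ c (α : κ), MemLp (fun n : ℕ => (n : ℝ) * φ c α) 2 (poissonMeasure (h c)) :=
    fun c α => (memLp_natCast_poisson (h c)).mul_const (φ c α)
  have hL' : ∀ (α : κ) c, MemLp (fun n : ι → ℕ => (n c : ℝ) * φ c α) 2 (poisProd h) :=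
    fun α c => (hL c α).comp_measurePreserving (measurePreserving_eval _ c)
  refine exists_concentrated (poisProd h) (load φ) (fun α => ?_) (fun α => .of_discrete) _
    (fun α => ?_) V hV (fun α => ?_) δ hδ
  · simp only [load_apply]
    exact memLp_finsetSum _ fun c _ => hL' α c
  · simp only [load_apply]
    rw [integral_finsetSum _ fun c _ => (hL' α c).integrable (by norm_num), Finset.sum_apply]
    refine Finset.sum_congr rfl fun c _ => ?_
    rw [integral_mul_const, Pi.smul_apply, smul_eq_mul]
    congr 1
    rw [← integral_natCast_poisson (h c),
      ← (measurePreserving_eval (fun c => poissonMeasure (h c)) c).map_eq,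
      integral_map Measurable.of_discrete.aemeasurable .of_discrete]
    rfl
  · have e : (fun n => load φ n α) = ∑ c, fun n : ι → ℕ => (n c : ℝ) * φ c α := by
      funext n; rw [load_apply, Finset.sum_apply]
    rw [e, poisProd, variance_sum_pi (X := fun c (n : ℕ) => (n : ℝ) * φ c α) fun c => hL c α]
    refine le_trans (Finset.sum_le_sum fun c _ => ?_) hhV
    have : (fun n : ℕ => (n : ℝ) * φ c α) = fun n : ℕ => φ c α * (n : ℝ) := by
      funext n; ring
    rw [this, variance_const_mul, variance_natCast_poisson]
    have := hφ c α
    have h1 : (φ c α) ^ 2 ≤ 1 := (sq_le_one_iff_abs_le_one _).2 this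
    nlinarith [(h c).coe_nonneg]

end Concentration

/-! ### Bootstrap for matching prescribed moments -/

section Matching

/-- A family of moment vectors `φ c` that can be averaged, with bounded densities, to any vector
near `b`, and of which sums of `J` members nearly fill a neighbourhood of `J • b`. -/
structure IsMomentSystem {ι κ : Type*} [Fintype ι] [Fintype κ] (φ : ι → κ → ℝ) (α₀ : κ)
    (b : κ → ℝ) (a G : ℝ) (J : ℕ) (η : ℝ) : Prop where
  abs_le : ∀ c α, |φ c α| ≤ 1
  const : ∀ c, φ c α₀ = 1
  base_const : b α₀ = 1
  norm_base : ‖b‖ ≤ 1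
  nonneg : 0 ≤ η
  steer : ∀ v, ‖v - b‖ ≤ a → ∃ g : ι → ℝ≥0, (∀ c, (g c : ℝ) ≤ G) ∧
    ∑ c, (g c : ℝ) • φ c = (Fintype.card ι : ℝ) • v
  fill : ∀ v, ‖v - b‖ ≤ a → v α₀ = 1 → ∃ c : Fin J → ι, ‖∑ j, φ (c j) - (J : ℝ) • v‖ ≤ η

/-- Each factorial `(n c)!` is at most `N ^ n c`, and these exponents add up to `N`. -/
lemma poisProd_const_singleton_ge {ι : Type*} [Fintype ι] (θ : ℝ≥0) (n : ι → ℕ) (N : ℕ)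
    (hN : ∑ c, n c = N) (hN0 : 0 < N) :
    Real.exp (-(Fintype.card ι * θ)) * (θ / N : ℝ) ^ N ≤ (poisProd fun _ => θ).real {n} := by
  rw [poisProd_real_singleton]
  have hN' : (0 : ℝ) < N := by exact_mod_cast hN0
  have e : Real.exp (-(Fintype.card ι * θ)) * (θ / N : ℝ) ^ N =
      ∏ c : ι, (Real.exp (-(θ : ℝ)) * (θ : ℝ) ^ n c / (N : ℝ) ^ n c) := by
    rw [Finset.prod_div_distrib, Finset.prod_mul_distrib, Finset.prod_const,
      Finset.prod_pow_eq_pow_sum, Finset.prod_pow_eq_pow_sum, hN, ← Real.exp_nat_mul, div_pow,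
      Finset.card_univ, mul_neg, mul_div_assoc]
  rw [e]
  refine Finset.prod_le_prod (fun c _ => by positivity) fun c _ => ?_
  have h1 : n c ≤ N := hN ▸ Finset.single_le_sum (fun _ _ => Nat.zero_le _) (Finset.mem_univ c)
  have h2 : ((n c).factorial : ℝ) ≤ (N : ℝ) ^ n c := by
    exact_mod_cast (Nat.factorial_le_pow (n c)).trans (Nat.pow_le_pow_left h1 _)
  gcongr

lemma load_single_sum {ι κ : Type*} [Fintype ι] [DecidableEq ι] (φ : ι → κ → ℝ) {J : ℕ}
    (c : Fin J → ι) (k : ℕ) :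
    load φ (∑ j, Pi.single (c j) k) = (k : ℝ) • ∑ j, φ (c j) := by
  funext α
  rw [load_apply]
  simp only [Finset.sum_apply, Nat.cast_sum, Finset.sum_mul, Pi.smul_apply, smul_eq_mul,
    Finset.mul_sum]
  rw [Finset.sum_comm]
  refine Finset.sum_congr rfl fun j _ => ?_
  rw [Finset.sum_eq_single (c j)]
  · simp
  · intro i _ hi; simp [hi]
  · simp

/-- The prescription `Y` of the total moment can be met, up to an error of order `δ`, by Poisson
counts of total intensity of order `T`, with a probability at least `exp (-C T ^ (2 ^ -q) Λ)`. -/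
def Matchable (κ : Type*) [Fintype κ] (α₀ : κ) (b : κ → ℝ) (a G : ℝ) (J q : ℕ) (C T₀ : ℝ) : Prop :=
  ∀ (ι : Type) [Fintype ι] [Nonempty ι] (φ : ι → κ → ℝ) (η : ℝ),
    IsMomentSystem φ α₀ b a G J η → ∀ T δ Λ : ℝ, T₀ ≤ T → 0 < δ → δ ≤ 1 → η * T ≤ δ →
    Real.log (Fintype.card ι) ≤ Λ → Real.log T ≤ Λ → -Real.log δ ≤ Λ → 1 ≤ Λ →
    ∀ Y : κ → ℝ, ‖Y - T • b‖ ≤ a / 8 * T → (∃ n : ℤ, Y α₀ = n) →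
    ∃ h : ι → ℝ≥0, (∀ c, (h c : ℝ) ≤ C * T / Fintype.card ι) ∧
      Real.exp (-(C * T ^ ((1 / 2 : ℝ) ^ q) * Λ)) ≤
        (poisProd h).real {n | ‖load φ n - Y‖ ≤ C * δ}

variable {κ : Type*} [Fintype κ] {α₀ : κ} {b : κ → ℝ} {a G : ℝ} {J : ℕ}

-- The bootstrap starts from one explicit configuration: `J` cells whose moments sum almost to `J •
-- v`, each taken `k` times, and `r` further points in one cell to reach exactly the integer `Y α₀ =
-- J * k + r`. Its `N ≤ 2 * T` points each contribute a factor at least `exp (-2Λ)` to its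
-- probability, whence a cost of order `T * Λ`.
set_option maxHeartbeats 400000 in
lemma matchable_zero (ha : 0 < a) (ha' : a ≤ 1 / 2) (hJ : 0 < J) :
    Matchable κ α₀ b a G J 0 5 (8 * J / a) := by
  classical
  intro ι _ _ φ η hS T δ Λ hT hδ hδ1 hηT hcard hlogT hlogδ hΛ Y hY ⟨n, hn⟩
  have hJ' : (1 : ℝ) ≤ J := by exact_mod_cast hJ
  have hT8 : 8 * J ≤ T * a := by rwa [div_le_iff₀ ha] at hT
  have hT0 : 0 < T := by
    by_contra hcon
    push Not at hcon
    nlinarith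
  have hTJ : 16 * J ≤ T := by nlinarith
  have hT16 : 16 ≤ T := by linarith
  have hn1 : |(n : ℝ) - T| ≤ a / 8 * T := by
    have := (norm_le_pi_norm (Y - T • b) α₀).trans hY
    rwa [Pi.sub_apply, Pi.smul_apply, smul_eq_mul, hS.base_const, mul_one, hn] at this
  have hn2 := abs_le.1 hn1
  have haT : a / 8 * T ≤ T / 16 := by nlinarith
  have hnpos : 0 < n := by
    have : (0 : ℝ) < n := by linarith
    exact_mod_cast this
  obtain ⟨N, rfl⟩ : ∃ N : ℕ, n = N := ⟨n.toNat, (Int.toNat_of_nonneg hnpos.le).symm⟩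
  simp only [Int.cast_natCast] at hn hn1 hn2
  set k := N / J with hk
  set r := N % J with hr
  have hkr : J * k + r = N := Nat.div_add_mod N J
  have hkr' : (J : ℝ) * k + r = N := by exact_mod_cast hkr
  have hrJ : (r : ℝ) ≤ J := by exact_mod_cast (Nat.mod_lt N hJ).le
  have hr0 : (0 : ℝ) ≤ r := Nat.cast_nonneg _
  have hJk : T / 2 ≤ J * k := by linarith
  have hJk0 : (0 : ℝ) < J * k := by linarith
  have hk0 : (0 : ℝ) ≤ k := Nat.cast_nonneg _
  obtain ⟨c₀⟩ := ‹Nonempty ι›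
  have hφ0 : ‖φ c₀‖ ≤ 1 := (pi_norm_le_iff_of_nonneg zero_le_one).2 fun α => hS.abs_le c₀ α
  -- The moment per point still to be produced once the `r` leftover points are placed. Its constant
  -- coordinate is exactly `1`, as `fill` demands, and the lower bound on `T` keeps it within `a` of
  -- `b`.
  set v : κ → ℝ := ((J : ℝ) * k)⁻¹ • (Y - (r : ℝ) • φ c₀) with hv
  have hv1 : ((J : ℝ) * k) • v = Y - (r : ℝ) • φ c₀ := by
    rw [hv, smul_smul, mul_inv_cancel₀ hJk0.ne', one_smul]
  have hvb : ‖v - b‖ ≤ a := by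
    have e : ((J : ℝ) * k) • (v - b) =
        (Y - T • b) - (r : ℝ) • φ c₀ + (T - J * k) • b := by
      rw [smul_sub, hv1, sub_smul]; abel
    have h1 : ‖((J : ℝ) * k) • (v - b)‖ ≤ a / 8 * T + r * 1 + |T - J * k| * 1 := by
      rw [e]
      refine (norm_add_le _ _).trans (add_le_add ((norm_sub_le _ _).trans (add_le_add hY ?_)) ?_)
      · rw [norm_smul, Real.norm_of_nonneg hr0]
        gcongr
      · rw [norm_smul, Real.norm_eq_abs]
        exact mul_le_mul_of_nonneg_left hS.norm_base (abs_nonneg _)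
    rw [norm_smul, Real.norm_of_nonneg hJk0.le] at h1
    have h2 : |T - J * k| ≤ a / 8 * T + J := by
      rw [abs_le]; constructor <;> linarith
    have h3 : (T / 2) * ‖v - b‖ ≤ J * k * ‖v - b‖ := by gcongr
    have h4 : T / 2 * ‖v - b‖ ≤ T / 2 * a := by linarith
    exact le_of_mul_le_mul_left h4 (by linarith)
  have hvα : v α₀ = 1 := by
    rw [hv, Pi.smul_apply, Pi.sub_apply, Pi.smul_apply, hS.const, hn, smul_eq_mul, smul_eq_mul,
      mul_one, ← hkr', add_sub_cancel_right, inv_mul_cancel₀ hJk0.ne']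
  obtain ⟨c, hc⟩ := hS.fill v hvb hvα
  set cfg : ι → ℕ := (∑ j, Pi.single (c j) k) + Pi.single c₀ r with hcfg
  have hsum : ∑ i, cfg i = N := by
    simp only [hcfg, Pi.add_apply, Finset.sum_add_distrib, Finset.sum_apply]
    rw [Finset.sum_comm]
    simp [hkr]
  have hload1 : load φ (Pi.single c₀ r) = (r : ℝ) • φ c₀ := by
    have := load_single_sum φ (fun _ : Fin 1 => c₀) r
    simpa using this
  have hload : load φ cfg - Y = (k : ℝ) • (∑ j, φ (c j) - (J : ℝ) • v) := by
    rw [hcfg, load_add, load_single_sum, hload1, smul_sub, smul_smul, mul_comm (k : ℝ), hv1]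
    abel
  have hkN : (k : ℝ) ≤ 2 * T := by
    have : (k : ℝ) ≤ N := by exact_mod_cast Nat.div_le_self N J
    linarith
  have hmem : cfg ∈ {n | ‖load φ n - Y‖ ≤ 5 * δ} := by
    rw [Set.mem_ofPred_eq, hload, norm_smul, Real.norm_of_nonneg hk0]
    calc (k : ℝ) * ‖∑ j, φ (c j) - (J : ℝ) • v‖ ≤ 2 * T * η := by gcongr
      _ ≤ 5 * δ := by linarith
  have hcard0 : (0 : ℝ) < Fintype.card ι := by exact_mod_cast Fintype.card_pos
  obtain ⟨θ, hθ⟩ : ∃ θ : ℝ≥0, (θ : ℝ) = T / Fintype.card ι := ⟨⟨_, by positivity⟩, rfl⟩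
  refine ⟨fun _ => θ, fun _ => ?_, ?_⟩
  · rw [hθ]
    gcongr
    linarith
  have hN0 : 0 < N := by exact_mod_cast hnpos
  have hNr : (0 : ℝ) < N := by exact_mod_cast hN0
  refine le_trans ?_ (measureReal_mono (Set.singleton_subset_iff.2 hmem) (measure_ne_top _ _))
  refine le_trans ?_ (poisProd_const_singleton_ge _ cfg N hsum hN0)
  rw [hθ, mul_div_cancel₀ _ hcard0.ne', pow_zero, Real.rpow_one]
  have hq : (0 : ℝ) < T / Fintype.card ι / N := by positivity
  have h5 : (T / Fintype.card ι / N : ℝ) ^ N = Real.exp (N * Real.log (T / Fintype.card ι / N)) := by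
    rw [Real.exp_nat_mul, Real.exp_log hq]
  rw [h5, ← Real.exp_add, Real.exp_le_exp]
  have h6 : -(2 * Λ) ≤ Real.log (T / Fintype.card ι / N) := by
    have h7 : (1 / 2 : ℝ) / Fintype.card ι ≤ T / Fintype.card ι / N := by
      rw [div_right_comm T]
      refine div_le_div_of_nonneg_right ?_ hcard0.le
      rw [div_le_div_iff₀ (by norm_num) hNr]
      linarith
    have h8 := Real.log_le_log (by positivity) h7
    rw [Real.log_div (by norm_num) hcard0.ne', Real.log_div (by norm_num) (by norm_num),
      Real.log_one] at h8
    have := Real.log_two_lt_d9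
    linarith
  have h9 : (N : ℝ) ≤ 2 * T := by linarith
  have h10 : (N : ℝ) * (2 * Λ) ≤ 2 * T * (2 * Λ) := by gcongr
  have h11 : (N : ℝ) * -(2 * Λ) ≤ N * Real.log (T / Fintype.card ι / N) := by gcongr
  have h12 : T * 1 ≤ T * Λ := by gcongr
  linarith

/-- The ratio between `√T` and the size of the part that corrects fluctuations of order `√T`. -/
noncomputable def corrFactor (D : ℕ) (a : ℝ) : ℝ := 16 / a * √D

/-- The cost of concentrating the moments near one value. -/
noncomputable def pigeonCost (D : ℕ) : ℝ := 1 + D * (Real.log (4 * √D + 3) + 2)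

/-- The number of pigeonholes for total intensity `2 * T` is at most a constant times a fixed power
of `T / δ`, so its logarithm is `O(Λ)`. -/
lemma pigeonCost_bound (D : ℕ) (hD : 0 < D) (T δ Λ : ℝ) (hT : 1 ≤ T) (hδ : 0 < δ) (hδ1 : δ ≤ 1)
    (hlogT : Real.log T ≤ Λ) (hlogδ : -Real.log δ ≤ Λ) (hΛ : 1 ≤ Λ) :
    Real.exp (-(pigeonCost D * Λ)) ≤
      1 / 2 * (1 / (2 * √(2 * D * (2 * T)) / δ + 3)) ^ D := by
  have hT0 : 0 < T := by linarith
  have h1 : √(2 * D * (2 * T)) = 2 * (√D * √T) := by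
    rw [show 2 * (D : ℝ) * (2 * T) = 2 ^ 2 * (D * T) by ring, Real.sqrt_mul (by norm_num),
      Real.sqrt_sq (by norm_num), Real.sqrt_mul (by positivity)]
  have hsT : √T ≤ T := by
    rw [Real.sqrt_le_left (by linarith)]; nlinarith
  have h2 : 2 * √(2 * D * (2 * T)) / δ + 3 ≤ (4 * √D + 3) * (T / δ) := by
    have h3 : 1 ≤ T / δ := by rw [le_div_iff₀ hδ]; linarith
    have h4 : 2 * √(2 * D * (2 * T)) / δ = 4 * √D * (√T / δ) := by rw [h1]; ring
    rw [h4, add_mul]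
    have : 4 * √D * (√T / δ) ≤ 4 * √D * (T / δ) := by gcongr
    linarith
  have h5 : 0 < 2 * √(2 * D * (2 * T)) / δ + 3 := by positivity
  have h6 : Real.log (2 * √(2 * D * (2 * T)) / δ + 3) ≤ (Real.log (4 * √D + 3) + 2) * Λ := by
    refine (Real.log_le_log h5 h2).trans ?_
    rw [Real.log_mul (by positivity) (by positivity), Real.log_div (by positivity) (by positivity)]
    have : 0 ≤ Real.log (4 * √D + 3) := Real.log_nonneg (by linarith [Real.sqrt_nonneg (D : ℝ)])
    nlinarith
  have h7 : (1 / (2 * √(2 * D * (2 * T)) / δ + 3)) ^ D =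
      Real.exp (D * -Real.log (2 * √(2 * D * (2 * T)) / δ + 3)) := by
    rw [Real.exp_nat_mul, Real.exp_neg, Real.exp_log h5, one_div]
  have h8 : (1 / 2 : ℝ) = Real.exp (-Real.log 2) := by
    rw [Real.exp_neg, Real.exp_log (by norm_num)]; norm_num
  rw [h7, h8, ← Real.exp_add, Real.exp_le_exp, pigeonCost]
  have h9 := Real.log_two_lt_d9
  have h10 : (D : ℝ) * Real.log (2 * √(2 * D * (2 * T)) / δ + 3) ≤
      D * ((Real.log (4 * √D + 3) + 2) * Λ) := by gcongr
  nlinarith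

/-- One round of the bootstrap. The mean moment of `h₀` falls short of `Y` by `T₁ • b`, where `T₁`
is a multiple of `√T`. The load of `h₀` is pinned near a value `load φ n₀`, and `hM` with `T₁`
points supplies the deficit `Y - load φ n₀`. The factor `corrFactor` makes the fluctuation bound
equal to the tolerance `a / 8 * T₁` of `hM`; passing from `T` to `√T` halves the exponent. -/
lemma Matchable.correct [Nonempty κ] {q : ℕ} {C T₀ : ℝ} (hM : Matchable κ α₀ b a G J q C T₀)
    (ha : 0 < a) (ha' : a ≤ 1 / 2) (hC : 0 ≤ C) (hT₀ : 1 ≤ T₀)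
    {ι : Type} [Fintype ι] [Nonempty ι] {φ : ι → κ → ℝ} {η : ℝ}
    (hS : IsMomentSystem φ α₀ b a G J η) {T δ Λ : ℝ} (hT : T₀ ^ 2 ≤ T)
    (hAT : corrFactor (Fintype.card κ) a * √T ≤ T) (hδ : 0 < δ) (hδ1 : δ ≤ 1)
    (hηT : η * T ≤ δ) (hcard : Real.log (Fintype.card ι) ≤ Λ) (hlogT : Real.log T ≤ Λ)
    (hlogδ : -Real.log δ ≤ Λ) (hΛ : 1 ≤ Λ) (Y : κ → ℝ) (hYint : ∃ n : ℤ, Y α₀ = n)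
    (h₀ : ι → ℝ≥0) (hmass : ∑ c, (h₀ c : ℝ) ≤ 2 * T)
    (hmean : ∑ c, (h₀ c : ℝ) • φ c = Y - (corrFactor (Fintype.card κ) a * √T) • b) :
    ∃ h : ι → ℝ≥0,
      (∀ c, (h c : ℝ) ≤ C * (corrFactor (Fintype.card κ) a * √T) / Fintype.card ι) ∧
      Real.exp (-((pigeonCost (Fintype.card κ) + C * corrFactor (Fintype.card κ) a) *
        T ^ ((1 / 2 : ℝ) ^ (q + 1)) * Λ)) ≤
        (poisProd (h₀ + h)).real {n | ‖load φ n - Y‖ ≤ (C + 1) * δ} := by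
  set D := Fintype.card κ with hD
  have hD0 : 0 < D := Fintype.card_pos
  have hD1 : (1 : ℝ) ≤ D := by exact_mod_cast hD0
  set A := corrFactor D a with hA
  have hA1 : 1 ≤ A := by
    rw [hA, corrFactor]
    have h1 : 1 ≤ 16 / a := by rw [le_div_iff₀ ha]; linarith
    have h2 : 1 ≤ √(D : ℝ) := Real.one_le_sqrt.2 hD1
    nlinarith
  have hT1 : 1 ≤ T := by nlinarith
  have hT0 : 0 < T := by linarith
  have hsT : T₀ ≤ √T := Real.le_sqrt_of_sq_le hT
  have hsT0 : 0 ≤ √T := Real.sqrt_nonneg _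
  set T₁ := A * √T with hT₁
  have hT₁0 : T₀ ≤ T₁ := by nlinarith
  obtain ⟨n₀, hn₀, hp₀⟩ := exists_concentrated_load h₀ φ hS.abs_le (2 * T) (by linarith) hmass δ hδ
  rw [← hD] at hn₀ hp₀
  have hfluct : √(2 * D * (2 * T)) = a / 8 * T₁ := by
    rw [hT₁, hA, corrFactor, show 2 * (D : ℝ) * (2 * T) = 2 ^ 2 * (D * T) by ring,
      Real.sqrt_mul (by norm_num), Real.sqrt_sq (by norm_num), Real.sqrt_mul (by positivity)]
    field_simp
    ring
  -- The coordinate `α₀` counts points, so the deficit again asks for an integer number of them.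
  have hint : ∃ k : ℤ, (Y - load φ n₀) α₀ = k := by
    obtain ⟨k, hk⟩ := hYint
    refine ⟨k - ∑ c, (n₀ c : ℤ), ?_⟩
    rw [Pi.sub_apply, hk, load_apply]
    simp [hS.const]
  have hclose : ‖(Y - load φ n₀) - T₁ • b‖ ≤ a / 8 * T₁ := by
    rw [← hfluct, ← norm_neg]
    refine le_trans (le_of_eq ?_) hn₀
    rw [hmean]
    congr 1
    abel
  have hlogT₁ : Real.log T₁ ≤ Λ := (Real.log_le_log (by linarith) hAT).trans hlogT
  have hη : η * T₁ ≤ δ := (mul_le_mul_of_nonneg_left hAT hS.nonneg).trans hηT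
  obtain ⟨h, hh, hp⟩ := hM ι φ η hS T₁ δ Λ hT₁0 hδ hδ1 hη hcard hlogT₁ hlogδ hΛ _ hclose hint
  refine ⟨h, hh, ?_⟩
  refine le_trans ?_ (mul_le_poisProd_add h₀ h (S := {n | ‖load φ n - load φ n₀‖ ≤ δ})
    (S' := {n | ‖load φ n - (Y - load φ n₀)‖ ≤ C * δ}) ?_)
  · refine le_trans ?_ (mul_le_mul ((pigeonCost_bound D hD0 T δ Λ hT1 hδ hδ1 hlogT hlogδ hΛ).trans
      hp₀) hp (Real.exp_nonneg _) measureReal_nonneg)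
    rw [← Real.exp_add, Real.exp_le_exp]
    set s : ℝ := (1 / 2 : ℝ) ^ q with hs
    have hs0 : 0 < s := by positivity
    have hs1 : s ≤ 1 := pow_le_one₀ (by norm_num) (by norm_num)
    have e1 : T ^ ((1 / 2 : ℝ) ^ (q + 1)) = (√T) ^ s := by
      rw [Real.sqrt_eq_rpow, ← Real.rpow_mul hT0.le, pow_succ, mul_comm]
    have e2 : T₁ ^ s ≤ A * (√T) ^ s := by
      rw [hT₁, Real.mul_rpow (by linarith) hsT0]
      gcongr
      calc A ^ s ≤ A ^ (1 : ℝ) := Real.rpow_le_rpow_of_exponent_le hA1 hs1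
        _ = A := Real.rpow_one A
    have e3 : 1 ≤ (√T) ^ s := Real.one_le_rpow (Real.one_le_sqrt.2 hT1) hs0.le
    have e4 : 0 ≤ pigeonCost D := by
      have : 0 ≤ Real.log (4 * √D + 3) := Real.log_nonneg (by linarith [Real.sqrt_nonneg (D : ℝ)])
      rw [pigeonCost]; positivity
    rw [e1]
    have e5 : pigeonCost D * Λ ≤ pigeonCost D * (√T) ^ s * Λ := by
      have : pigeonCost D * 1 ≤ pigeonCost D * (√T) ^ s := by gcongr
      rw [mul_one] at this
      gcongr
    have e6 : C * T₁ ^ s * Λ ≤ C * (A * (√T) ^ s) * Λ := by gcongr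
    linarith
  · intro n hn n' hn'
    rw [Set.mem_ofPred_eq] at hn hn' ⊢
    rw [load_add]
    calc ‖load φ n + load φ n' - Y‖
        = ‖(load φ n - load φ n₀) + (load φ n' - (Y - load φ n₀))‖ := by congr 1; abel
      _ ≤ δ + C * δ := (norm_add_le _ _).trans (add_le_add hn hn')
      _ = (C + 1) * δ := by ring

lemma exists_matchable [Nonempty κ] (α₀ : κ) (b : κ → ℝ) (ha : 0 < a) (ha' : a ≤ 1 / 2)
    (hG : 0 ≤ G) (hJ : 0 < J) (q : ℕ) :
    ∃ C T₀ : ℝ, 0 ≤ C ∧ 1 ≤ T₀ ∧ Matchable κ α₀ b a G J q C T₀ := by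
  induction q with
  | zero =>
    refine ⟨5, 8 * J / a, by norm_num, ?_, matchable_zero ha ha' hJ⟩
    have : (1 : ℝ) ≤ J := by exact_mod_cast hJ
    rw [le_div_iff₀ ha]; linarith
  | succ q ih =>
    obtain ⟨C, T₀, hC, hT₀, hM⟩ := ih
    set D := Fintype.card κ with hD
    set A := corrFactor D a with hA
    have hA0 : 0 ≤ A := by rw [hA, corrFactor]; positivity
    have hP0 : 0 ≤ pigeonCost D := by
      have : 0 ≤ Real.log (4 * √D + 3) := Real.log_nonneg (by linarith [Real.sqrt_nonneg (D : ℝ)])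
      rw [pigeonCost]; positivity
    have hCA0 : 0 ≤ C * A := by positivity
    -- The term `T₀ ^ 2` puts the corrector `A * √T` above the threshold of the previous round; `(2
    -- * A / a) ^ 2` makes it at most `a / 2 * T`, so that the normalized target of `steer` stays
    -- within `a` of `b`.
    refine ⟨G + C + 1 + (pigeonCost D + C * A), T₀ ^ 2 + (2 * A / a) ^ 2, by positivity, ?_, ?_⟩
    · nlinarith [sq_nonneg (2 * A / a)]
    intro ι _ _ φ η hS T δ Λ hT hδ hδ1 hηT hcard hlogT hlogδ hΛ Y hY hYint
    have hT1 : T₀ ^ 2 ≤ T := by nlinarith [sq_nonneg (2 * A / a)]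
    have hT2 : (2 * A / a) ^ 2 ≤ T := by nlinarith
    have hTpos : 0 < T := by nlinarith
    have hs : 2 * A / a ≤ √T := Real.le_sqrt_of_sq_le hT2
    have hAT : A * √T ≤ a / 2 * T := by
      rw [div_le_iff₀ ha] at hs
      have := Real.mul_self_sqrt hTpos.le
      nlinarith [Real.sqrt_nonneg T]
    have hAT' : A * √T ≤ T := by nlinarith
    have hcard0 : (0 : ℝ) < Fintype.card ι := by exact_mod_cast Fintype.card_pos
    set T₁ := A * √T with hT₁
    have hT₁0 : 0 ≤ T₁ := by positivity
    obtain ⟨g, hg, hgsum⟩ := hS.steer (T⁻¹ • (Y - T₁ • b)) (by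
      have e : T⁻¹ • (Y - T₁ • b) - b = T⁻¹ • ((Y - T • b) - T₁ • b) := by
        rw [sub_right_comm, smul_sub T⁻¹ (Y - T₁ • b), smul_smul, inv_mul_cancel₀ hTpos.ne',
          one_smul]
      rw [e, norm_smul, norm_inv, Real.norm_of_nonneg hTpos.le, inv_mul_le_iff₀ hTpos]
      refine (norm_sub_le _ _).trans ?_
      rw [norm_smul, Real.norm_of_nonneg hT₁0]
      nlinarith [hS.norm_base, norm_nonneg b])
    obtain ⟨τ, hτ⟩ : ∃ τ : ℝ≥0, (τ : ℝ) = T / Fintype.card ι := ⟨⟨_, by positivity⟩, rfl⟩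
    have hmean : ∑ c, ((τ * g c : ℝ≥0) : ℝ) • φ c = Y - T₁ • b := by
      simp only [NNReal.coe_mul, ← smul_smul]
      rw [← Finset.smul_sum, hgsum, smul_smul, smul_smul, hτ]
      rw [div_mul_cancel₀ _ hcard0.ne', mul_inv_cancel₀ hTpos.ne', one_smul]
    have hmass : ∑ c, ((τ * g c : ℝ≥0) : ℝ) ≤ 2 * T := by
      have h1 := congrFun hmean α₀
      rw [Finset.sum_apply] at h1
      simp only [Pi.smul_apply, hS.const, smul_eq_mul, mul_one, Pi.sub_apply, hS.base_const] at h1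
      rw [h1]
      have h2 := (abs_le.1 ((norm_le_pi_norm (Y - T • b) α₀).trans hY)).2
      rw [Pi.sub_apply, Pi.smul_apply, smul_eq_mul, hS.base_const, mul_one] at h2
      nlinarith
    obtain ⟨h, hh, hp⟩ := hM.correct ha ha' hC hT₀ hS hT1 hAT' hδ hδ1 hηT hcard hlogT hlogδ hΛ Y
      hYint (fun c => τ * g c) hmass hmean
    refine ⟨_, fun c => ?_, le_trans ?_ (hp.trans (measureReal_mono fun n hn => ?_))⟩
    · rw [Pi.add_apply, NNReal.coe_add, NNReal.coe_mul, hτ]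
      have h1 : T / Fintype.card ι * g c ≤ T / Fintype.card ι * G := by gcongr; exact hg c
      have h2 : C * T₁ / Fintype.card ι ≤ C * T / Fintype.card ι := by gcongr
      have h3 := hh c
      calc T / Fintype.card ι * (g c : ℝ) + h c ≤ T / Fintype.card ι * G + C * T / Fintype.card ι :=
            by linarith
        _ = (G + C) * T / Fintype.card ι := by ring
        _ ≤ _ := by
          refine div_le_div_of_nonneg_right (mul_le_mul_of_nonneg_right ?_ hTpos.le) hcard0.le
          linarith
    · rw [Real.exp_le_exp, neg_le_neg_iff, ← hD, ← hA]
      refine mul_le_mul_of_nonneg_right (mul_le_mul_of_nonneg_right ?_ (by positivity))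
        (by linarith)
      linarith
    · rw [Set.mem_ofPred_eq] at hn ⊢
      refine hn.trans (mul_le_mul_of_nonneg_right ?_ hδ.le)
      linarith

set_option maxHeartbeats 400000 in
/-- Independent Poisson counts with equal means meet their mean total moment, up to an error of
order `δ`, with a probability that is not too small. -/
theorem exists_uniform_match [Nonempty κ] (α₀ : κ) (b : κ → ℝ) (ha : 0 < a) (ha' : a ≤ 1 / 2)
    (hG : 0 ≤ G) (hJ : 0 < J) (q : ℕ) :
    ∃ C N₀ : ℝ, 0 < C ∧ 1 ≤ N₀ ∧ ∀ (ι : Type) [Fintype ι] [Nonempty ι] (φ : ι → κ → ℝ) (η : ℝ),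
      IsMomentSystem φ α₀ b a G J η → ∀ (N : ℕ) (δ Λ : ℝ), N₀ ≤ N → 0 < δ → δ ≤ 1 → η * N ≤ δ →
      Real.log (Fintype.card ι) ≤ Λ → Real.log N ≤ Λ → -Real.log δ ≤ Λ → 1 ≤ Λ →
      Real.exp (-(C * (N : ℝ) ^ ((1 / 2 : ℝ) ^ (q + 1)) * Λ)) ≤
        (poisProd fun _ : ι => ((N : ℝ≥0) / (Fintype.card ι : ℝ≥0))).real
          {n | ‖load φ n - ((N : ℝ) / Fintype.card ι) • ∑ c, φ c‖ ≤ C * δ} := by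
  obtain ⟨C, T₀, hC, hT₀, hM⟩ := exists_matchable α₀ b ha ha' hG hJ q
  set D := Fintype.card κ with hD
  set A := corrFactor D a with hA
  have hA0 : 0 ≤ A := by rw [hA, corrFactor]; positivity
  have hP0 : 0 ≤ pigeonCost D := by
    have : 0 ≤ Real.log (4 * √D + 3) := Real.log_nonneg (by linarith [Real.sqrt_nonneg (D : ℝ)])
    rw [pigeonCost]; positivity
  -- The factor `2` comes from the square in `sq_poisProd_le`, and `(G + C) ^ 2 * A ^ 2` is the `χ²`
  -- cost. The threshold `((1 + G) * A) ^ 2` ensures that there is enough uniform intensity to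
  -- remove `τ * g c`.
  refine ⟨C + 1 + 2 * (pigeonCost D + C * A) + (G + C) ^ 2 * A ^ 2,
    T₀ ^ 2 + ((1 + G) * A) ^ 2, by positivity, ?_, ?_⟩
  · nlinarith [sq_nonneg ((1 + G) * A)]
  intro ι _ _ φ η hS N δ Λ hN hδ hδ1 hηN hcard hlogN hlogδ hΛ
  have hN1 : T₀ ^ 2 ≤ N := by nlinarith [sq_nonneg ((1 + G) * A)]
  have hN2 : ((1 + G) * A) ^ 2 ≤ N := by nlinarith
  have hN3 : (1 : ℝ) ≤ N := by nlinarith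
  have hNpos : (0 : ℝ) < N := by linarith
  have hs : (1 + G) * A ≤ √N := Real.le_sqrt_of_sq_le hN2
  have hs0 : 0 ≤ √(N : ℝ) := Real.sqrt_nonneg _
  have hss := Real.mul_self_sqrt hNpos.le
  set T₁ := A * √N with hT₁
  have hT₁0 : 0 ≤ T₁ := by positivity
  have hGT : (1 + G) * T₁ ≤ N := by rw [hT₁]; nlinarith
  have hAT : T₁ ≤ N := by nlinarith
  have hcard0 : (0 : ℝ) < Fintype.card ι := by exact_mod_cast Fintype.card_pos
  obtain ⟨g, hg, hgsum⟩ := hS.steer b (by simpa using ha.le)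
  set l : ℝ≥0 := (N : ℝ≥0) / (Fintype.card ι : ℝ≥0) with hl
  have hlr : (l : ℝ) = N / Fintype.card ι := by rw [hl]; push_cast; rfl
  have hl0 : 0 < (l : ℝ) := by rw [hlr]; positivity
  obtain ⟨τ, hτ⟩ : ∃ τ : ℝ≥0, (τ : ℝ) = T₁ / Fintype.card ι := ⟨⟨_, by positivity⟩, rfl⟩
  have hτg : ∀ c, (τ : ℝ) * g c ≤ G * T₁ / Fintype.card ι := fun c => by
    rw [hτ]
    calc T₁ / Fintype.card ι * (g c : ℝ) ≤ T₁ / Fintype.card ι * G := by gcongr; exact hg c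
      _ = _ := by ring
  have hle : ∀ c, τ * g c ≤ l := fun c => by
    rw [← NNReal.coe_le_coe, NNReal.coe_mul, hlr]
    refine (hτg c).trans ?_
    gcongr
    linarith
  -- The removed part has total moment exactly `T₁ • b`, the shortfall required by
  -- `Matchable.correct`.
  set h₀ : ι → ℝ≥0 := fun c => l - τ * g c with hh₀
  have hh₀r : ∀ c, (h₀ c : ℝ) = l - τ * g c := fun c => by
    rw [hh₀, NNReal.coe_sub (hle c), NNReal.coe_mul]
  set Y : κ → ℝ := ((N : ℝ) / Fintype.card ι) • ∑ c, φ c with hY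
  have hmean : ∑ c, (h₀ c : ℝ) • φ c = Y - T₁ • b := by
    simp only [hh₀r, sub_smul, ← smul_smul]
    rw [Finset.sum_sub_distrib, ← Finset.smul_sum, ← Finset.smul_sum, hgsum, smul_smul, hτ,
      div_mul_cancel₀ _ hcard0.ne', hlr]
  have hmass : ∑ c, (h₀ c : ℝ) ≤ 2 * N := by
    calc ∑ c, (h₀ c : ℝ) ≤ ∑ _c : ι, (N : ℝ) / Fintype.card ι := by
          refine Finset.sum_le_sum fun c _ => ?_
          rw [hh₀r, ← hlr]
          have : 0 ≤ (τ : ℝ) * g c := by positivity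
          linarith
      _ = N := by
          rw [Finset.sum_const, nsmul_eq_mul, Finset.card_univ]
          field_simp
      _ ≤ 2 * N := by linarith
  have hYint : ∃ n : ℤ, Y α₀ = n := by
    refine ⟨N, ?_⟩
    rw [hY, Pi.smul_apply, Finset.sum_apply]
    simp only [hS.const, Finset.sum_const, Finset.card_univ, nsmul_eq_mul, smul_eq_mul, mul_one]
    rw [div_mul_cancel₀ _ hcard0.ne']; simp
  obtain ⟨h, hh, hp⟩ := hM.correct ha ha' hC hT₀ hS hN1 hAT hδ hδ1 hηN hcard hlogN hlogδ hΛ Y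
    hYint h₀ hmass hmean
  -- In every cell the intensity changes by a relative amount `O(N ^ (-1 / 2))`, so the sum is
  -- bounded independently of `N` and of the number of cells.
  have hchi : ∑ c, ((((h₀ + h) c : ℝ≥0) : ℝ) - l) ^ 2 / l ≤ (G + C) ^ 2 * A ^ 2 := by
    have h1 : ∀ c, ((((h₀ + h) c : ℝ≥0) : ℝ) - l) ^ 2 / l ≤
        (G + C) ^ 2 * A ^ 2 / Fintype.card ι := fun c => by
      have h2 : |(((h₀ + h) c : ℝ≥0) : ℝ) - l| ≤ (G + C) * T₁ / Fintype.card ι := by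
        rw [Pi.add_apply, NNReal.coe_add, hh₀r]
        have h3 := hτg c
        have h4 : (h c : ℝ) ≤ C * T₁ / Fintype.card ι := hh c
        have h5 : (0 : ℝ) ≤ h c := (h c).coe_nonneg
        have h6 : 0 ≤ (τ : ℝ) * g c := by positivity
        have h7 : (G + C) * T₁ / Fintype.card ι =
          G * T₁ / Fintype.card ι + C * T₁ / Fintype.card ι := by ring
        rw [h7, abs_le]
        constructor <;> linarith
      rw [← sq_abs]
      calc |(((h₀ + h) c : ℝ≥0) : ℝ) - l| ^ 2 / l ≤ ((G + C) * T₁ / Fintype.card ι) ^ 2 / l := by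
            gcongr
        _ = (G + C) ^ 2 * A ^ 2 * (√N * √N) / N / Fintype.card ι := by
            rw [hlr, hT₁]; field_simp
        _ = (G + C) ^ 2 * A ^ 2 / Fintype.card ι := by rw [hss]; field_simp
    refine (Finset.sum_le_sum fun c _ => h1 c).trans (le_of_eq ?_)
    rw [Finset.sum_const, nsmul_eq_mul, Finset.card_univ]
    field_simp
  have hCS := sq_poisProd_le (h₀ + h) (fun _ => l) (fun _ => hl0)
    {n | ‖load φ n - Y‖ ≤ (C + 1) * δ}
  set E := {n | ‖load φ n - Y‖ ≤ (C + 1) * δ} with hE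
  have hmono : (poisProd fun _ : ι => l).real E ≤ (poisProd fun _ : ι => l).real
      {n | ‖load φ n - Y‖ ≤
        (C + 1 + 2 * (pigeonCost D + C * A) + (G + C) ^ 2 * A ^ 2) * δ} := by
    refine measureReal_mono fun n hn => ?_
    rw [hE, Set.mem_ofPred_eq] at hn
    rw [Set.mem_ofPred_eq]
    refine hn.trans (mul_le_mul_of_nonneg_right ?_ hδ.le)
    have : 0 ≤ 2 * (pigeonCost D + C * A) + (G + C) ^ 2 * A ^ 2 := by positivity
    linarith
  refine le_trans ?_ hmono
  set s : ℝ := (N : ℝ) ^ ((1 / 2 : ℝ) ^ (q + 1)) with hsdef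
  have hs1 : 1 ≤ s := Real.one_le_rpow hN3 (by positivity)
  have h1 := pow_le_pow_left₀ (Real.exp_nonneg _) hp 2
  have h2 := h1.trans (hCS.trans (mul_le_mul_of_nonneg_right (Real.exp_le_exp.2 hchi)
    measureReal_nonneg))
  have h3 : Real.exp (-(2 * ((pigeonCost D + C * A) * s * Λ) + (G + C) ^ 2 * A ^ 2)) ≤
      (poisProd fun _ : ι => l).real E := by
    rw [pow_two, ← Real.exp_add] at h2
    rw [← mul_le_mul_iff_right₀ (Real.exp_pos ((G + C) ^ 2 * A ^ 2)), ← Real.exp_add]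
    refine le_trans (le_of_eq ?_) h2
    congr 1
    ring
  refine le_trans ?_ h3
  rw [Real.exp_le_exp, neg_le_neg_iff]
  have h4 : 1 ≤ s * Λ := one_le_mul_of_one_le_of_one_le hs1 hΛ
  have h5 : (G + C) ^ 2 * A ^ 2 * 1 ≤ (G + C) ^ 2 * A ^ 2 * (s * Λ) :=
    mul_le_mul_of_nonneg_left h4 (by positivity)
  have h6 : 0 ≤ (C + 1) * (s * Λ) := mul_nonneg (by linarith) (by linarith)
  have h7 : (C + 1 + 2 * (pigeonCost D + C * A) + (G + C) ^ 2 * A ^ 2) * s * Λ =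
      (C + 1) * (s * Λ) + 2 * ((pigeonCost D + C * A) * s * Λ) +
        (G + C) ^ 2 * A ^ 2 * (s * Λ) := by ring
  rw [h7]
  linarith

end Matching

/-! ### Monomial moments: interpolation, local surjectivity, and the moment system of a grid -/

section Monomials

/-- The vector of all monomials with exponents at most `m` in each variable. -/
def mono {d : ℕ} (m : ℕ) (u : Fin d → ℝ) : (Fin d → Fin (m + 1)) → ℝ :=
  fun α => ∏ i, u i ^ (α i : ℕ)

/-- The interpolation nodes in the open unit cube. -/
noncomputable def node {d : ℕ} (m : ℕ) (j : Fin d → Fin (m + 1)) : Fin d → ℝ :=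
  fun i => ((j i : ℕ) + 1 : ℝ) / (m + 2)

/-- The polynomial with coefficients `ξ`. -/
noncomputable def polyOf {d m : ℕ} (ξ : (Fin d → Fin (m + 1)) → ℝ) : MvPolynomial (Fin d) ℝ :=
  ∑ α, MvPolynomial.monomial (Finsupp.equivFunOnFinite.symm fun i => (α i : ℕ)) (ξ α)

variable {d m : ℕ}

lemma eval_polyOf (ξ : (Fin d → Fin (m + 1)) → ℝ) (u : Fin d → ℝ) :
    MvPolynomial.eval u (polyOf ξ) = ∑ α, ξ α * mono m u α := by
  simp only [polyOf, map_sum, MvPolynomial.eval_monomial, mono]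
  refine Finset.sum_congr rfl fun α _ => ?_
  rw [Finsupp.prod_fintype _ _ (fun i => pow_zero _)]
  simp

lemma coeff_polyOf (ξ : (Fin d → Fin (m + 1)) → ℝ) (α : Fin d → Fin (m + 1)) :
    (polyOf ξ).coeff (Finsupp.equivFunOnFinite.symm fun i => (α i : ℕ)) = ξ α := by
  classical
  simp only [polyOf, MvPolynomial.coeff_sum, MvPolynomial.coeff_monomial]
  rw [Finset.sum_eq_single α]
  · simp
  · intro β _ hβ
    rw [if_neg]
    intro h
    apply hβ
    funext i
    have := DFunLike.congr_fun h i
    exact Fin.ext (by simpa using this)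
  · simp

lemma support_polyOf (ξ : (Fin d → Fin (m + 1)) → ℝ) (s : Fin d →₀ ℕ)
    (hs : (polyOf ξ).coeff s ≠ 0) (i : Fin d) : s i < m + 1 := by
  classical
  by_contra hcon
  apply hs
  simp only [polyOf, MvPolynomial.coeff_sum, MvPolynomial.coeff_monomial]
  refine Finset.sum_eq_zero fun α _ => if_neg ?_
  rintro rfl
  simp only [Finsupp.equivFunOnFinite_symm_apply_apply] at hcon
  exact hcon (α i).2

/-- The nodes form a product grid with `m + 1` values per coordinate, more than the degree of `P` in
any variable. -/
lemma eq_zero_of_eval_node (P : MvPolynomial (Fin d) ℝ)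
    (hP : ∀ s, P.coeff s ≠ 0 → ∀ i, s i < m + 1)
    (h : ∀ j : Fin d → Fin (m + 1), MvPolynomial.eval (node m j) P = 0) : P = 0 := by
  classical
  set S : Finset ℝ := Finset.univ.image fun k : Fin (m + 1) => ((k : ℕ) + 1 : ℝ) / (m + 2) with hS
  have hcard : S.card = m + 1 := by
    rw [hS, Finset.card_image_of_injective, Finset.card_univ, Fintype.card_fin]
    intro k l hkl
    have h0 : (m : ℝ) + 2 ≠ 0 := by positivity
    simp only [div_left_inj' h0, add_left_inj, Nat.cast_inj] at hkl
    exact Fin.ext hkl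
  refine MvPolynomial.eq_zero_of_eval_zero_at_prod_finset P (fun _ => S) (fun i => ?_) ?_
  · rw [hcard, MvPolynomial.degreeOf_lt_iff (Nat.succ_pos m)]
    intro s hs
    exact hP s (MvPolynomial.mem_support_iff.1 hs) i
  · intro x hx
    have : ∀ i, ∃ k : Fin (m + 1), ((k : ℕ) + 1 : ℝ) / (m + 2) = x i := fun i => by
      simpa [hS] using hx i
    choose j hj using this
    rw [← h j]
    congr 1
    congr 1
    funext i
    exact (hj i).symm

lemma eq_zero_of_node (ξ : (Fin d → Fin (m + 1)) → ℝ)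
    (h : ∀ j : Fin d → Fin (m + 1), ∑ α, ξ α * mono m (node m j) α = 0) : ξ = 0 := by
  have := eq_zero_of_eval_node (polyOf ξ) (support_polyOf ξ) fun j => by rw [eval_polyOf, h]
  funext α
  rw [← coeff_polyOf ξ α, this]
  simp

/-- A partial derivative still has degree at most `m` in each variable, so it vanishes identically.
If `α i ≠ 0`, the coefficient `ξ α` survives in the derivative along `i`, multiplied by a nonzero
integer. -/
lemma eq_zero_of_pderiv_node (ξ : (Fin d → Fin (m + 1)) → ℝ)
    (h : ∀ (j : Fin d → Fin (m + 1)) (i : Fin d),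
      MvPolynomial.eval (node m j) (MvPolynomial.pderiv i (polyOf ξ)) = 0)
    (α : Fin d → Fin (m + 1)) (hα : α ≠ 0) : ξ α = 0 := by
  obtain ⟨i, hi⟩ := Function.ne_iff.1 hα
  have hz := eq_zero_of_eval_node (m := m) (MvPolynomial.pderiv i (polyOf ξ)) (fun s hs k => by
    rw [MvPolynomial.coeff_pderiv] at hs
    have := support_polyOf ξ _ (left_ne_zero_of_mul hs) k
    rw [Finsupp.add_apply] at this
    omega) fun j => h j i
  set s : Fin d →₀ ℕ := Finsupp.equivFunOnFinite.symm fun i => (α i : ℕ) with hs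
  have hsi : 1 ≤ s i := by
    rw [hs, Finsupp.equivFunOnFinite_symm_apply_apply, Nat.one_le_iff_ne_zero]
    intro h0
    exact hi (Fin.ext h0)
  have h1 := congrArg (MvPolynomial.coeff (s - Finsupp.single i 1)) hz
  rw [MvPolynomial.coeff_pderiv, tsub_add_cancel_of_le (Finsupp.single_le_iff.2 hsi), hs,
    coeff_polyOf] at h1
  simp only [MvPolynomial.coeff_zero, mul_eq_zero] at h1
  rcases h1 with h1 | h1
  · exact h1
  · exfalso
    exact (Nat.cast_add_one_ne_zero _) h1

lemma hasDerivAt_eval_line (P : MvPolynomial (Fin d) ℝ) (u : Fin d → ℝ) (i : Fin d) :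
    HasDerivAt (fun t : ℝ => MvPolynomial.eval (u + t • Pi.single i (1 : ℝ)) P)
      (MvPolynomial.eval u (MvPolynomial.pderiv i P)) 0 := by
  induction P using MvPolynomial.induction_on with
  | C a => simpa using hasDerivAt_const (0 : ℝ) a
  | add p q hp hq => simpa using hp.fun_add hq
  | mul_X p k hp =>
    have hX : HasDerivAt (fun t : ℝ => MvPolynomial.eval (u + t • Pi.single i (1 : ℝ))
        (MvPolynomial.X k)) (MvPolynomial.eval u (MvPolynomial.pderiv i (MvPolynomial.X k))) 0 := by
      rw [MvPolynomial.pderiv_X]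
      simp only [MvPolynomial.eval_X, Pi.add_apply, Pi.smul_apply, smul_eq_mul]
      have := ((hasDerivAt_id (0 : ℝ)).mul_const ((Pi.single i (1 : ℝ) : Fin d → ℝ) k)).const_add (u k)
      convert! this using 1
      by_cases hk : k = i
      · subst hk; simp
      · simp [hk]
    have := hp.fun_mul hX
    simp only [map_mul]
    convert! this using 1
    simp
    ring

lemma abs_mono_le_one {u : Fin d → ℝ} (hu : ∀ i, u i ∈ Set.Icc (0 : ℝ) 1)
    (α : Fin d → Fin (m + 1)) : |mono m u α| ≤ 1 := by
  rw [mono, Finset.abs_prod]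
  refine Finset.prod_le_one (fun i _ => abs_nonneg _) fun i _ => ?_
  rw [abs_of_nonneg (pow_nonneg (hu i).1 _)]
  exact pow_le_one₀ (hu i).1 (hu i).2

lemma abs_prod_sub_prod_le {ι : Type*} (s : Finset ι) (f g : ι → ℝ)
    (hf : ∀ i ∈ s, |f i| ≤ 1) (hg : ∀ i ∈ s, |g i| ≤ 1) :
    |∏ i ∈ s, f i - ∏ i ∈ s, g i| ≤ ∑ i ∈ s, |f i - g i| := by
  classical
  induction s using Finset.induction_on with
  | empty => simp
  | insert i s hi ih =>
    rw [Finset.prod_insert hi, Finset.prod_insert hi, Finset.sum_insert hi]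
    have h1 := ih (fun k hk => hf k (Finset.mem_insert_of_mem hk))
      (fun k hk => hg k (Finset.mem_insert_of_mem hk))
    have h2 : |∏ k ∈ s, f k| ≤ 1 := by
      rw [Finset.abs_prod]
      exact Finset.prod_le_one (fun _ _ => abs_nonneg _)
        fun k hk => hf k (Finset.mem_insert_of_mem hk)
    have h3 := hg i (Finset.mem_insert_self i s)
    calc |f i * ∏ k ∈ s, f k - g i * ∏ k ∈ s, g k|
        = |(f i - g i) * ∏ k ∈ s, f k + g i * (∏ k ∈ s, f k - ∏ k ∈ s, g k)| := by
          congr 1; ring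
      _ ≤ |f i - g i| * 1 + 1 * |∏ k ∈ s, f k - ∏ k ∈ s, g k| := by
          refine (abs_add_le _ _).trans ?_
          rw [abs_mul, abs_mul]
          gcongr
      _ ≤ _ := by linarith

lemma abs_mono_sub_le {u w : Fin d → ℝ} (hu : ∀ i, u i ∈ Set.Icc (0 : ℝ) 1)
    (hw : ∀ i, w i ∈ Set.Icc (0 : ℝ) 1) {r : ℝ} (h : ∀ i, |u i - w i| ≤ r)
    (α : Fin d → Fin (m + 1)) : |mono m u α - mono m w α| ≤ d * m * r := by
  have hb : ∀ x ∈ Set.Icc (0 : ℝ) 1, ∀ k : ℕ, |x ^ k| ≤ 1 := fun x hx k => by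
    rw [abs_of_nonneg (pow_nonneg hx.1 _)]
    exact pow_le_one₀ hx.1 hx.2
  have hpow : ∀ x ∈ Set.Icc (0 : ℝ) 1, ∀ y ∈ Set.Icc (0 : ℝ) 1, ∀ k : ℕ,
      |x ^ k - y ^ k| ≤ k * |x - y| := fun x hx y hy k => by
    have := abs_prod_sub_prod_le (Finset.range k) (fun _ => x) (fun _ => y)
      (fun _ _ => by simpa using hb x hx 1) (fun _ _ => by simpa using hb y hy 1)
    simpa using this
  rw [mono, mono]
  refine (abs_prod_sub_prod_le _ _ _ (fun i _ => hb _ (hu i) _) fun i _ => hb _ (hw i) _).trans ?_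
  calc ∑ i, |u i ^ (α i : ℕ) - w i ^ (α i : ℕ)| ≤ ∑ _i : Fin d, (m : ℝ) * r := by
        refine Finset.sum_le_sum fun i _ => (hpow _ (hu i) _ (hw i) _).trans ?_
        have h1 : ((α i : ℕ) : ℝ) ≤ m := by exact_mod_cast Nat.lt_succ_iff.1 (α i).2
        exact mul_le_mul h1 (h i) (abs_nonneg _) (Nat.cast_nonneg _)
    _ = d * m * r := by simp; ring

lemma norm_mono_sub_le {u w : Fin d → ℝ} (hu : ∀ i, u i ∈ Set.Icc (0 : ℝ) 1)
    (hw : ∀ i, w i ∈ Set.Icc (0 : ℝ) 1) {r : ℝ} (hr : 0 ≤ r) (h : ∀ i, |u i - w i| ≤ r) :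
    ‖mono m u - mono m w‖ ≤ d * m * r :=
  (pi_norm_le_iff_of_nonneg (by positivity)).2 fun α => abs_mono_sub_le hu hw h α

lemma node_pos (j : Fin d → Fin (m + 1)) (i : Fin d) : 0 < node m j i := by
  rw [node]; positivity

lemma node_lt_one (j : Fin d → Fin (m + 1)) (i : Fin d) : node m j i < 1 := by
  rw [node, div_lt_one (by positivity)]
  have : ((j i : ℕ) : ℝ) ≤ m := by exact_mod_cast Nat.lt_succ_iff.1 (j i).2
  linarith

lemma node_mem (j : Fin d → Fin (m + 1)) (i : Fin d) : node m j i ∈ Set.Icc (0 : ℝ) 1 :=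
  ⟨(node_pos j i).le, (node_lt_one j i).le⟩

/-- Interpolation: every vector is a combination of the moment vectors of the nodes. -/
lemma exists_interpolation (d m : ℕ) : ∃ K : ℝ, 0 < K ∧
    ∃ S : ((Fin d → Fin (m + 1)) → ℝ) →ₗ[ℝ] ((Fin d → Fin (m + 1)) → ℝ),
      (∀ y, ∑ j, S y j • mono m (node m j) = y) ∧ ∀ y, ‖S y‖ ≤ K * ‖y‖ := by
  set W : ((Fin d → Fin (m + 1)) → ℝ) →ₗ[ℝ] ((Fin d → Fin (m + 1)) → ℝ) :=
    Fintype.linearCombination ℝ fun j => mono m (node m j) with hW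
  have hWa : ∀ y, W y = ∑ j, y j • mono m (node m j) := fun y => by
    rw [hW, Fintype.linearCombination_apply]
  -- A functional vanishing on the range is the coefficient vector of a polynomial vanishing at all
  -- nodes.
  have hsurj : LinearMap.range W = ⊤ := by
    by_contra hne
    obtain ⟨f, hf0, hf⟩ := Submodule.exists_le_ker_of_lt_top _ (lt_top_iff_ne_top.2 hne)
    apply hf0
    set ξ : (Fin d → Fin (m + 1)) → ℝ := fun α => f (Pi.single α 1) with hξ
    have hfa : ∀ y, f y = ∑ α, ξ α * y α := fun y => by
      rw [LinearMap.pi_apply_eq_sum_univ f y]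
      refine Finset.sum_congr rfl fun α _ => ?_
      rw [smul_eq_mul, mul_comm, hξ]
      congr 3
      funext β
      simp [Pi.single_apply, eq_comm]
    have : ξ = 0 := eq_zero_of_node ξ fun j => by
      rw [← hfa]
      have : mono m (node m j) ∈ LinearMap.range W := ⟨Pi.single j 1, by
        rw [hWa, Finset.sum_eq_single j] <;> simp +contextual⟩
      exact hf this
    ext α
    simp [hfa, this]
  obtain ⟨S, hS⟩ := W.exists_rightInverse_of_surjective hsurj
  refine ⟨‖LinearMap.toContinuousLinearMap S‖ + 1, by positivity, S, fun y => ?_, fun y => ?_⟩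
  · rw [← hWa, ← LinearMap.comp_apply, hS, LinearMap.id_apply]
  · refine ((LinearMap.toContinuousLinearMap S).le_opNorm y).trans ?_
    gcongr
    linarith

/-- The mean of the moment vectors of the nodes. -/
noncomputable def nodeMean (d m : ℕ) : (Fin d → Fin (m + 1)) → ℝ :=
  ((m + 1 : ℕ) ^ d : ℝ)⁻¹ • ∑ j, mono m (node m j)

lemma card_nodes (d m : ℕ) : (Fintype.card (Fin d → Fin (m + 1)) : ℝ) = ((m + 1 : ℕ) ^ d : ℝ) := by
  simp

lemma mono_zero (u : Fin d → ℝ) : mono m u 0 = 1 := by simp [mono]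

/-- Sums of moment vectors of points near the nodes fill a neighbourhood of the sum of the moment
vectors of the nodes, among the vectors with the same number of points. -/
lemma exists_fill (d m : ℕ) : ∃ a : ℝ, 0 < a ∧ ∀ v : (Fin d → Fin (m + 1)) → ℝ,
    ‖v - nodeMean d m‖ ≤ a → v 0 = 1 →
    ∃ z : (Fin d → Fin (m + 1)) → Fin d → ℝ, (∀ j i, 0 < z j i ∧ z j i < 1) ∧
      ∑ j, mono m (z j) = ((m + 1 : ℕ) ^ d : ℝ) • v := by
  classical
  -- The constant monomial is left out: its sum is the number of points and cannot be moved.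
  let Φ : ((Fin d → Fin (m + 1)) → Fin d → ℝ) → {α : Fin d → Fin (m + 1) // α ≠ 0} → ℝ := fun z α => ∑ j, mono m (z j) α
  let z₀ : (Fin d → Fin (m + 1)) → Fin d → ℝ := fun j => node m j
  have hsmooth : ContDiff ℝ 1 Φ := by
    refine contDiff_pi.2 fun α => ContDiff.sum fun j _ => ?_
    unfold mono
    refine contDiff_prod fun i _ => ContDiff.pow ?_ _
    fun_prop
  have hstrict : HasStrictFDerivAt Φ (fderiv ℝ Φ z₀) z₀ :=
    hsmooth.contDiffAt.hasStrictFDerivAt (by norm_num)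
  -- A functional that annihilates the range is a polynomial without constant term. Moving the
  -- single node `j` in direction `i` shows that its gradient vanishes at every node, so it is zero.
  -- Surjectivity then makes `Φ` open at `z₀`.
  have hrange : (fderiv ℝ Φ z₀).range = ⊤ := by
    by_contra hne
    obtain ⟨f, hf0, hf⟩ := Submodule.exists_le_ker_of_lt_top _ (lt_top_iff_ne_top.2 hne)
    apply hf0
    set ξ : (Fin d → Fin (m + 1)) → ℝ := fun α => if h : α ≠ 0 then f (Pi.single ⟨α, h⟩ 1) else 0 with hξ
    have hfΦ : ∀ z, f (Φ z) = ∑ j, MvPolynomial.eval (z j) (polyOf ξ) := fun z => by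
      rw [LinearMap.pi_apply_eq_sum_univ f (Φ z)]
      simp only [eval_polyOf]
      have hs := Fintype.sum_subtype_add_sum_subtype (fun α : Fin d → Fin (m + 1) => α ≠ 0)
        (fun α => ∑ j, ξ α * mono m (z j) α)
      rw [Finset.sum_comm, ← hs]
      have h0 : ∀ α : {α : Fin d → Fin (m + 1) // ¬ α ≠ 0},
          ∑ j, ξ α.1 * mono m (z j) α.1 = 0 := fun α => by simp [hξ, α.2]
      simp only [h0, Finset.sum_const_zero, add_zero]
      refine Finset.sum_congr rfl fun α _ => ?_
      have h1 : ξ α.1 = f (fun β => if α = β then 1 else 0) := by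
        simp only [hξ, dif_pos α.2]
        congr 1
        funext β
        simp [Pi.single_apply, eq_comm]
      rw [← Finset.mul_sum, h1, smul_eq_mul, mul_comm]
    have hline : ∀ j i, MvPolynomial.eval (node m j) (MvPolynomial.pderiv i (polyOf ξ)) = 0 := by
      intro j i
      set w : (Fin d → Fin (m + 1)) → Fin d → ℝ := Pi.single j (Pi.single i 1) with hw
      have h1 : HasDerivAt (fun t : ℝ => f (Φ (z₀ + t • w))) 0 0 := by
        have h2 : HasDerivAt (fun t : ℝ => z₀ + t • w) w 0 := by
          simpa using ((hasDerivAt_id (0 : ℝ)).smul_const w).const_add z₀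
        have h3 := (LinearMap.toContinuousLinearMap f).hasFDerivAt.comp_hasDerivAt (0 : ℝ)
          (HasFDerivAt.comp_hasDerivAt (0 : ℝ) (f := fun t : ℝ => z₀ + t • w) (l := Φ)
            (by simpa using hstrict.hasFDerivAt) h2)
        have h4 : f (fderiv ℝ Φ z₀ w) = 0 := hf ⟨w, rfl⟩
        have h5 : LinearMap.toContinuousLinearMap f (fderiv ℝ Φ z₀ w) = 0 := h4
        rw [h5] at h3
        exact h3
      have h5 : HasDerivAt (fun t : ℝ => f (Φ (z₀ + t • w)))
          (MvPolynomial.eval (node m j) (MvPolynomial.pderiv i (polyOf ξ))) 0 := by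
        simp only [hfΦ]
        have h6 : ∀ k, HasDerivAt (fun t : ℝ => MvPolynomial.eval ((z₀ + t • w) k) (polyOf ξ))
            (if k = j then MvPolynomial.eval (node m j) (MvPolynomial.pderiv i (polyOf ξ))
              else 0) 0 := by
          intro k
          by_cases hk : k = j
          · subst hk
            simpa [hw, z₀] using hasDerivAt_eval_line (polyOf ξ) (node m k) i
          · simpa [hw, hk] using hasDerivAt_const (0 : ℝ) _
        have := HasDerivAt.fun_sum fun k (_ : k ∈ Finset.univ) => h6 k
        rwa [Finset.sum_ite_eq' Finset.univ j, if_pos (Finset.mem_univ j)] at this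
      exact h5.unique h1
    have hξ0 : ∀ α, α ≠ 0 → ξ α = 0 := eq_zero_of_pderiv_node ξ hline
    ext α
    have := hξ0 α.1 α.2
    simpa [hξ, α.2] using this
  have hnhds := hstrict.map_nhds_eq_of_surj hrange
  set U : Set ((Fin d → Fin (m + 1)) → Fin d → ℝ) := {z | ∀ j i, 0 < z j i ∧ z j i < 1} with hU
  have hUo : U ∈ nhds z₀ := by
    have : U = ⋂ j, ⋂ i, {z | 0 < z j i ∧ z j i < 1} := by ext; simp [hU]
    rw [this]
    refine Filter.iInter_mem.2 fun j => Filter.iInter_mem.2 fun i => ?_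
    have hc : Continuous fun z : (Fin d → Fin (m + 1)) → Fin d → ℝ => z j i := by fun_prop
    exact (hc.tendsto z₀).eventually (Ioo_mem_nhds (node_pos j i) (node_lt_one j i))
  have himg : Φ '' U ∈ nhds (Φ z₀) := by
    rw [← hnhds]; exact Filter.image_mem_map hUo
  obtain ⟨r, hr, hball⟩ := Metric.mem_nhds_iff.1 himg
  set J : ℝ := ((m + 1 : ℕ) ^ d : ℝ) with hJ
  have hJ0 : 0 < J := by positivity
  refine ⟨r / (2 * J), by positivity, fun v hv hv0 => ?_⟩
  have hmem : (fun α : {α : Fin d → Fin (m + 1) // α ≠ 0} => J * v α) ∈ Metric.ball (Φ z₀) r := by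
    rw [mem_ball_iff_norm]
    refine lt_of_le_of_lt (b := r / 2) ?_ (by linarith)
    refine (pi_norm_le_iff_of_nonneg (by positivity)).2 fun α => ?_
    have h1 := (norm_le_pi_norm (v - nodeMean d m) α.1).trans hv
    have h2 : J * v α - Φ z₀ α = J * (v - nodeMean d m) α.1 := by
      simp only [Pi.sub_apply, nodeMean, Pi.smul_apply, smul_eq_mul, Finset.sum_apply, mul_sub,
        ← hJ]
      rw [mul_inv_cancel_left₀ hJ0.ne']
    rw [Pi.sub_apply, h2, norm_mul, Real.norm_of_nonneg hJ0.le]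
    calc J * ‖(v - nodeMean d m) α.1‖ ≤ J * (r / (2 * J)) := by gcongr
      _ = r / 2 := by field_simp
  obtain ⟨z, hz, hzΦ⟩ := hball hmem
  refine ⟨z, hz, ?_⟩
  funext α
  rw [Finset.sum_apply, Pi.smul_apply, smul_eq_mul]
  by_cases hα : α = 0
  · subst hα
    simp [mono_zero, hv0, hJ]
  · exact congrFun hzΦ ⟨α, hα⟩

/-- The position of a cell of the regular subdivision of the unit cube in `t ^ d` cells. -/
noncomputable def cellPos {d t : ℕ} (c : Fin d → Fin t) : Fin d → ℝ := fun i => ((c i : ℕ) : ℝ) / t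

lemma cellPos_mem {t : ℕ} (c : Fin d → Fin t) (i : Fin d) : cellPos c i ∈ Set.Icc (0 : ℝ) 1 := by
  have h1 : ((c i : ℕ) : ℝ) ≤ t := by exact_mod_cast (c i).2.le
  have h2 : (0 : ℝ) < t := by exact_mod_cast (c i).pos
  exact ⟨by rw [cellPos]; positivity, by rw [cellPos, div_le_one h2]; exact h1⟩

lemma exists_cell_near {t : ℕ} (ht : 0 < t) (u : Fin d → ℝ) (hu : ∀ i, 0 < u i ∧ u i < 1) :
    ∃ c : Fin d → Fin t, ∀ i, |cellPos c i - u i| ≤ 1 / t := by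
  have ht' : (0 : ℝ) < t := by exact_mod_cast ht
  refine ⟨fun i => ⟨⌊u i * t⌋₊, ?_⟩, fun i => ?_⟩
  · rw [Nat.floor_lt (mul_nonneg (hu i).1.le ht'.le)]
    nlinarith [(hu i).2]
  · have h1 := Nat.floor_le (mul_nonneg (hu i).1.le ht'.le)
    have h2 := Nat.lt_floor_add_one (u i * t)
    have h3 : u i = u i * t / t := by field_simp
    simp only [cellPos]
    rw [h3, ← sub_div, abs_div, abs_of_pos ht']
    refine div_le_div_of_nonneg_right ?_ ht'.le
    rw [← h3, abs_le]
    constructor <;> linarith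

/-- Interpolation is stable under small perturbations of the moment vectors. -/
lemma exists_weights {κ : Type*} [Fintype κ] (w ψ : κ → κ → ℝ) (S : (κ → ℝ) →ₗ[ℝ] (κ → ℝ)) {K ρ : ℝ}
    (hS : ∀ y, ∑ j, S y j • w j = y) (hK : ∀ y, ‖S y‖ ≤ K * ‖y‖) (hK0 : 0 ≤ K)
    (hψ : ∀ j, ‖ψ j - w j‖ ≤ ρ) (hρ : Fintype.card κ * ρ * K ≤ 1 / 2) (y : κ → ℝ) :
    ∃ β : κ → ℝ, ∑ j, β j • ψ j = y ∧ ‖β‖ ≤ 2 * K * ‖y‖ := by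
  set W : (κ → ℝ) →ₗ[ℝ] (κ → ℝ) := Fintype.linearCombination ℝ ψ with hW
  have hWa : ∀ y, W y = ∑ j, y j • ψ j := fun y => by rw [hW, Fintype.linearCombination_apply]
  have hclose : ∀ y, ‖W (S y) - y‖ ≤ 1 / 2 * ‖y‖ := fun y => by
    have e : W (S y) - y = ∑ j, S y j • (ψ j - w j) := by
      simp only [smul_sub, Finset.sum_sub_distrib, hS, hWa]
    rw [e]
    calc ‖∑ j, S y j • (ψ j - w j)‖ ≤ ∑ j, ‖S y j • (ψ j - w j)‖ := norm_sum_le _ _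
      _ ≤ ∑ _j : κ, (K * ‖y‖) * ρ := by
          refine Finset.sum_le_sum fun j _ => ?_
          rw [norm_smul]
          exact mul_le_mul ((norm_le_pi_norm (S y) j).trans (hK y)) (hψ j) (norm_nonneg _)
            (by positivity)
      _ = (Fintype.card κ * ρ * K) * ‖y‖ := by simp; ring
      _ ≤ _ := by gcongr
  have hinj : Function.Injective (W ∘ₗ S) := by
    rw [injective_iff_map_eq_zero]
    intro x hx
    have := hclose x
    rw [LinearMap.comp_apply] at hx
    rw [hx, zero_sub, norm_neg] at this
    have h0 := norm_nonneg x
    exact norm_eq_zero.1 (by linarith)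
  obtain ⟨x, hx⟩ := LinearMap.injective_iff_surjective.1 hinj y
  rw [LinearMap.comp_apply] at hx
  refine ⟨S x, by rw [← hWa, hx], (hK x).trans ?_⟩
  have h1 := hclose x
  rw [hx] at h1
  have h2 : ‖x‖ ≤ ‖y‖ + ‖y - x‖ := by
    have := norm_sub_le y (y - x)
    rwa [sub_sub_cancel] at this
  have h3 : ‖x‖ ≤ 2 * ‖y‖ := by linarith
  nlinarith

/-- The cells in the block (of `t'` cells in each direction) that has its corner at a node. -/
def blockCells (d m t₁ t' : ℕ) (j : Fin d → Fin (m + 1)) :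
    Finset (Fin d → Fin ((m + 2) * t₁ * t')) :=
  Fintype.piFinset fun i => Finset.univ.filter fun c => (c : ℕ) / t' = t₁ * ((j i : ℕ) + 1)

lemma card_blockCells {t₁ t' : ℕ} (ht₁ : 0 < t₁) (ht' : 0 < t') (j : Fin d → Fin (m + 1)) :
    (blockCells d m t₁ t' j).card = t' ^ d := by
  have h : ∀ i, (Finset.univ.filter fun c : Fin ((m + 2) * t₁ * t') =>
      (c : ℕ) / t' = t₁ * ((j i : ℕ) + 1)).card = t' := fun i => by
    have hlt : ∀ k < t', t₁ * ((j i : ℕ) + 1) * t' + k < (m + 2) * t₁ * t' := fun k hk => by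
      have h1 : t₁ * ((j i : ℕ) + 1) + 1 ≤ (m + 2) * t₁ := by
        have := (j i).2
        nlinarith
      calc t₁ * ((j i : ℕ) + 1) * t' + k < t₁ * ((j i : ℕ) + 1) * t' + t' := by omega
        _ = (t₁ * ((j i : ℕ) + 1) + 1) * t' := by ring
        _ ≤ _ := Nat.mul_le_mul_right _ h1
    rw [← Finset.card_map Fin.valEmbedding]
    have : (Finset.univ.filter fun c : Fin ((m + 2) * t₁ * t') =>
        (c : ℕ) / t' = t₁ * ((j i : ℕ) + 1)).map Fin.valEmbedding =
        Finset.Ico (t₁ * ((j i : ℕ) + 1) * t') (t₁ * ((j i : ℕ) + 1) * t' + t') := by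
      ext x
      simp only [Finset.mem_map, Finset.mem_filter, Finset.mem_univ, true_and,
        Fin.valEmbedding_apply, Finset.mem_Ico]
      constructor
      · rintro ⟨c, hc, rfl⟩
        rw [← hc]
        have h1 := Nat.div_add_mod' (c : ℕ) t'
        have h2 := Nat.mod_lt (c : ℕ) ht'
        omega
      · rintro ⟨h1, h2⟩
        obtain ⟨k, rfl⟩ := Nat.exists_eq_add_of_le h1
        have hk : k < t' := by omega
        refine ⟨⟨_, hlt k hk⟩, ?_, rfl⟩
        change (t₁ * ((j i : ℕ) + 1) * t' + k) / t' = _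
        rw [mul_comm _ t', Nat.mul_add_div ht', Nat.div_eq_of_lt hk, add_zero]
    rw [this]
    simp
  rw [blockCells, Fintype.card_piFinset]
  simp [h]

lemma cellPos_near_node {t₁ t' : ℕ} (ht₁ : 0 < t₁) (ht' : 0 < t') {j : Fin d → Fin (m + 1)}
    {c : Fin d → Fin ((m + 2) * t₁ * t')} (hc : c ∈ blockCells d m t₁ t' j) (i : Fin d) :
    |cellPos c i - node m j i| ≤ 1 / t₁ := by
  rw [blockCells, Fintype.mem_piFinset] at hc
  have h := (Finset.mem_filter.1 (hc i)).2
  have h1 := Nat.div_add_mod' (c i : ℕ) t'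
  rw [h] at h1
  have h2 : (((c i : ℕ) % t' : ℕ) : ℝ) ≤ t' := by exact_mod_cast (Nat.mod_lt _ ht').le
  have h3 : ((c i : ℕ) : ℝ) = t₁ * ((j i : ℕ) + 1) * t' + (((c i : ℕ) % t' : ℕ) : ℝ) := by
    exact_mod_cast h1.symm
  have ht₁' : (0 : ℝ) < t₁ := by exact_mod_cast ht₁
  have ht'' : (0 : ℝ) < t' := by exact_mod_cast ht'
  have e : cellPos c i - node m j i = (((c i : ℕ) % t' : ℕ) : ℝ) / ((m + 2) * t₁ * t') := by
    rw [cellPos, node, h3]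
    push_cast
    field_simp
    ring
  rw [e, abs_of_nonneg (by positivity)]
  have h4 : (0 : ℝ) ≤ m := Nat.cast_nonneg m
  rw [div_le_div_iff₀ (by positivity) ht₁', one_mul]
  have h5 : (t' : ℝ) * t₁ ≤ (m + 2) * t₁ * t' := by nlinarith [mul_pos ht₁' ht'']
  nlinarith

/-- The cells of fine regular subdivisions of the unit cube form moment systems with common
constants. -/
theorem exists_momentSystem (d m : ℕ) : ∃ (a G L : ℝ) (t₀ : ℕ), 0 < a ∧ a ≤ 1 / 2 ∧ 0 ≤ G ∧
    0 ≤ L ∧ 0 < t₀ ∧ ∀ t' : ℕ, 0 < t' →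
    IsMomentSystem (fun c : Fin d → Fin (t₀ * t') => mono m (cellPos c)) 0 (nodeMean d m) a G
      ((m + 1) ^ d) (L / (t₀ * t' : ℕ)) := by
  classical
  obtain ⟨a₁, ha₁, hfill⟩ := exists_fill d m
  obtain ⟨K, hK, S, hS, hSK⟩ := exists_interpolation d m
  set J : ℝ := ((m + 1 : ℕ) ^ d : ℝ) with hJ
  have hJ0 : 0 < J := by positivity
  have hJc : (Fintype.card (Fin d → Fin (m + 1)) : ℝ) = J := card_nodes d m
  -- Block averages then differ from the node moments by at most `ρ ≤ 1 / (4 * J * K)`. With `a`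
  -- under the same bound, `exists_weights` yields corrections of size at most `2 * K * (a + ρ) ≤
  -- J⁻¹`.
  obtain ⟨t₁, ht₁⟩ := exists_nat_gt (max 1 (d * m * (4 * J * K)))
  have ht₁1 : (1 : ℝ) < t₁ := (le_max_left _ _).trans_lt ht₁
  have ht₁0 : 0 < t₁ := by
    have : (0 : ℝ) < t₁ := by linarith
    exact_mod_cast this
  have ht₁r : (0 : ℝ) < t₁ := by linarith
  set ρ : ℝ := d * m * (1 / t₁) with hρ
  have hρ0 : 0 ≤ ρ := by positivity
  have hρ1 : ρ * (4 * J * K) ≤ 1 := by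
    have h1 := (le_max_right _ _).trans ht₁.le
    have h2 : ρ * (4 * J * K) = d * m * (4 * J * K) / t₁ := by rw [hρ]; ring
    rw [h2, div_le_one ht₁r]
    exact h1
  set a := min (min a₁ (1 / 2)) (1 / (4 * J * K)) with ha
  have ha0 : 0 < a := by positivity
  have haJ : a * (4 * J * K) ≤ 1 := by
    rw [← le_div_iff₀ (by positivity)]
    exact min_le_right _ _
  set V : ℝ := (((m + 2) * t₁ : ℕ) : ℝ) ^ d with hV
  have hV0 : 0 ≤ V := by positivity
  refine ⟨a, J * (2 * V), (J * (d * m)), (m + 2) * t₁, ha0,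
    (min_le_left _ _).trans (min_le_right _ _), by positivity, by positivity, by positivity, ?_⟩
  intro t' ht'
  have ht'r : (0 : ℝ) < t' := by exact_mod_cast ht'
  have hJb : J • nodeMean d m = ∑ j, mono m (node m j) := by
    rw [nodeMean, ← hJ, smul_smul, mul_inv_cancel₀ hJ0.ne', one_smul]
  have hcard : (Fintype.card (Fin d → Fin ((m + 2) * t₁ * t')) : ℝ) = V * (t' : ℝ) ^ d := by
    rw [Fintype.card_fun, Fintype.card_fin, Fintype.card_fin, hV]
    push_cast
    rw [mul_pow]
  refine ⟨fun c α => abs_mono_le_one (cellPos_mem c) α, fun c => mono_zero _, ?_, ?_,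
    by positivity, fun v hv => ?_, fun v hv hv0 => ?_⟩
  · have := congrFun hJb 0
    simp only [Pi.smul_apply, Finset.sum_apply, mono_zero, Finset.sum_const, Finset.card_univ,
      nsmul_eq_mul, mul_one, smul_eq_mul, hJc] at this
    exact mul_left_cancel₀ hJ0.ne' (by rw [this, mul_one])
  · have h1 : ‖J • nodeMean d m‖ ≤ J := by
      rw [hJb]
      refine (norm_sum_le _ _).trans ?_
      calc ∑ j, ‖mono m (node m j)‖ ≤ ∑ _j : Fin d → Fin (m + 1), (1 : ℝ) :=
            Finset.sum_le_sum fun j _ => (pi_norm_le_iff_of_nonneg zero_le_one).2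
              fun α => abs_mono_le_one (node_mem j) α
        _ = J := by rw [Finset.sum_const, Finset.card_univ, nsmul_eq_mul, mul_one, hJc]
    rw [norm_smul, Real.norm_of_nonneg hJ0.le] at h1
    exact le_of_mul_le_mul_left (by linarith) hJ0
  · set ψ : (Fin d → Fin (m + 1)) → (Fin d → Fin (m + 1)) → ℝ := fun j =>
      ((t' : ℝ) ^ d)⁻¹ • ∑ c ∈ blockCells d m t₁ t' j, mono m (cellPos c) with hψ
    have htd : (0 : ℝ) < (t' : ℝ) ^ d := by positivity
    have hψw : ∀ j, ‖ψ j - mono m (node m j)‖ ≤ ρ := fun j => by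
      have e : ψ j - mono m (node m j) = ((t' : ℝ) ^ d)⁻¹ •
          ∑ c ∈ blockCells d m t₁ t' j, (mono m (cellPos c) - mono m (node m j)) := by
        rw [Finset.sum_sub_distrib, smul_sub, Finset.sum_const, card_blockCells ht₁0 ht',
          ← Nat.cast_smul_eq_nsmul ℝ, smul_smul]
        push_cast
        rw [inv_mul_cancel₀ htd.ne', one_smul]
      rw [e, norm_smul, norm_inv, Real.norm_of_nonneg htd.le, inv_mul_le_iff₀ htd]
      refine (norm_sum_le _ _).trans ?_
      calc ∑ c ∈ blockCells d m t₁ t' j, ‖mono m (cellPos c) - mono m (node m j)‖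
          ≤ ∑ c ∈ blockCells d m t₁ t' j, ρ := by
            refine Finset.sum_le_sum fun c hc => ?_
            exact norm_mono_sub_le (cellPos_mem c) (node_mem j) (by positivity)
              (cellPos_near_node ht₁0 ht' hc)
        _ = (t' : ℝ) ^ d * ρ := by
            rw [Finset.sum_const, card_blockCells ht₁0 ht', nsmul_eq_mul]; push_cast; rfl
    obtain ⟨β, hβ, hβn⟩ := exists_weights (fun j => mono m (node m j)) ψ S hS hSK hK.le hψw
      (by rw [hJc]; nlinarith) (v - J⁻¹ • ∑ j, ψ j)
    have hvb : ‖v - J⁻¹ • ∑ j, ψ j‖ ≤ a + ρ := by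
      have e : v - J⁻¹ • ∑ j, ψ j =
          (v - nodeMean d m) - J⁻¹ • ∑ j, (ψ j - mono m (node m j)) := by
        rw [Finset.sum_sub_distrib, smul_sub, ← hJb, smul_smul, inv_mul_cancel₀ hJ0.ne', one_smul]
        abel
      rw [e]
      refine (norm_sub_le _ _).trans (add_le_add hv ?_)
      rw [norm_smul, norm_inv, Real.norm_of_nonneg hJ0.le, inv_mul_le_iff₀ hJ0]
      refine (norm_sum_le _ _).trans ((Finset.sum_le_sum fun j _ => hψw j).trans (le_of_eq ?_))
      rw [Finset.sum_const, Finset.card_univ, nsmul_eq_mul, hJc]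
    have hβ1 : ∀ j, |β j| ≤ J⁻¹ := fun j => by
      refine (norm_le_pi_norm β j).trans (hβn.trans ?_)
      rw [← mul_le_mul_iff_right₀ hJ0, mul_inv_cancel₀ hJ0.ne']
      have : J * (2 * K * ‖v - J⁻¹ • ∑ j, ψ j‖) ≤ J * (2 * K * (a + ρ)) := by gcongr
      linarith
    have hJi : J⁻¹ ≤ 1 := by
      refine inv_le_one_of_one_le₀ ?_
      rw [hJ]
      exact one_le_pow₀ (by exact_mod_cast Nat.succ_le_succ (Nat.zero_le m))
    -- Weight `wt j` is spread evenly over the block of node `j`; it is nonnegative since `|β j| ≤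
    -- J⁻¹`. The factor `V` below is the ratio of the number of all cells to that of one block.
    set wt : (Fin d → Fin (m + 1)) → ℝ := fun j => J⁻¹ + β j with hwt
    have hwt0 : ∀ j, 0 ≤ wt j := fun j => by
      have := (abs_le.1 (hβ1 j)).1
      simp only [hwt]; linarith
    have hwt2 : ∀ j, wt j ≤ 2 := fun j => by
      have := (abs_le.1 (hβ1 j)).2
      simp only [hwt]; linarith
    have hwsum : ∑ j, wt j • ψ j = v := by
      simp only [hwt, add_smul, Finset.sum_add_distrib]
      rw [hβ, ← Finset.smul_sum]
      abel
    have hg0 : ∀ c, 0 ≤ ∑ j, if c ∈ blockCells d m t₁ t' j then wt j * V else 0 := fun c =>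
      Finset.sum_nonneg fun j _ => by
        split_ifs
        · exact mul_nonneg (hwt0 j) hV0
        · exact le_rfl
    refine ⟨fun c => ⟨_, hg0 c⟩, fun c => ?_, ?_⟩
    · change (∑ j, if c ∈ blockCells d m t₁ t' j then wt j * V else 0) ≤ _
      calc (∑ j, if c ∈ blockCells d m t₁ t' j then wt j * V else 0)
          ≤ ∑ _j : Fin d → Fin (m + 1), 2 * V := by
            refine Finset.sum_le_sum fun j _ => ?_
            split_ifs
            · exact mul_le_mul_of_nonneg_right (hwt2 j) hV0
            · positivity
        _ = J * (2 * V) := by rw [Finset.sum_const, Finset.card_univ, nsmul_eq_mul, hJc]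
    · change ∑ c, (∑ j, if c ∈ blockCells d m t₁ t' j then wt j * V else 0) • mono m (cellPos c) = _
      simp only [Finset.sum_smul, ite_smul, zero_smul]
      rw [Finset.sum_comm]
      simp only [Finset.sum_ite_mem, Finset.univ_inter]
      rw [hcard, ← hwsum, Finset.smul_sum]
      refine Finset.sum_congr rfl fun j _ => ?_
      rw [← Finset.smul_sum, hψ, smul_smul, smul_smul]
      congr 1
      field_simp
  -- The exact solution is rounded to the grid, which moves each coordinate by at most the mesh
  -- size.
  · obtain ⟨z, hz, hzs⟩ := hfill v (hv.trans ((min_le_left _ _).trans (min_le_left _ _))) hv0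
    have ht : 0 < (m + 2) * t₁ * t' := by positivity
    choose c hc using fun j => exists_cell_near ht (z j) (hz j)
    have e : Fintype.card (Fin d → Fin (m + 1)) = (m + 1) ^ d := by simp
    let E : Fin ((m + 1) ^ d) ≃ (Fin d → Fin (m + 1)) := (finCongr e.symm).trans
      (Fintype.equivFin _).symm
    refine ⟨fun k => c (E k), ?_⟩
    rw [Equiv.sum_comp E fun j => mono m (cellPos (c j))]
    have e2 : (((m + 1) ^ d : ℕ) : ℝ) = J := by rw [hJ]; push_cast; rfl
    rw [e2, ← hzs, ← Finset.sum_sub_distrib]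
    refine (norm_sum_le _ _).trans ?_
    calc ∑ j, ‖mono m (cellPos (c j)) - mono m (z j)‖
        ≤ ∑ _j : Fin d → Fin (m + 1), d * m * (1 / (((m + 2) * t₁ * t' : ℕ) : ℝ)) :=
          Finset.sum_le_sum fun j _ => norm_mono_sub_le (cellPos_mem _)
            (fun i => ⟨(hz j i).1.le, (hz j i).2.le⟩) (by positivity) (hc j)
      _ = J * (d * m) / (((m + 2) * t₁ * t' : ℕ) : ℝ) := by
          rw [Finset.sum_const, Finset.card_univ, nsmul_eq_mul, hJc]; ring

end Monomials

/-! ### Polynomial approximation of the force kernel -/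

section Kernel

lemma exists_binomial_approx (a : ℝ) (M : ℕ) : ∃ (c : ℕ → ℝ) (C r : ℝ), 0 < C ∧ 0 < r ∧ r ≤ 1 ∧
    ∀ x : ℝ, |x| < r → |(1 + x) ^ a - ∑ k ∈ Finset.range M, c k * x ^ k| ≤ C * |x| ^ M := by
  have h := (Real.one_add_rpow_hasFPowerSeriesAt_zero (a := a)).isBigO_sub_partialSum_pow M
  obtain ⟨C, hC, hb⟩ := h.exists_pos
  rw [Asymptotics.isBigOWith_iff] at hb
  obtain ⟨r, hr, hball⟩ := Metric.eventually_nhds_iff.1 hb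
  refine ⟨(binomialSeries ℝ a).coeff, C, min r 1, hC, lt_min hr one_pos, min_le_right _ _,
    fun x hx => ?_⟩
  have := hball (y := x) (by rw [Real.dist_eq, sub_zero]; exact hx.trans_le (min_le_left _ _))
  simp only [zero_add, FormalMultilinearSeries.partialSum,
    FormalMultilinearSeries.apply_eq_pow_smul_coeff, smul_eq_mul, Real.norm_eq_abs, abs_pow,
    abs_abs] at this
  refine le_trans (le_of_eq ?_) this
  congr 2
  exact Finset.sum_congr rfl fun k _ => mul_comm _ _

variable {d m : ℕ}

lemma eval_eq_sum_mono (P : MvPolynomial (Fin d) ℝ) (hP : ∀ i, P.degreeOf i ≤ m) (u : Fin d → ℝ) :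
    MvPolynomial.eval u P =
      ∑ α : Fin d → Fin (m + 1), P.coeff (Finsupp.equivFunOnFinite.symm fun i => (α i : ℕ)) *
        mono m u α := by
  rw [← eval_polyOf]
  congr 1
  ext s
  by_cases hs : ∀ i, s i < m + 1
  · have e : s = Finsupp.equivFunOnFinite.symm
        fun i => (((fun i => ⟨s i, hs i⟩ : Fin d → Fin (m + 1)) i : Fin (m + 1)) : ℕ) := by
      ext i; simp
    rw [e, coeff_polyOf]
  · have h1 : P.coeff s = 0 := by
      by_contra hne
      exact hs fun i => Nat.lt_succ_iff.2
        (MvPolynomial.degreeOf_le_iff.1 (hP i) s (MvPolynomial.mem_support_iff.2 hne))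
    rw [h1]
    by_contra hne
    exact hs fun i => support_polyOf _ s (Ne.symm hne) i

/-- The coefficients of a polynomial are controlled by its values in the unit cube. -/
lemma exists_coeff_bound (d m : ℕ) : ∃ K : ℝ, 0 < K ∧
    ∀ (P : MvPolynomial (Fin d) ℝ) (B : ℝ), (∀ i, P.degreeOf i ≤ m) → 0 ≤ B →
    (∀ u : Fin d → ℝ, (∀ i, u i ∈ Set.Icc (0 : ℝ) 1) → |MvPolynomial.eval u P| ≤ B) →
    ∃ ξ : (Fin d → Fin (m + 1)) → ℝ, (∀ α, |ξ α| ≤ K * B) ∧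
      ∀ u, MvPolynomial.eval u P = ∑ α, ξ α * mono m u α := by
  classical
  obtain ⟨K, hK, S, hS, hSK⟩ := exists_interpolation d m
  set J : ℝ := ((m + 1 : ℕ) ^ d : ℝ) with hJ
  have hJ0 : 0 < J := by positivity
  refine ⟨J * K, by positivity, fun P B hP hB hPB => ?_⟩
  refine ⟨_, fun α => ?_, fun u => eval_eq_sum_mono P hP u⟩
  set ξ : (Fin d → Fin (m + 1)) → ℝ :=
    fun α => P.coeff (Finsupp.equivFunOnFinite.symm fun i => (α i : ℕ)) with hξ
  -- Interpolating the coordinate vector of `α` expresses the coefficient through the values of `P`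
  -- at the nodes.
  have h1 : ξ α = ∑ j, S (Pi.single α 1) j * MvPolynomial.eval (node m j) P := by
    have h2 : ξ α = ∑ β, ξ β * (Pi.single α (1 : ℝ) : (Fin d → Fin (m + 1)) → ℝ) β := by
      simp [Pi.single_apply]
    rw [h2]
    conv_lhs => rw [← hS (Pi.single α 1)]
    simp only [Finset.sum_apply, Pi.smul_apply, smul_eq_mul, Finset.mul_sum, eval_eq_sum_mono P hP]
    rw [Finset.sum_comm]
    exact Finset.sum_congr rfl fun j _ => Finset.sum_congr rfl fun β _ => by ring
  change |ξ α| ≤ _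
  rw [h1]
  refine (Finset.abs_sum_le_sum_abs _ _).trans ?_
  calc ∑ j, |S (Pi.single α 1) j * MvPolynomial.eval (node m j) P|
      ≤ ∑ _j : Fin d → Fin (m + 1), K * B := by
        refine Finset.sum_le_sum fun j _ => ?_
        rw [abs_mul]
        have h3 : ‖(Pi.single α (1 : ℝ) : (Fin d → Fin (m + 1)) → ℝ)‖ ≤ 1 :=
          (pi_norm_le_iff_of_nonneg zero_le_one).2 fun β => by
            by_cases h : β = α
            · subst h; simp
            · simp [h]
        have h4 : |S (Pi.single α 1) j| ≤ K :=
          (norm_le_pi_norm (S (Pi.single α 1)) j).trans ((hSK _).trans (by nlinarith))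
        exact mul_le_mul h4 (hPB _ (node_mem j)) (abs_nonneg _) hK.le
    _ = J * K * B := by
        rw [Finset.sum_const, Finset.card_univ, nsmul_eq_mul, card_nodes, ← hJ]; ring

/-- The polynomial `2 τ e · u + τ² |u|²` in `u`. -/
noncomputable def quadPoly (e : Fin d → ℝ) (τ : ℝ) : MvPolynomial (Fin d) ℝ :=
  ∑ l, (MvPolynomial.C (2 * τ * e l) * MvPolynomial.X l +
    MvPolynomial.C (τ ^ 2) * MvPolynomial.X l ^ 2)

lemma eval_quadPoly (e u : Fin d → ℝ) (τ : ℝ) :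
    MvPolynomial.eval u (quadPoly e τ) = ∑ l, (2 * τ * e l * u l + τ ^ 2 * u l ^ 2) := by
  simp [quadPoly]

lemma degreeOf_quadPoly (e : Fin d → ℝ) (τ : ℝ) (i : Fin d) : (quadPoly e τ).degreeOf i ≤ 2 := by
  classical
  refine (MvPolynomial.degreeOf_sum_le _ _ _).trans (Finset.sup_le fun l _ => ?_)
  have hX : (MvPolynomial.X l : MvPolynomial (Fin d) ℝ).degreeOf i ≤ 1 := by
    rw [MvPolynomial.degreeOf_X]; split_ifs <;> omega
  refine (MvPolynomial.degreeOf_add_le _ _ _).trans (max_le ?_ ?_)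
  · exact (MvPolynomial.degreeOf_C_mul_le _ _ _).trans (hX.trans (by norm_num))
  · refine (MvPolynomial.degreeOf_C_mul_le _ _ _).trans ?_
    exact (MvPolynomial.degreeOf_pow_le _ _ _).trans (by omega)

lemma abs_quadPoly_le {e u : Fin d → ℝ} {τ : ℝ} (he : ∀ l, |e l| ≤ 1)
    (hu : ∀ i, u i ∈ Set.Icc (0 : ℝ) 1) (hτ0 : 0 ≤ τ) (hτ1 : τ ≤ 1) :
    |MvPolynomial.eval u (quadPoly e τ)| ≤ 3 * d * τ := by
  rw [eval_quadPoly]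
  refine (Finset.abs_sum_le_sum_abs _ _).trans ?_
  calc ∑ l, |2 * τ * e l * u l + τ ^ 2 * u l ^ 2| ≤ ∑ _l : Fin d, 3 * τ := by
        refine Finset.sum_le_sum fun l _ => ?_
        refine (abs_add_le _ _).trans ?_
        have hu1 : |u l| ≤ 1 := by rw [abs_of_nonneg (hu l).1]; exact (hu l).2
        have h1 : |e l| * |u l| ≤ 1 := mul_le_one₀ (he l) (abs_nonneg _) hu1
        have h2 : u l ^ 2 ≤ 1 := pow_le_one₀ (hu l).1 (hu l).2
        rw [abs_mul, abs_mul, abs_mul, abs_of_nonneg hτ0, abs_of_nonneg (by positivity : 0 ≤ τ ^ 2 * u l ^ 2),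
          abs_two]
        have h3 : 2 * τ * |e l| * |u l| ≤ 2 * τ := by nlinarith
        have h4 : τ ^ 2 * u l ^ 2 ≤ τ := by nlinarith [sq_nonneg τ]
        linarith
    _ = 3 * d * τ := by simp; ring

/-- The force exerted by the points of a small cube is a polynomial of bounded degree in their
relative position, up to a small error. -/
theorem exists_kernel_approx (hd : 1 ≤ d) (M : ℕ) : ∃ C τ₀ : ℝ, 0 < C ∧ 0 < τ₀ ∧
    ∀ (y : Space d) (s : ℝ), 0 ≤ s → 1 ≤ ‖y‖ → s ≤ τ₀ * ‖y‖ → ∀ i : Fin d,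
    ∃ ξ : (Fin d → Fin (2 * M + 1 + 1)) → ℝ, (∀ α, |ξ α| ≤ C) ∧
      ∀ (w : Space d) (u : Fin d → ℝ), (∀ l, u l ∈ Set.Icc (0 : ℝ) 1) →
        (∀ l, w l = y l + s * u l) →
        |(‖w‖ ^ d)⁻¹ * w i - ∑ α, ξ α * mono (2 * M + 1) u α| ≤ C * (s / ‖y‖) ^ M := by
  obtain ⟨c, C₁, r, hC₁, hr, hr1, happ⟩ := exists_binomial_approx (-(d / 2 : ℝ)) M
  obtain ⟨K, hK, hcoeff⟩ := exists_coeff_bound d (2 * M + 1)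
  have hd0 : (0 : ℝ) < d := by exact_mod_cast hd
  set B : ℝ := 2 * ∑ k ∈ Finset.range M, |c k| with hB
  have hB0 : 0 ≤ B := by positivity
  -- The quadratic increment is at most `3 * d * τ`, so `τ ≤ r / (6 * d)` keeps it inside the radius
  -- `r` of the binomial expansion.
  refine ⟨K * B + 2 * (C₁ * (3 * d) ^ M), min 1 (r / (6 * d)), by positivity, by positivity, ?_⟩
  intro y s hs hy hsy i
  set ρ := ‖y‖ with hρ
  have hρ0 : 0 < ρ := by linarith
  set τ := s / ρ with hτ
  have hτ0 : 0 ≤ τ := by positivity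
  have hτ' : τ ≤ min 1 (r / (6 * d)) := by rwa [hτ, div_le_iff₀ hρ0]
  have hτ1 : τ ≤ 1 := hτ'.trans (min_le_left _ _)
  have hτr : 3 * d * τ < r := by
    have := hτ'.trans (min_le_right _ _)
    rw [le_div_iff₀ (by positivity)] at this
    linarith
  set e : Fin d → ℝ := fun l => y l / ρ with he
  have hesum : ∑ l, e l ^ 2 = 1 := by
    simp only [he, div_pow]
    rw [← Finset.sum_div, ← EuclideanSpace.real_norm_sq_eq, ← hρ, div_self (by positivity)]
  have he1 : ∀ l, |e l| ≤ 1 := fun l => by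
    rw [← sq_le_one_iff_abs_le_one, ← hesum]
    exact Finset.single_le_sum (f := fun l => e l ^ 2) (fun _ _ => sq_nonneg _) (Finset.mem_univ l)
  set A : ℝ := (ρ ^ d)⁻¹ * ρ with hA
  have hA0 : 0 ≤ A := by positivity
  have hA1 : A ≤ 1 := by
    rw [hA, inv_mul_le_iff₀ (by positivity), mul_one]
    exact le_self_pow₀ hy (by omega)
  -- Since `w = ρ (e + τ u)` and `‖w‖ ^ 2 = ρ ^ 2 (1 + q)` with `q` the value of `quadPoly`, the
  -- force coordinate is `A (e i + τ u i) (1 + q) ^ (-d / 2)`. The power is replaced by its binomial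
  -- polynomial in `q`.
  set P : MvPolynomial (Fin d) ℝ := MvPolynomial.C A *
    ((MvPolynomial.C (e i) + MvPolynomial.C τ * MvPolynomial.X i) *
      ∑ k ∈ Finset.range M, MvPolynomial.C (c k) * quadPoly e τ ^ k) with hP
  have hPeval : ∀ u, MvPolynomial.eval u P = A * ((e i + τ * u i) *
      ∑ k ∈ Finset.range M, c k * (MvPolynomial.eval u (quadPoly e τ)) ^ k) := fun u => by
    simp [hP]
  have hPdeg : ∀ l, P.degreeOf l ≤ 2 * M + 1 := fun l => by
    classical
    refine (MvPolynomial.degreeOf_C_mul_le _ _ _).trans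
      ((MvPolynomial.degreeOf_mul_le _ _ _).trans ?_)
    have h1 : (MvPolynomial.C (e i) + MvPolynomial.C τ * MvPolynomial.X i :
        MvPolynomial (Fin d) ℝ).degreeOf l ≤ 1 := by
      refine (MvPolynomial.degreeOf_add_le _ _ _).trans (max_le ?_ ?_)
      · simp
      · refine (MvPolynomial.degreeOf_C_mul_le _ _ _).trans ?_
        rw [MvPolynomial.degreeOf_X]; split_ifs <;> omega
    have h2 : (∑ k ∈ Finset.range M, MvPolynomial.C (c k) * quadPoly e τ ^ k).degreeOf l ≤
        2 * M := by
      refine (MvPolynomial.degreeOf_sum_le _ _ _).trans (Finset.sup_le fun k hk => ?_)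
      refine (MvPolynomial.degreeOf_C_mul_le _ _ _).trans
        ((MvPolynomial.degreeOf_pow_le _ _ _).trans ?_)
      have h3 := degreeOf_quadPoly e τ l
      have h4 := (Finset.mem_range.1 hk).le
      calc k * (quadPoly e τ).degreeOf l ≤ M * 2 := Nat.mul_le_mul h4 h3
        _ = 2 * M := mul_comm _ _
    omega
  have hlin : ∀ u : Fin d → ℝ, (∀ l, u l ∈ Set.Icc (0 : ℝ) 1) → |e i + τ * u i| ≤ 2 := by
    intro u hu
    refine (abs_add_le _ _).trans ?_
    have h1 := he1 i
    have h2 : |τ * u i| ≤ 1 := by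
      rw [abs_of_nonneg (mul_nonneg hτ0 (hu i).1)]
      exact mul_le_one₀ hτ1 (hu i).1 (hu i).2
    linarith
  have hquad : ∀ u : Fin d → ℝ, (∀ l, u l ∈ Set.Icc (0 : ℝ) 1) →
      |MvPolynomial.eval u (quadPoly e τ)| ≤ 3 * d * τ := fun u hu =>
    abs_quadPoly_le he1 hu hτ0 hτ1
  obtain ⟨ξ, hξ, hξP⟩ := hcoeff P B hPdeg hB0 fun u hu => by
    rw [hPeval, abs_mul A, abs_mul (e i + _), abs_of_nonneg hA0, hB]
    have h1 : |∑ k ∈ Finset.range M, c k * (MvPolynomial.eval u (quadPoly e τ)) ^ k| ≤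
        ∑ k ∈ Finset.range M, |c k| := by
      refine (Finset.abs_sum_le_sum_abs _ _).trans (Finset.sum_le_sum fun k _ => ?_)
      rw [abs_mul, abs_pow]
      have : |MvPolynomial.eval u (quadPoly e τ)| ^ k ≤ 1 :=
        pow_le_one₀ (abs_nonneg _) ((hquad u hu).trans (hτr.le.trans hr1))
      exact mul_le_of_le_one_right (abs_nonneg _) this
    have h2 := mul_le_mul (hlin u hu) h1 (abs_nonneg _) (by norm_num)
    exact (mul_le_of_le_one_left (by positivity) hA1).trans h2
  refine ⟨ξ, fun α => (hξ α).trans (by linarith [show 0 ≤ 2 * (C₁ * (3 * d) ^ M) by positivity]),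
    fun w u hu hw => ?_⟩
  rw [← hξP, hPeval]
  set q := MvPolynomial.eval u (quadPoly e τ) with hq
  have hqr : |q| < r := (hquad u hu).trans_lt hτr
  have hnorm : ‖w‖ ^ 2 = ρ ^ 2 * (1 + q) := by
    rw [EuclideanSpace.real_norm_sq_eq, hq, eval_quadPoly, ← hesum, ← Finset.sum_add_distrib,
      Finset.mul_sum]
    refine Finset.sum_congr rfl fun l _ => ?_
    rw [hw l, he, hτ]
    field_simp
    ring
  have h1q : 0 < 1 + q := by have := (abs_lt.1 hqr).1; linarith
  have hw0 : 0 < ‖w‖ := by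
    have : 0 < ‖w‖ ^ 2 := by rw [hnorm]; positivity
    exact (norm_nonneg w).lt_of_ne fun h => by simp [← h] at this
  have hrpow : (1 + q) ^ (-(d / 2 : ℝ)) = ρ ^ d * (‖w‖ ^ d)⁻¹ := by
    have h2 : 1 + q = (‖w‖ / ρ) ^ 2 := by rw [div_pow, hnorm]; field_simp
    rw [h2, ← Real.rpow_natCast, ← Real.rpow_mul (by positivity)]
    have h3 : ((2 : ℕ) : ℝ) * -(d / 2 : ℝ) = -(d : ℝ) := by push_cast; ring
    rw [h3, Real.rpow_neg (by positivity), Real.rpow_natCast, div_pow, inv_div]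
    rfl
  have hfirst : (‖w‖ ^ d)⁻¹ * w i = A * ((e i + τ * u i) * (1 + q) ^ (-(d / 2 : ℝ))) := by
    rw [hrpow, hA, hw i, he, hτ]
    field_simp
  rw [hfirst, ← mul_sub, ← mul_sub, abs_mul A, abs_mul (e i + _), abs_of_nonneg hA0]
  have h5 := happ q hqr
  have h6 : |q| ^ M ≤ (3 * d * τ) ^ M := pow_le_pow_left₀ (abs_nonneg _) (hquad u hu) M
  calc A * (|e i + τ * u i| * |(1 + q) ^ (-(d / 2 : ℝ)) - ∑ k ∈ Finset.range M, c k * q ^ k|)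
      ≤ 1 * (2 * (C₁ * (3 * d * τ) ^ M)) := by
        refine mul_le_mul hA1 (mul_le_mul (hlin u hu) (h5.trans ?_) (abs_nonneg _) (by norm_num))
          (by positivity) zero_le_one
        gcongr
    _ = 2 * (C₁ * (3 * d) ^ M) * τ ^ M := by rw [mul_pow]; ring
    _ ≤ (K * B + 2 * (C₁ * (3 * d) ^ M)) * τ ^ M := by
        gcongr
        linarith [mul_nonneg hK.le hB0]

end Kernel

/-! ### Joint law of the counts in disjoint cells -/

section Independence

variable {d : ℕ} {Ω : Type*} [MeasurableSpace Ω] {P : Measure Ω}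
  {Z : Ω → Set (Space d)}

lemma IsStandardPoissonProcess.iIndepFun_count_fintype (hZ : IsStandardPoissonProcess P Z)
    {ι : Type*} [Fintype ι] {A : ι → Set (Space d)} (hA : ∀ i, MeasurableSet (A i))
    (hb : ∀ i, Bornology.IsBounded (A i)) (hdis : Pairwise fun i j => Disjoint (A i) (A j)) :
    iIndepFun (fun i ω => count (Z ω) (A i)) P := by
  have e := (Fintype.equivFin ι).symm
  have := hZ.iIndepFun_count (Fintype.card ι) (fun k => A (e k)) (fun k => hA _) (fun k => hb _)
    (fun i j hij => hdis (e.injective.ne hij))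
  exact iIndepFun.of_precomp e.surjective this

lemma IsStandardPoissonProcess.map_counts (hZ : IsStandardPoissonProcess P Z)
    {ι : Type*} [Fintype ι] {A : ι → Set (Space d)} (hA : ∀ i, MeasurableSet (A i))
    (hb : ∀ i, Bornology.IsBounded (A i)) (hdis : Pairwise fun i j => Disjoint (A i) (A j)) :
    P.map (fun ω i => count (Z ω) (A i)) = poisProd fun i => (volume (A i)).toNNReal := by
  rw [(hZ.iIndepFun_count_fintype hA hb hdis).map_fun_eq_pi_map
    fun i => (hZ.measurable_count _ (hA i) (hb i)).aemeasurable]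
  simp only [poisProd]
  congr 1
  funext i
  exact hZ.map_count _ (hA i) (hb i)

/-- Grouping independent counts into the blocks `{κ} × ι` leaves the blocks independent, so
constraints on separate blocks multiply. -/
lemma poisProd_real_forall {K ι : Type*} [Fintype K] [Fintype ι] (h : K → ι → ℝ≥0)
    (S : K → Set (ι → ℕ)) :
    (poisProd fun p : K × ι => h p.1 p.2).real {n | ∀ κ, (fun c => n (κ, c)) ∈ S κ} =
      ∏ κ, (poisProd (h κ)).real (S κ) := by
  have hind := iIndepFun_uncurry_infinitePi' (ι := K) (κ := ι) (X := fun _ _ n => n)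
    (fun κ c => poissonMeasure (h κ c)) (fun _ _ => measurable_id)
  have hmap := hind.map_fun_eq_pi_map (fun p => by
    exact (Measurable.aemeasurable (by fun_prop)))
  have hmarg : ∀ p : K × ι, (Measure.infinitePi fun κ => Measure.infinitePi fun c =>
      poissonMeasure (h κ c)).map (fun ω => ω p.1 p.2) = poissonMeasure (h p.1 p.2) := by
    intro p
    rw [← Measure.infinitePi_map_eval (fun c => poissonMeasure (h p.1 c)) p.2,
      ← Measure.infinitePi_map_eval (fun κ => Measure.infinitePi fun c =>
      poissonMeasure (h κ c)) p.1, Measure.map_map (by fun_prop) (by fun_prop)]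
    rfl
  simp only [hmarg] at hmap
  rw [poisProd, ← hmap, map_measureReal_apply (by fun_prop) (Set.to_countable _).measurableSet,
    measureReal_def]
  simp only [Measure.infinitePi_eq_pi]
  have : ((fun (ω : K → ι → ℕ) (p : K × ι) => ω p.1 p.2) ⁻¹' {n | ∀ κ, (fun c => n (κ, c)) ∈ S κ})
      = Set.univ.pi S := by
    ext n; simp
  rw [this, Measure.pi_pi, ENNReal.toReal_prod]
  rfl

lemma IsStandardPoissonProcess.real_counts (hZ : IsStandardPoissonProcess P Z)
    {K ι : Type*} [Fintype K] [Fintype ι] {A : K → ι → Set (Space d)}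
    (hA : ∀ κ c, MeasurableSet (A κ c)) (hb : ∀ κ c, Bornology.IsBounded (A κ c))
    (hdis : ∀ κ c κ' c', (κ, c) ≠ (κ', c') → Disjoint (A κ c) (A κ' c'))
    {v : K → ℝ≥0} (hv : ∀ κ c, volume (A κ c) = v κ) (S : K → Set (ι → ℕ)) :
    P.real {ω | ∀ κ, (fun c => count (Z ω) (A κ c)) ∈ S κ} =
      ∏ κ, (poisProd fun _ => v κ).real (S κ) := by
  have h := hZ.map_counts (A := fun p : K × ι => A p.1 p.2) (fun p => hA _ _) (fun p => hb _ _)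
    (fun p q hpq => hdis _ _ _ _ hpq)
  simp only [hv, ENNReal.toNNReal_coe] at h
  rw [← poisProd_real_forall (fun κ (_ : ι) => v κ) S, ← h, map_measureReal_apply
    (measurable_pi_lambda _ fun p => hZ.measurable_count _ (hA _ _) (hb _ _))
    (Set.to_countable _).measurableSet]
  rfl

end Independence

/-! ### Half-open cubes and their subdivision -/

section Cubes

variable {d : ℕ}

/-- The half-open cube of side `s` with lower corner `s • a`. -/
def cube (s : ℝ) (a : Fin d → ℤ) : Set (Space d) := {z | ∀ i, ⌊z i / s⌋ = a i}

lemma mem_cube_iff {s : ℝ} (hs : 0 < s) {a : Fin d → ℤ} {z : Space d} :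
    z ∈ cube s a ↔ ∀ i, z i ∈ Set.Ico (a i * s) ((a i + 1) * s) := by
  refine forall_congr' fun i => ?_
  rw [Int.floor_eq_iff, le_div_iff₀ hs, div_lt_iff₀ hs]
  rfl

lemma corner_mem_cube {s : ℝ} (hs : 0 < s) (a : Fin d → ℤ) :
    WithLp.toLp 2 (fun i => s * (a i : ℝ)) ∈ cube s a := by
  intro i
  simp [mul_div_cancel_left₀ _ hs.ne']

lemma disjoint_cube {s : ℝ} {a b : Fin d → ℤ} (hab : a ≠ b) :
    Disjoint (cube s a) (cube s b) := by
  rw [Set.disjoint_left]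
  intro z hz hz'
  exact hab (funext fun i => (hz i).symm.trans (hz' i))

/-- Products of half-open intervals in Euclidean space. -/
def hbox (l u : Fin d → ℝ) : Set (Space d) := {z | ∀ i, z i ∈ Set.Ico (l i) (u i)}

lemma hbox_eq_preimage (l u : Fin d → ℝ) :
    hbox l u = WithLp.ofLp ⁻¹' Set.univ.pi fun i => Set.Ico (l i) (u i) := by
  ext z; simp [hbox]

lemma cube_eq_hbox {s : ℝ} (hs : 0 < s) (a : Fin d → ℤ) :
    cube s a = hbox (fun i => a i * s) (fun i => (a i + 1) * s) :=
  Set.ext fun _ => mem_cube_iff hs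

lemma measurableSet_hbox (l u : Fin d → ℝ) : MeasurableSet (hbox l u) := by
  rw [hbox_eq_preimage]
  exact (MeasurableSet.univ_pi fun i => measurableSet_Ico).preimage
    (PiLp.volume_preserving_ofLp (Fin d)).measurable

lemma norm_le_sum_abs (z : Space d) : ‖z‖ ≤ ∑ i, |z i| := by
  conv_lhs => rw [← (EuclideanSpace.basisFun (Fin d) ℝ).sum_repr z]
  refine (norm_sum_le _ _).trans (le_of_eq (Finset.sum_congr rfl fun i _ => ?_))
  simp [norm_smul]

lemma isBounded_of_abs_le {A : Set (Space d)} {r : ℝ} (h : ∀ z ∈ A, ∀ i, |z i| ≤ r) :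
    Bornology.IsBounded A := by
  refine (isBounded_iff_forall_norm_le).2 ⟨∑ _i : Fin d, r, fun z hz => ?_⟩
  refine (norm_le_sum_abs z).trans (Finset.sum_le_sum fun i _ => h z hz i)

lemma isBounded_hbox (l u : Fin d → ℝ) : Bornology.IsBounded (hbox l u) := by
  refine isBounded_of_abs_le (r := ∑ i, (|l i| + |u i|)) fun z hz i => ?_
  refine le_trans ?_ (Finset.single_le_sum (f := fun i => |l i| + |u i|)
    (fun _ _ => by positivity) (Finset.mem_univ i))
  obtain ⟨h1, h2⟩ := hz i
  rw [abs_le]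
  constructor <;> linarith [neg_abs_le (l i), le_abs_self (u i), abs_nonneg (l i), abs_nonneg (u i)]

lemma volume_hbox (l u : Fin d → ℝ) : volume (hbox l u) = ∏ i, ENNReal.ofReal (u i - l i) := by
  rw [hbox_eq_preimage, (PiLp.volume_preserving_ofLp (Fin d)).measure_preimage
    (MeasurableSet.univ_pi fun i => measurableSet_Ico).nullMeasurableSet, Real.volume_pi_Ico]

lemma hbox_ae_eq (l u : Fin d → ℝ) :
    hbox l u =ᵐ[volume] {z : Space d | ∀ i, z i ∈ Set.Icc (l i) (u i)} := by
  have h := (Measure.univ_pi_Ico_ae_eq_Icc (μ := fun _ : Fin d => (volume : Measure ℝ))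
    (f := l) (g := u))
  have := (PiLp.volume_preserving_ofLp (Fin d)).quasiMeasurePreserving.preimage_ae_eq h
  rw [hbox_eq_preimage]
  refine this.trans (Filter.EventuallyEq.of_eq ?_)
  ext z
  change (l ≤ z.ofLp ∧ z.ofLp ≤ u) ↔ ∀ i, l i ≤ z i ∧ z i ≤ u i
  rw [Pi.le_def, Pi.le_def, forall_and]

lemma measurableSet_cube {s : ℝ} (hs : 0 < s) (a : Fin d → ℤ) : MeasurableSet (cube s a) := by
  rw [cube_eq_hbox hs]; exact measurableSet_hbox _ _

lemma isBounded_cube {s : ℝ} (hs : 0 < s) (a : Fin d → ℤ) : Bornology.IsBounded (cube s a) := by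
  rw [cube_eq_hbox hs]; exact isBounded_hbox _ _

lemma volume_cube {s : ℝ} (hs : 0 < s) (a : Fin d → ℤ) :
    volume (cube s a) = ENNReal.ofReal (s ^ d) := by
  rw [cube_eq_hbox hs, volume_hbox, ENNReal.ofReal_pow hs.le]
  simp [add_mul]

/-- The index of the `c`-th cell among the cubes of side `s / t`. -/
def subIndex (t : ℕ) (a : Fin d → ℤ) (c : Fin d → Fin t) : Fin d → ℤ := fun i => a i * t + (c i : ℕ)

lemma subIndex_injective {t : ℕ} (a b : Fin d → ℤ) (c c' : Fin d → Fin t)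
    (h : subIndex t a c = subIndex t b c') : a = b ∧ c = c' := by
  rcases Nat.eq_zero_or_pos t with rfl | ht
  · have : IsEmpty (Fin d) := ⟨fun i => (c i).elim0⟩
    exact ⟨Subsingleton.elim _ _, Subsingleton.elim _ _⟩
  have ht' : (0:ℤ) < t := by exact_mod_cast ht
  have key : ∀ (a : Fin d → ℤ) (c : Fin d → Fin t) i, subIndex t a c i / t = a i := by
    intro a c i
    simp only [subIndex]
    rw [add_comm, Int.add_mul_ediv_right _ _ ht'.ne', Int.ediv_eq_zero_of_lt (by positivity)
      (by exact_mod_cast (c i).2), zero_add]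
  have hab : a = b := funext fun i => by rw [← key a c i, h, key]
  refine ⟨hab, funext fun i => Fin.ext ?_⟩
  have := congrFun h i
  simp only [subIndex, hab] at this
  exact_mod_cast add_left_cancel this

lemma cell_subset_cube {s : ℝ} {t : ℕ} (a : Fin d → ℤ) (c : Fin d → Fin t) :
    cube (s / t) (subIndex t a c) ⊆ cube s a := by
  intro z hz i
  have ht : 0 < t := Fin.pos (c i)
  have ht' : (0:ℤ) < t := by exact_mod_cast ht
  have h1 : z i / s = z i / (s / t) / (t : ℕ) := by
    rw [div_div_eq_mul_div, div_right_comm, mul_div_assoc, div_self (by positivity), mul_one]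
  rw [h1, Int.floor_div_natCast, hz i]
  simp only [subIndex]
  rw [add_comm, Int.add_mul_ediv_right _ _ ht'.ne', Int.ediv_eq_zero_of_lt (by positivity)
      (by exact_mod_cast (c i).2), zero_add]

lemma cube_eq_iUnion {s : ℝ} {t : ℕ} (ht : 0 < t) (a : Fin d → ℤ) :
    cube s a = ⋃ c : Fin d → Fin t, cube (s / t) (subIndex t a c) := by
  refine subset_antisymm (fun z hz => ?_) (Set.iUnion_subset fun c => cell_subset_cube a c)
  have ht' : (0:ℤ) < t := by exact_mod_cast ht
  rw [Set.mem_iUnion]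
  have hlt : ∀ i, (⌊z i / (s / t)⌋ % t).toNat < t := fun i => by
    have := Int.emod_lt_of_pos ⌊z i / (s / t)⌋ ht'
    have := Int.emod_nonneg ⌊z i / (s / t)⌋ ht'.ne'
    omega
  refine ⟨fun i => ⟨_, hlt i⟩, fun i => ?_⟩
  have h1 : z i / s = z i / (s / t) / (t : ℕ) := by
    rw [div_div_eq_mul_div, div_right_comm, mul_div_assoc, div_self (by positivity), mul_one]
  have h2 := hz i
  rw [h1, Int.floor_div_natCast] at h2
  simp only [subIndex]
  rw [Int.toNat_of_nonneg (Int.emod_nonneg _ ht'.ne'), ← h2, mul_comm]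
  exact (Int.mul_ediv_add_emod _ _).symm

lemma disjoint_cells {s : ℝ} {t : ℕ} (a : Fin d → ℤ) {c c' : Fin d → Fin t} (h : c ≠ c') :
    Disjoint (cube (s / t) (subIndex t a c)) (cube (s / t) (subIndex t a c')) :=
  disjoint_cube fun h' => h (subIndex_injective a a c c' h').2

end Cubes

/-! ### Moment matching in a cube makes its centered force small -/

section Force

variable {d : ℕ}

lemma norm_pull_le_one (hd : 1 ≤ d) {x z : Space d} (h : 1 ≤ ‖z - x‖) : ‖pull x z‖ ≤ 1 := by
  rw [pull, norm_smul, norm_inv, norm_pow, norm_norm, inv_mul_le_iff₀ (by positivity), mul_one]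
  exact le_self_pow₀ h (by omega)

lemma measurable_pull (x : Space d) : Measurable (pull x) := by
  unfold pull
  fun_prop

lemma integrableOn_pull (hd : 1 ≤ d) {A : Set (Space d)} (hA : MeasurableSet A)
    (hb : Bornology.IsBounded A) {x : Space d} (h : ∀ z ∈ A, 1 ≤ ‖z - x‖) :
    IntegrableOn (pull x) A := by
  refine Measure.integrableOn_of_bounded (M := 1) hb.measure_lt_top.ne
    (measurable_pull x).aestronglyMeasurable ?_
  exact (ae_restrict_iff' hA).2 (Filter.Eventually.of_forall fun z hz =>
    norm_pull_le_one hd (h z hz))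

lemma force_iUnion {ι : Type*} [Fintype ι] {S : Set (Space d)} {A : ι → Set (Space d)}
    {x : Space d} (hfin : ∀ i, (S ∩ A i).Finite) (hA : ∀ i, MeasurableSet (A i))
    (hdis : Pairwise fun i j => Disjoint (A i) (A j)) (hint : ∀ i, IntegrableOn (pull x) (A i)) :
    force S (⋃ i, A i) x = ∑ i, force S (A i) x := by
  simp only [force]
  rw [Set.inter_iUnion, finsum_mem_iUnion (fun i j hij => ((hdis hij).mono Set.inter_subset_right
    Set.inter_subset_right)) hfin, finsum_eq_sum_of_fintype,
    integral_iUnion_fintype hA hdis hint, Finset.sum_sub_distrib]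

lemma force_apply {S A : Set (Space d)} {x : Space d} (hfin : (S ∩ A).Finite)
    (hint : IntegrableOn (pull x) A) (i : Fin d) :
    force S A x i = (∑ᶠ z ∈ S ∩ A, pull x z i) - ∫ z in A, pull x z i := by
  have h := (EuclideanSpace.proj (𝕜 := ℝ) i : Space d →L[ℝ] ℝ).integral_comp_comm hint
  change ∫ z in A, pull x z i = (∫ z in A, pull x z) i at h
  rw [h, force, finsum_mem_eq_finite_toFinset_sum _ hfin, finsum_mem_eq_finite_toFinset_sum _ hfin]
  simp

/-- Replacing `f` by the constant `v` in both the sum and the integral costs `E` per point and per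
unit of volume. -/
lemma abs_finsum_sub_integral_le {S A : Set (Space d)} {f : Space d → ℝ} {v E : ℝ}
    (hfin : (S ∩ A).Finite) (hvol : volume A ≠ ∞) (hint : IntegrableOn f A)
    (hv : ∀ z ∈ A, |f z - v| ≤ E) :
    |(∑ᶠ z ∈ S ∩ A, f z) - (∫ z in A, f z) - (count S A - volume.real A) * v| ≤
      (count S A + volume.real A) * E := by
  have h1 : |(∑ᶠ z ∈ S ∩ A, f z) - count S A * v| ≤ count S A * E := by
    rw [finsum_mem_eq_finite_toFinset_sum _ hfin, count, Set.ncard_eq_toFinset_card _ hfin,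
      ← nsmul_eq_mul, ← Finset.sum_const, ← Finset.sum_sub_distrib, ← nsmul_eq_mul,
      ← Finset.sum_const]
    exact (Finset.abs_sum_le_sum_abs _ _).trans (Finset.sum_le_sum fun z hz =>
      hv z ((hfin.mem_toFinset.1 hz).2))
  have h2 : |(∫ z in A, f z) - volume.real A * v| ≤ volume.real A * E := by
    have hc : ∫ z in A, v = volume.real A * v := by simp
    rw [← hc, ← integral_sub hint (integrableOn_const hvol), mul_comm]
    have := norm_setIntegral_le_of_norm_le_const (μ := volume) (f := fun z => f z - v) (C := E)
      (s := A) hvol.lt_top (fun z hz => hv z hz)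
    exact this
  have : (∑ᶠ z ∈ S ∩ A, f z) - (∫ z in A, f z) - (count S A - volume.real A) * v =
      ((∑ᶠ z ∈ S ∩ A, f z) - count S A * v) - ((∫ z in A, f z) - volume.real A * v) := by ring
  rw [this, add_mul]
  exact (abs_sub _ _).trans (add_le_add h1 h2)

lemma abs_cell_pos_sub_le {s : ℝ} (hs : 0 < s) {t : ℕ} {a : Fin d → ℤ} {c : Fin d → Fin t}
    {z : Space d} (hz : z ∈ cube (s / t) (subIndex t a c)) (i : Fin d) :
    |z i / s - a i - cellPos c i| ≤ 1 / t := by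
  have ht : (0:ℝ) < t := by exact_mod_cast Fin.pos (c i)
  have h := (mem_cube_iff (div_pos hs ht)).1 hz i
  simp only [subIndex, Int.cast_add, Int.cast_mul, Int.cast_natCast, Set.mem_Ico] at h
  have e : z i / s - a i - cellPos c i = (z i - (a i * t + (c i : ℕ)) * (s / t)) / s := by
    simp only [cellPos]; field_simp; ring
  rw [e, abs_div, abs_of_pos hs, div_le_div_iff₀ hs ht, one_mul, abs_of_nonneg (by linarith [h.1])]
  have : z i - (a i * t + (c i : ℕ)) * (s / t) ≤ s / t := by nlinarith [h.2]
  calc _ ≤ s / t * t := by gcongr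
    _ = s := by field_simp

/-- On each cell a force coordinate is nearly a fixed linear functional `ξ` of the moment vector of
the cell. The centered force is thus `ξ` applied to the moment mismatch, of order `Δ`, up to two
errors: `(s / ρ) ^ M` from truncating the kernel and `1 / t` from moving points to the cell corners.
They are weighted by the number of points plus the volume, at most `2 * s ^ d + Δ`. -/
theorem exists_force_cube_bound (hd : 1 ≤ d) (M : ℕ) : ∃ C τ₀ : ℝ, 0 < C ∧ 0 < τ₀ ∧
    ∀ (S : Set (Space d)) (_ : ∀ A : Set (Space d), Bornology.IsBounded A → (S ∩ A).Finite)
      (x : Space d) (s ρ Δ : ℝ) (a : Fin d → ℤ) (t : ℕ), 0 < s → 0 < t → 1 ≤ ρ → s ≤ τ₀ * ρ →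
      (∀ z ∈ cube s a, ρ ≤ ‖z - x‖) →
      ‖load (fun c : Fin d → Fin t => mono (2 * M + 1) (cellPos c))
          (fun c => count S (cube (s / t) (subIndex t a c))) -
        (s ^ d / (Fintype.card (Fin d → Fin t) : ℝ)) •
          ∑ c : Fin d → Fin t, mono (2 * M + 1) (cellPos c)‖ ≤ Δ →
      ‖force S (cube s a) x‖ ≤ C * (Δ + (s ^ d + Δ) * ((s / ρ) ^ M + 1 / t)) := by
  obtain ⟨C, τ₀, hC, hτ, hker⟩ := exists_kernel_approx hd M
  set D : ℝ := (Fintype.card (Fin d → Fin (2 * M + 1 + 1)) : ℝ) with hD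
  have hD0 : 0 ≤ D := by positivity
  set B : ℝ := C + D * C * (d * (2 * M + 1 : ℕ)) with hB
  have hB0 : 0 ≤ B := by positivity
  refine ⟨d * (D * C + 2 * B) + 1, τ₀, by positivity, hτ, ?_⟩
  intro S hS x s ρ Δ a t hs ht hρ hsρ hdist hΔ
  have htR : (0:ℝ) < t := by exact_mod_cast ht
  have hst : 0 < s / t := div_pos hs htR
  have hΔ0 : 0 ≤ Δ := (norm_nonneg _).trans hΔ
  set y : Space d := WithLp.toLp 2 (fun i => s * (a i : ℝ)) - x with hy
  have hyρ : ρ ≤ ‖y‖ := hdist _ (corner_mem_cube hs a)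
  set A : (Fin d → Fin t) → Set (Space d) := fun c => cube (s / t) (subIndex t a c) with hA
  have hcell : ∀ c, A c ⊆ cube s a := fun c => cell_subset_cube a c
  have hvol : ∀ c, volume.real (A c) = s ^ d / (Fintype.card (Fin d → Fin t) : ℝ) := fun c => by
    rw [measureReal_def, volume_cube hst, ENNReal.toReal_ofReal (by positivity), div_pow]
    simp
  set lam : ℝ := s ^ d / (Fintype.card (Fin d → Fin t) : ℝ) with hlam
  have hlam0 : 0 ≤ lam := by positivity
  have hmA : ∀ c, MeasurableSet (A c) := fun c => measurableSet_cube hst _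
  have hbA : ∀ c, Bornology.IsBounded (A c) := fun c => isBounded_cube hst _
  have hint : ∀ c, IntegrableOn (pull x) (A c) := fun c =>
    integrableOn_pull hd (hmA c) (hbA c) fun z hz => hρ.trans (hdist z (hcell c hz))
  set n : (Fin d → Fin t) → ℕ := fun c => count S (A c) with hn
  set φ : (Fin d → Fin t) → (Fin d → Fin (2 * M + 1 + 1)) → ℝ :=
    fun c => mono (2 * M + 1) (cellPos c) with hφ
  set E : ℝ := B * ((s / ρ) ^ M + 1 / t) with hE
  have hE0 : 0 ≤ E := by positivity
  have hload : ∀ α, |∑ c, ((n c : ℝ) - lam) * φ c α| ≤ Δ := fun α => by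
    refine le_trans (le_of_eq ?_) ((norm_le_pi_norm _ α).trans hΔ)
    rw [Pi.sub_apply, load_apply, Pi.smul_apply, Finset.sum_apply, smul_eq_mul, Finset.mul_sum,
      ← Finset.sum_sub_distrib, Real.norm_eq_abs]
    simp only [sub_mul, hφ]
  have hlamsum : ∑ _c : Fin d → Fin t, lam = s ^ d := by
    have : (Fintype.card (Fin d → Fin t) : ℝ) ≠ 0 := by simp [ht.ne']
    rw [Finset.sum_const, Finset.card_univ, nsmul_eq_mul, hlam]
    field_simp
  -- The mismatch in the constant monomial controls the number of points in the cube.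
  have hnsum : ∑ c, (n c : ℝ) ≤ s ^ d + Δ := by
    have h0 := (le_abs_self _).trans (hload 0)
    simp only [hφ, mono_zero, mul_one, Finset.sum_sub_distrib, hlamsum] at h0
    linarith
  have hcoord : ∀ i, |force S (cube s a) x i| ≤ D * C * Δ + (2 * s ^ d + Δ) * E := by
    intro i
    obtain ⟨ξ, hξ, hF⟩ := hker y s hs.le (hρ.trans hyρ) (hsρ.trans (by gcongr)) i
    have hu : ∀ c : Fin d → Fin t, ∀ l, cellPos c l ∈ Set.Icc (0:ℝ) 1 := fun c => cellPos_mem c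
    have hv : ∀ c, ∀ z ∈ A c, |pull x z i - ∑ α, ξ α * φ c α| ≤ E := by
      intro c z hz
      have hz' := (mem_cube_iff hs).1 (hcell c hz)
      have hul : ∀ l, z l / s - a l ∈ Set.Icc (0:ℝ) 1 := fun l => by
        have := hz' l
        rw [Set.mem_Ico] at this
        have h1 : (a l : ℝ) ≤ z l / s := by rw [le_div_iff₀ hs]; exact this.1
        have h2 : z l / s ≤ a l + 1 := by rw [div_le_iff₀ hs]; exact this.2.le
        exact ⟨by linarith, by linarith⟩
      have h1 := hF (z - x) (fun l => z l / s - a l) hul (fun l => by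
        simp only [hy, PiLp.sub_apply]
        field_simp
        ring)
      have h2 : |∑ α, ξ α * mono (2 * M + 1) (fun l => z l / s - a l) α - ∑ α, ξ α * φ c α| ≤
          D * C * (d * (2 * M + 1 : ℕ)) * (1 / t) := by
        rw [← Finset.sum_sub_distrib]
        refine (Finset.abs_sum_le_sum_abs _ _).trans ?_
        have : ∀ α ∈ Finset.univ, |ξ α * mono (2 * M + 1) (fun l => z l / s - a l) α - ξ α * φ c α|
            ≤ C * (d * (2 * M + 1 : ℕ) * (1 / t)) := fun α _ => by
          rw [← mul_sub, abs_mul]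
          exact mul_le_mul (hξ α) (abs_mono_sub_le hul (hu c)
            (fun l => abs_cell_pos_sub_le hs hz l) α) (abs_nonneg _) hC.le
        refine (Finset.sum_le_sum this).trans (le_of_eq ?_)
        rw [Finset.sum_const, Finset.card_univ, nsmul_eq_mul, ← hD]
        ring
      have h3 : (s / ‖y‖) ^ M ≤ (s / ρ) ^ M := by gcongr
      have h4 : pull x z i = (‖z - x‖ ^ d)⁻¹ * (z - x) i := rfl
      rw [h4]
      refine (abs_sub_le _ _ _).trans ((add_le_add h1 h2).trans ?_)
      rw [hE, hB]
      have h5 : C * (s / ‖y‖) ^ M ≤ C * (s / ρ) ^ M := by gcongr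
      have h6 : 0 ≤ D * C * (d * (2 * M + 1 : ℕ)) * (s / ρ) ^ M := by positivity
      have h7 : 0 ≤ C * (1 / t) := by positivity
      nlinarith
    have hsplit : force S (cube s a) x i = ∑ c, force S (A c) x i := by
      rw [cube_eq_iUnion ht a, force_iUnion (fun c => hS _ (hbA c)) hmA
        (fun c c' h => disjoint_cells a h) hint]
      simp [hA]
    have hc : ∀ c, |force S (A c) x i - ((n c : ℝ) - lam) * ∑ α, ξ α * φ c α| ≤
        ((n c : ℝ) + lam) * E := fun c => by
      rw [force_apply (hS _ (hbA c)) (hint c), ← hvol c]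
      exact abs_finsum_sub_integral_le (hS _ (hbA c)) (hbA c).measure_lt_top.ne
        ((EuclideanSpace.proj (𝕜 := ℝ) i : Space d →L[ℝ] ℝ).integrable_comp (hint c)) (hv c)
    have hmain : |∑ c, ((n c : ℝ) - lam) * ∑ α, ξ α * φ c α| ≤ D * C * Δ := by
      have : ∑ c, ((n c : ℝ) - lam) * ∑ α, ξ α * φ c α =
          ∑ α, ξ α * ∑ c, ((n c : ℝ) - lam) * φ c α := by
        simp only [Finset.mul_sum]
        rw [Finset.sum_comm]
        exact Finset.sum_congr rfl fun α _ => Finset.sum_congr rfl fun c _ => by ring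
      rw [this]
      refine (Finset.abs_sum_le_sum_abs _ _).trans ?_
      have : ∀ α ∈ Finset.univ, |ξ α * ∑ c, ((n c : ℝ) - lam) * φ c α| ≤ C * Δ := fun α _ => by
        rw [abs_mul]
        exact mul_le_mul (hξ α) (hload α) (abs_nonneg _) hC.le
      refine (Finset.sum_le_sum this).trans (le_of_eq ?_)
      rw [Finset.sum_const, Finset.card_univ, nsmul_eq_mul, ← hD]
      ring
    have hrest : |force S (cube s a) x i - ∑ c, ((n c : ℝ) - lam) * ∑ α, ξ α * φ c α| ≤
        (2 * s ^ d + Δ) * E := by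
      rw [hsplit, ← Finset.sum_sub_distrib]
      refine (Finset.abs_sum_le_sum_abs _ _).trans ((Finset.sum_le_sum fun c _ => hc c).trans ?_)
      rw [← Finset.sum_mul, Finset.sum_add_distrib, hlamsum]
      exact mul_le_mul_of_nonneg_right (by linarith) hE0
    have := abs_sub_abs_le_abs_sub (force S (cube s a) x i)
      (∑ c, ((n c : ℝ) - lam) * ∑ α, ξ α * φ c α)
    linarith
  refine (norm_le_sum_abs _).trans ((Finset.sum_le_sum fun i _ => hcoord i).trans ?_)
  rw [Finset.sum_const, Finset.card_univ, Fintype.card_fin, nsmul_eq_mul, hE]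
  set e : ℝ := (s / ρ) ^ M + 1 / t with he
  have he0 : 0 ≤ e := by positivity
  have hN0 : 0 ≤ s ^ d := by positivity
  have hd0 : (0:ℝ) ≤ d := by positivity
  have k1 : 0 ≤ d * (D * C) * ((s ^ d + Δ) * e) := by positivity
  have k2 : 0 ≤ d * (2 * B) * Δ := by positivity
  have k3 : 0 ≤ Δ + (s ^ d + Δ) * e := by positivity
  have k4 : 0 ≤ d * B * (Δ * e) := by positivity
  nlinarith

end Force

/-! ### Dyadic shells around the long axis, and their cubes -/

section Shells

variable {d : ℕ}

/-- The half-open version of `box`. -/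
def slab (d : ℕ) (L W : ℝ) : Set (Space d) :=
  hbox (fun i => -(if i.val = 0 then L else W)) (fun i => if i.val = 0 then L else W)

lemma slab_ae_eq_box (L W : ℝ) : slab d L W =ᵐ[volume] box d L W := by
  refine (hbox_ae_eq _ _).trans (Filter.EventuallyEq.of_eq ?_)
  ext z
  simp only [box, abs_le, Set.mem_Icc]

lemma slab_mono (L : ℝ) {W W' : ℝ} (h : W ≤ W') : slab d L W ⊆ slab d L W' := by
  intro z hz i
  have := hz i
  simp only [Set.mem_Ico] at this ⊢
  split_ifs at this ⊢
  · exact this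
  · exact ⟨by linarith [this.1], by linarith [this.2]⟩

lemma two_smul_box (L W : ℝ) : (2 : ℝ) • box d L W = box d (2 * L) (2 * W) := by
  ext z
  rw [Set.mem_smul_set_iff_inv_smul_mem₀ two_ne_zero]
  refine forall_congr' fun i => ?_
  rw [PiLp.smul_apply, smul_eq_mul, abs_mul, abs_of_pos (by norm_num : (0:ℝ) < 2⁻¹)]
  split_ifs <;> constructor <;> intro h <;> linarith

lemma measurableSet_box (L W : ℝ) : MeasurableSet (box d L W) := by
  have : box d L W = ⋂ i : Fin d, {x : Space d | |x i| ≤ if i.val = 0 then L else W} := by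
    ext; simp [box]
  rw [this]
  exact MeasurableSet.iInter fun i => measurableSet_le (by fun_prop) measurable_const

lemma isBounded_box (L W : ℝ) : Bornology.IsBounded (box d L W) :=
  isBounded_of_abs_le (r := max L W) fun z hz i => (hz i).trans (by
    split_ifs
    · exact le_max_left _ _
    · exact le_max_right _ _)

lemma floor_mem_Ico_iff {s r : ℝ} (hs : 0 < s) (b : ℤ) :
    ⌊r / s⌋ ∈ Finset.Ico (-b) b ↔ r ∈ Set.Ico (-(b * s)) (b * s) := by
  rw [Finset.mem_Ico, Set.mem_Ico, Int.le_floor, Int.floor_lt, le_div_iff₀ hs, div_lt_iff₀ hs]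
  simp

/-- The indices of the cubes of side `2 ^ (k - j)` in the `k`-th shell. -/
noncomputable def shell (d n j k : ℕ) : Finset (Fin d → ℤ) :=
  (Fintype.piFinset fun i : Fin d => if i.val = 0 then
    Finset.Ico (-2 ^ (n + 1 + j - k)) (2 ^ (n + 1 + j - k)) else
    Finset.Ico (-2 ^ (j + 1)) (2 ^ (j + 1))).filter
      fun a => ∃ i : Fin d, i.val ≠ 0 ∧ a i ∉ Finset.Ico (-2 ^ j : ℤ) (2 ^ j)

lemma mem_shell_floor_iff {n j k : ℕ} (hk : k ≤ n) (hj : j ≤ k) (z : Space d) :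
    (fun i => ⌊z i / (2:ℝ) ^ (k - j)⌋) ∈ shell d n j k ↔
      z ∈ slab d (2 ^ (n + 1)) (2 ^ (k + 1)) \ slab d (2 ^ (n + 1)) (2 ^ k) := by
  have hs : (0:ℝ) < 2 ^ (k - j) := by positivity
  have e1 : (2:ℝ) ^ (n + 1 + j - k) * 2 ^ (k - j) = 2 ^ (n + 1) := by
    rw [← pow_add]; congr 1; omega
  have e2 : (2:ℝ) ^ (j + 1) * 2 ^ (k - j) = 2 ^ (k + 1) := by
    rw [← pow_add]; congr 1; omega
  have e3 : (2:ℝ) ^ j * 2 ^ (k - j) = 2 ^ k := by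
    rw [← pow_add]; congr 1; omega
  have f1 := fun i => floor_mem_Ico_iff (r := z i) hs (2 ^ (n + 1 + j - k))
  have f2 := fun i => floor_mem_Ico_iff (r := z i) hs (2 ^ (j + 1))
  have f3 := fun i => floor_mem_Ico_iff (r := z i) hs (2 ^ j)
  simp only [Int.cast_pow, Int.cast_ofNat, e1, e2, e3] at f1 f2 f3
  rw [shell, Finset.mem_filter, Fintype.mem_piFinset]
  simp only [f3]
  have hA : (∀ i : Fin d, ⌊z i / (2:ℝ) ^ (k - j)⌋ ∈ if i.val = 0 then
      Finset.Ico (-2 ^ (n + 1 + j - k) : ℤ) (2 ^ (n + 1 + j - k)) else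
      Finset.Ico (-2 ^ (j + 1)) (2 ^ (j + 1))) ↔ z ∈ slab d (2 ^ (n + 1)) (2 ^ (k + 1)) := by
    refine forall_congr' fun i => ?_
    dsimp only
    split_ifs
    · exact f1 i
    · exact f2 i
  rw [hA, Set.mem_sdiff]
  refine and_congr_right fun h => ?_
  constructor
  · rintro ⟨i, hi, hz⟩ h'
    have := h' i
    simp only [hi, if_false] at this
    exact hz this
  · intro h'
    by_contra! hcon
    refine h' fun i => ?_
    by_cases hi : i.val = 0
    · have := h i
      simpa only [hi, if_true] using this
    · simpa only [hi, if_false] using hcon i hi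

lemma iUnion_shell {n j k : ℕ} (hk : k ≤ n) (hj : j ≤ k) :
    ⋃ a ∈ shell d n j k, cube ((2:ℝ) ^ (k - j)) a =
      slab d (2 ^ (n + 1)) (2 ^ (k + 1)) \ slab d (2 ^ (n + 1)) (2 ^ k) := by
  ext z
  rw [← mem_shell_floor_iff hk hj, Set.mem_iUnion₂]
  constructor
  · rintro ⟨a, ha, hz⟩
    rwa [show (fun i => ⌊z i / (2:ℝ) ^ (k - j)⌋) = a from funext hz]
  · exact fun h => ⟨_, h, fun i => rfl⟩

/-- The indices of all the cubes, together with their levels. -/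
noncomputable def shells (d m j n : ℕ) : Finset (Σ _ : ℕ, Fin d → ℤ) :=
  (Finset.Icc (2 * m + 1) n).sigma fun k => shell d n j k

/-- The cube with a given level and index. -/
noncomputable def shellCube (j : ℕ) (p : Σ _ : ℕ, Fin d → ℤ) : Set (Space d) := cube ((2:ℝ) ^ (p.1 - j)) p.2

lemma shellCube_subset {m j n : ℕ} (hj : j ≤ m) {p : Σ _ : ℕ, Fin d → ℤ}
    (hp : p ∈ shells d m j n) : shellCube j p ⊆
      slab d (2 ^ (n + 1)) (2 ^ (p.1 + 1)) \ slab d (2 ^ (n + 1)) (2 ^ p.1) := by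
  rw [shells, Finset.mem_sigma, Finset.mem_Icc] at hp
  rw [← iUnion_shell hp.1.2 (by omega : j ≤ p.1)]
  exact Set.subset_biUnion_of_mem (u := fun a => cube ((2:ℝ) ^ (p.1 - j)) a)
    (show p.2 ∈ (shell d n j p.1 : Set _) from hp.2)

lemma disjoint_shellCube {m j n : ℕ} (hj : j ≤ m) {p p' : Σ _ : ℕ, Fin d → ℤ}
    (hp : p ∈ shells d m j n) (hp' : p' ∈ shells d m j n) (hne : p ≠ p') :
    Disjoint (shellCube j p) (shellCube j p') := by
  have key : ∀ p p' : Σ _ : ℕ, Fin d → ℤ, p ∈ shells d m j n → p' ∈ shells d m j n → p.1 < p'.1 →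
      Disjoint (shellCube j p) (shellCube j p') := by
    intro p p' hp hp' hlt
    refine Set.disjoint_left.2 fun z hz hz' => (shellCube_subset hj hp' hz').2 ?_
    exact slab_mono _ (pow_le_pow_right₀ one_le_two hlt) (shellCube_subset hj hp hz).1
  rcases lt_trichotomy p.1 p'.1 with h | h | h
  · exact key _ _ hp hp' h
  · obtain ⟨k, a⟩ := p
    obtain ⟨k', a'⟩ := p'
    simp only at h
    subst h
    exact disjoint_cube fun h => hne (congrArg (Sigma.mk k) h)
  · exact (key _ _ hp' hp h).symm

/-- The level of a point is `r - 1` for the least `r` such that the slab of half-width `2 ^ r`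
contains it. -/
lemma iUnion_shells {m j n : ℕ} (hj : j ≤ m) :
    ⋃ p ∈ shells d m j n, shellCube j p =
      slab d (2 ^ (n + 1)) (2 ^ (n + 1)) \ slab d (2 ^ (n + 1)) (2 ^ (2 * m + 1)) := by
  refine subset_antisymm ?_ ?_
  · refine Set.iUnion₂_subset fun p hp z hz => ?_
    have h := shellCube_subset hj hp hz
    rw [shells, Finset.mem_sigma, Finset.mem_Icc] at hp
    exact ⟨slab_mono _ (pow_le_pow_right₀ one_le_two (by omega)) h.1,
      fun h' => h.2 (slab_mono _ (pow_le_pow_right₀ one_le_two hp.1.1) h')⟩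
  · rintro z ⟨hz, hz'⟩
    classical
    have hex : ∃ r, z ∈ slab d (2 ^ (n + 1)) (2 ^ r) := ⟨_, hz⟩
    have h1 := Nat.find_spec hex
    have h2 : Nat.find hex ≤ n + 1 := Nat.find_min' hex hz
    have h3 : 2 * m + 1 < Nat.find hex := by
      by_contra! h
      exact hz' (slab_mono _ (pow_le_pow_right₀ one_le_two h) h1)
    obtain ⟨k, hk⟩ : ∃ k, Nat.find hex = k + 1 := ⟨Nat.find hex - 1, by omega⟩
    have h4 := Nat.find_min hex (m := k) (by omega)
    rw [hk] at h1
    have : z ∈ ⋃ a ∈ shell d n j k, cube ((2:ℝ) ^ (k - j)) a := by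
      rw [iUnion_shell (by omega) (by omega)]
      exact ⟨h1, h4⟩
    obtain ⟨a, ha, hza⟩ := Set.mem_iUnion₂.1 this
    refine Set.mem_iUnion₂.2 ⟨⟨k, a⟩, ?_, hza⟩
    rw [shells, Finset.mem_sigma, Finset.mem_Icc]
    exact ⟨⟨by simp only; omega, by simp only; omega⟩, ha⟩

/-- Some transversal coordinate of `z` is at least `2 ^ p.1`, while that of `x` is at most `2 ^ (2 *
m) ≤ 2 ^ (p.1 - 1)`. Removing `2V₀` instead of `V₀` is what makes the levels start at `2 * m + 1`.
-/
lemma le_norm_sub_of_mem_shellCube {m j n : ℕ} (hj : j ≤ m) {p : Σ _ : ℕ, Fin d → ℤ}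
    (hp : p ∈ shells d m j n) {x z : Space d} (hx : x ∈ box d (2 ^ n) (2 ^ (2 * m)))
    (hz : z ∈ shellCube j p) : (2:ℝ) ^ (p.1 - 1) ≤ ‖z - x‖ := by
  have hz' := shellCube_subset hj hp hz
  rw [shells, Finset.mem_sigma, Finset.mem_Icc] at hp
  have : ∃ i : Fin d, i.val ≠ 0 ∧ (2:ℝ) ^ p.1 ≤ |z i| := by
    by_contra! hcon
    refine hz'.2 fun i => ?_
    by_cases hi : i.val = 0
    · have := hz'.1 i
      simpa only [hi, if_true] using this
    · have := abs_lt.1 (hcon i hi)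
      simp only [hi, if_false]
      exact ⟨this.1.le, this.2⟩
  obtain ⟨i, hi, hzi⟩ := this
  have hxi := hx i
  simp only [hi, if_false] at hxi
  have h1 : (2:ℝ) ^ (2 * m) ≤ 2 ^ (p.1 - 1) := pow_le_pow_right₀ one_le_two (by omega)
  have h2 : (2:ℝ) ^ p.1 = 2 * 2 ^ (p.1 - 1) := by rw [← pow_succ']; congr 1; omega
  have h3 := PiLp.norm_apply_le (z - x) i
  rw [Real.norm_eq_abs, PiLp.sub_apply] at h3
  linarith [abs_sub_abs_le_abs_sub (z i) (x i)]

lemma card_shell_le (hd : 1 ≤ d) (n j k : ℕ) (hk : k ≤ n) :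
    (shell d n j k).card ≤ 2 ^ (n + 2 + j - k) * (2 ^ (j + 2)) ^ (d - 1) := by
  obtain ⟨d, rfl⟩ : ∃ e, d = e + 1 := ⟨d - 1, by omega⟩
  refine (Finset.card_filter_le _ _).trans ?_
  rw [Fintype.card_piFinset, Fin.prod_univ_succ]
  refine Nat.mul_le_mul ?_ ?_
  · simp only [Fin.val_zero, if_true, Int.card_Ico]
    refine le_of_eq ?_
    rw [show n + 2 + j - k = n + 1 + j - k + 1 by omega, pow_succ 2 (n + 1 + j - k)]
    have : (2:ℤ) ^ (n + 1 + j - k) - -2 ^ (n + 1 + j - k) =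
      ((2 ^ (n + 1 + j - k) * 2 : ℕ) : ℤ) := by push_cast; ring
    rw [this, Int.toNat_natCast]
  · rw [Nat.add_sub_cancel]
    refine le_of_eq ?_
    have : (2:ℤ) ^ (j + 1) - -2 ^ (j + 1) = ((2 ^ (j + 2) : ℕ) : ℤ) := by push_cast; ring
    simp only [Fin.val_succ, Nat.add_eq_zero_iff, one_ne_zero, and_false, if_false, Int.card_Ico,
      this, Int.toNat_natCast]
    simp

/-- Side lengths are summed because each cube will cost its side. The bound on the number of cubes
times the side does not depend on the level, and there are at most `n` levels. -/
lemma sum_shells_le (hd : 1 ≤ d) {m j n : ℕ} (hj : j ≤ m) :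
    ∑ p ∈ shells d m j n, (2:ℝ) ^ (p.1 - j) ≤ n * 4 ^ d * 2 ^ (n + j * d) := by
  rw [shells, Finset.sum_sigma]
  have : ∀ k ∈ Finset.Icc (2 * m + 1) n, ∑ a ∈ shell d n j k, (2:ℝ) ^ (k - j) ≤
      4 ^ d * 2 ^ (n + j * d) := by
    intro k hk
    rw [Finset.mem_Icc] at hk
    rw [Finset.sum_const, nsmul_eq_mul]
    have h := card_shell_le hd n j k hk.2
    have h' : ((shell d n j k).card : ℝ) ≤ 2 ^ (n + 2 + j - k) * (2 ^ (j + 2)) ^ (d - 1) := by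
      exact_mod_cast h
    refine (mul_le_mul_of_nonneg_right h' (by positivity)).trans ?_
    rw [← pow_mul, ← pow_add, ← pow_add, show (4:ℝ) = 2 ^ 2 by norm_num, ← pow_mul, ← pow_add]
    refine pow_le_pow_right₀ one_le_two ?_
    obtain ⟨d, rfl⟩ : ∃ e, d = e + 1 := ⟨d - 1, by omega⟩
    have : n + 2 + j - k + (k - j) = n + 2 := by omega
    simp only [Nat.add_sub_cancel]
    ring_nf
    ring_nf at this
    nlinarith
  refine (Finset.sum_le_sum this).trans ?_
  rw [Finset.sum_const, nsmul_eq_mul, Nat.card_Icc, mul_assoc]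
  refine mul_le_mul_of_nonneg_right ?_ (by positivity)
  exact_mod_cast (by omega : n + 1 - (2 * m + 1) ≤ n)

end Shells

/-! ### From matching in every cube to a small force on the whole of `V₀` -/

section ForceBound

variable {d : ℕ}

lemma poissonMeasure_zero_singleton : poissonMeasure 0 {0} = 1 := by
  have h : (poissonMeasure 0).real {0} = 1 := by
    rw [poissonMeasure_real_singleton]; simp
  rw [← ENNReal.ofReal_one, ← h, ofReal_measureReal]

lemma IsStandardPoissonProcess.ae_inter_eq_empty {Ω : Type*} [MeasurableSpace Ω] {P : Measure Ω}
    [IsProbabilityMeasure P] {Z : Ω → Set (Space d)} (hZ : IsStandardPoissonProcess P Z)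
    {A : Set (Space d)} (hA : MeasurableSet A) (hb : Bornology.IsBounded A) (h0 : volume A = 0) :
    ∀ᵐ ω ∂P, Z ω ∩ A = ∅ := by
  have h := hZ.map_count A hA hb
  have h1 : P ((fun ω => count (Z ω) A) ⁻¹' {0}) = 1 := by
    rw [← Measure.map_apply (hZ.measurable_count A hA hb) (measurableSet_singleton _), h, h0]
    simpa using poissonMeasure_zero_singleton
  have h2 := (prob_compl_eq_zero_iff ((hZ.measurable_count A hA hb)
    (measurableSet_singleton 0))).2 h1
  filter_upwards [measure_eq_zero_iff_ae_notMem.1 h2] with ω hω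
  rw [Set.mem_compl_iff, not_not, Set.mem_preimage, Set.mem_singleton_iff, count,
    Set.ncard_eq_zero (hZ.locallyFinite ω A hb)] at hω
  exact hω

/-- Almost surely no point lies in the null symmetric difference, an event that does not involve
`x`. Half-open cubes may thus tile the closed boxes. -/
lemma IsStandardPoissonProcess.ae_force_congr {Ω : Type*} [MeasurableSpace Ω] {P : Measure Ω}
    [IsProbabilityMeasure P] {Z : Ω → Set (Space d)} (hZ : IsStandardPoissonProcess P Z)
    {A B : Set (Space d)} (hA : MeasurableSet A) (hb : Bornology.IsBounded A)
    (hB : MeasurableSet B) (hb' : Bornology.IsBounded B) (hAB : A =ᵐ[volume] B) :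
    ∀ᵐ ω ∂P, ∀ x, force (Z ω) A x = force (Z ω) B x := by
  have h1 := hZ.ae_inter_eq_empty (hA.diff hB) (hb.subset Set.sdiff_subset) (ae_eq_set.1 hAB).1
  have h2 := hZ.ae_inter_eq_empty (hB.diff hA) (hb'.subset Set.sdiff_subset) (ae_eq_set.1 hAB).2
  filter_upwards [h1, h2] with ω h1 h2 x
  have : Z ω ∩ A = Z ω ∩ B := by
    ext z
    have e1 : z ∉ Z ω ∩ (A \ B) := by simp [h1]
    have e2 : z ∉ Z ω ∩ (B \ A) := by simp [h2]
    simp only [Set.mem_inter_iff, Set.mem_sdiff] at e1 e2 ⊢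
    tauto
  rw [force, force, this, setIntegral_congr_set hAB]

/-- The law of the cell counts of a cube of a given level. -/
noncomputable def cellLaw (d t k j : ℕ) : Measure ((Fin d → Fin t) → ℕ) :=
  poisProd fun _ => (((2 ^ ((k - j) * d) : ℕ) : ℝ≥0) / (Fintype.card (Fin d → Fin t) : ℝ≥0))

/-- The cell counts whose moments of order at most `m'` match those of the uniform density. -/
def matching (d m' t k j : ℕ) (Δ : ℝ) : Set ((Fin d → Fin t) → ℕ) :=
  {n | ‖load (fun c : Fin d → Fin t => mono m' (cellPos c)) n -
    (((2 ^ ((k - j) * d) : ℕ) : ℝ) / (Fintype.card (Fin d → Fin t) : ℝ)) •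
      ∑ c : Fin d → Fin t, mono m' (cellPos c)‖ ≤ Δ}

/-- The matching events of distinct cubes are independent and do not refer to `x`, so on their
intersection the bounds of all cubes add up for every `x` at once. The bound for each cube is
multiplied by its side, which is at least `1`, so that `sum_shells_le` serves for this sum too. -/
theorem exists_prod_le_prob_force_le (hd : 1 ≤ d) (M : ℕ) : ∃ C τ₀ : ℝ, 0 < C ∧ 0 < τ₀ ∧
    ∀ {Ω : Type*} [MeasurableSpace Ω] (P : Measure Ω) [IsProbabilityMeasure P]
      (Z : Ω → Set (Space d)), IsStandardPoissonProcess P Z →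
      ∀ (n m j t : ℕ) (Δ : ℝ), 0 < t → j ≤ m → 2 / 2 ^ j ≤ τ₀ → 0 ≤ Δ →
      ∏ p ∈ shells d m j n, (cellLaw d t p.1 j).real (matching d (2 * M + 1) t p.1 j Δ) ≤
        P.real {ω | ∀ x ∈ box d (2 ^ n) (2 ^ (2 * m)), ‖force (Z ω)
          (box d (2 ^ (n + 1)) (2 ^ (n + 1)) \ (2 : ℝ) • box d (2 ^ n) (2 ^ (2 * m))) x‖ ≤
          n * 4 ^ d * 2 ^ (n + j * d) *
            (C * (Δ + (2 ^ (n * d) + Δ) * ((2 / 2 ^ j) ^ M + 1 / t)))} := by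
  obtain ⟨C, τ₀, hC, hτ, hcube⟩ := exists_force_cube_bound hd M
  refine ⟨C, τ₀, hC, hτ, fun P _ Z hZ n m j t Δ ht hj hjτ hΔ => ?_⟩
  classical
  set K := shells d m j n with hK
  have hspos : ∀ k : ℕ, (0:ℝ) < 2 ^ (k - j) := fun k => by positivity
  have htR : (0:ℝ) < t := by exact_mod_cast ht
  let A : K → (Fin d → Fin t) → Set (Space d) := fun p c =>
    cube ((2:ℝ) ^ (p.1.1 - j) / t) (subIndex t p.1.2 c)
  have hst : ∀ k : ℕ, (0:ℝ) < 2 ^ (k - j) / t := fun k => div_pos (hspos k) htR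
  have hlaw := hZ.real_counts (A := A) (fun p c => measurableSet_cube (hst _) _)
    (fun p c => isBounded_cube (hst _) _) (by
      intro p c p' c' hne
      by_cases h : p = p'
      · subst h
        exact disjoint_cells _ fun h => hne (by rw [h])
      · exact (disjoint_shellCube hj p.2 p'.2 fun h' => h (Subtype.ext h')).mono
          (cell_subset_cube _ _) (cell_subset_cube _ _))
    (v := fun p => ((2 ^ ((p.1.1 - j) * d) : ℕ) : ℝ≥0) / (Fintype.card (Fin d → Fin t) : ℝ≥0))
    (fun p c => by
      rw [volume_cube (hst _), ENNReal.ofReal, ENNReal.coe_inj]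
      apply NNReal.coe_injective
      rw [Real.coe_toNNReal _ (by positivity), div_pow, ← pow_mul]
      simp)
    (fun p => matching d (2 * M + 1) t p.1.1 j Δ)
  have hprod : ∏ p : K, (poisProd fun _ : Fin d → Fin t => ((2 ^ ((p.1.1 - j) * d) : ℕ) : ℝ≥0) /
      (Fintype.card (Fin d → Fin t) : ℝ≥0)).real (matching d (2 * M + 1) t p.1.1 j Δ) =
      ∏ p ∈ K, (cellLaw d t p.1 j).real (matching d (2 * M + 1) t p.1 j Δ) :=
    Finset.prod_coe_sort K fun p => (cellLaw d t p.1 j).real (matching d (2 * M + 1) t p.1 j Δ)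
  rw [← hprod, ← hlaw]
  refine ENNReal.toReal_mono (measure_ne_top _ _) (measure_mono_ae ?_)
  have hae : (box d (2 ^ (n + 1)) (2 ^ (n + 1)) \ (2 : ℝ) • box d (2 ^ n) (2 ^ (2 * m)) : Set _)
      =ᵐ[volume] ⋃ p ∈ K, shellCube j p := by
    rw [iUnion_shells hj, two_smul_box, ← pow_succ', ← pow_succ']
    exact ((slab_ae_eq_box _ _).diff (slab_ae_eq_box _ _)).symm
  have hmQ : ∀ p, MeasurableSet (shellCube (d := d) j p) := fun p => measurableSet_cube (hspos _) _
  have hbU : Bornology.IsBounded (⋃ p ∈ K, shellCube (d := d) j p) := by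
    rw [iUnion_shells hj]
    exact (isBounded_hbox _ _).subset Set.sdiff_subset
  filter_upwards [hZ.ae_force_congr (by
      rw [two_smul_box]; exact (measurableSet_box _ _).diff (measurableSet_box _ _))
    ((isBounded_box _ _).subset Set.sdiff_subset)
    (K.measurableSet_biUnion fun p _ => hmQ p) hbU hae] with ω hω hgood x hx
  rw [hω x]
  have hU : ⋃ p ∈ K, shellCube j p = ⋃ p : K, shellCube j p.1 := by
    rw [Set.iUnion_subtype]
  have hρ : ∀ p ∈ K, (1:ℝ) ≤ 2 ^ (p.1 - 1) := fun p _ => one_le_pow₀ one_le_two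
  rw [hU, force_iUnion (A := fun p : K => shellCube j p.1) (fun p => hZ.locallyFinite ω _ (isBounded_cube (hspos _) _))
    (fun p => hmQ _) (fun p p' h => disjoint_shellCube hj p.2 p'.2 fun h' => h (Subtype.ext h'))
    (fun p => integrableOn_pull hd (hmQ _) (isBounded_cube (hspos _) _) fun z hz =>
      (hρ _ p.2).trans (le_norm_sub_of_mem_shellCube hj p.2 hx hz))]
  refine (norm_sum_le _ _).trans ?_
  set e : ℝ := C * (Δ + (2 ^ (n * d) + Δ) * ((2 / 2 ^ j) ^ M + 1 / t)) with he
  have he0 : 0 ≤ e := by positivity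
  have hone : ∀ p : K, ‖force (Z ω) (shellCube j p.1) x‖ ≤ 2 ^ (p.1.1 - j) * e := by
    intro p
    have hp : p.1 ∈ shells d m j n := p.2
    rw [shells, Finset.mem_sigma, Finset.mem_Icc] at hp
    have hratio : (2:ℝ) ^ (p.1.1 - j) = 2 / 2 ^ j * 2 ^ (p.1.1 - 1) := by
      rw [div_mul_eq_mul_div, eq_div_iff (by positivity), ← pow_add, ← pow_succ']
      congr 1
      omega
    have hmatch := hgood p
    rw [matching, Set.mem_ofPred_eq] at hmatch
    have hpow : (((2 ^ ((p.1.1 - j) * d) : ℕ) : ℝ)) = ((2:ℝ) ^ (p.1.1 - j)) ^ d := by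
      rw [← pow_mul]; push_cast; rfl
    rw [hpow] at hmatch
    have h := hcube (Z ω) (hZ.locallyFinite ω) x (2 ^ (p.1.1 - j)) (2 ^ (p.1.1 - 1)) Δ p.1.2 t
      (hspos _) ht (hρ _ p.2) (by rw [hratio]; gcongr)
      (fun z hz => le_norm_sub_of_mem_shellCube hj p.2 hx hz) hmatch
    rw [show (2:ℝ) ^ (p.1.1 - j) / 2 ^ (p.1.1 - 1) = 2 / 2 ^ j by
      rw [hratio]; field_simp] at h
    refine h.trans (le_trans ?_ (le_mul_of_one_le_left he0 (one_le_pow₀ one_le_two)))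
    rw [he, ← pow_mul]
    have : (2:ℝ) ^ ((p.1.1 - j) * d) ≤ 2 ^ (n * d) :=
      pow_le_pow_right₀ one_le_two (Nat.mul_le_mul_right _ (by omega))
    gcongr
  refine (Finset.sum_le_sum fun p _ => hone p).trans ?_
  rw [← Finset.sum_mul, Finset.sum_coe_sort K fun p => (2:ℝ) ^ (p.1 - j)]
  exact mul_le_mul_of_nonneg_right (sum_shells_le hd hj) he0

end ForceBound

/-! ### Choice of precision and mesh, and the resulting total error -/

section Parameters

variable {d : ℕ}

/-- With `q = d` rounds and `N = (2 ^ (k - j)) ^ d` points, `d ≤ 2 ^ (d + 1)` bounds the cost by the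
side. The mesh exponent `u + d + 1` accounts for the precision `2 ^ (-u n)`, for up to `2 ^ (n d)`
points, and for one factor `2 ^ n` dominating `L`. The mesh enters the cost only through a logarithm
of order `n`. -/
theorem exists_prob_matching_ge (hd : 1 ≤ d) (m' u : ℕ) : ∃ (C : ℝ) (t₀ n₀ : ℕ), 0 < C ∧ 0 < t₀ ∧
    ∀ n k j : ℕ, n₀ ≤ n → 1 ≤ n → k ≤ n → n₀ ≤ 2 ^ (k - j) →
      Real.exp (-(C * n * 2 ^ (k - j))) ≤
        (cellLaw d (t₀ * 2 ^ ((u + d + 1) * n)) k j).real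
          (matching d m' (t₀ * 2 ^ ((u + d + 1) * n)) k j (C / 2 ^ (u * n))) := by
  obtain ⟨a, G, L, t₀, ha, ha', hG, hL, ht₀, hsys⟩ := exists_momentSystem d m'
  obtain ⟨C, N₀, hC, hN₀, hmatch⟩ := exists_uniform_match (κ := Fin d → Fin (m' + 1)) 0
    (nodeMean d m') (a := a) (G := G) (J := (m' + 1) ^ d) ha ha' hG (by positivity) d
  have hlt0 : 0 ≤ Real.log t₀ := Real.log_natCast_nonneg _
  set v : ℕ := u + d + 1 with hv
  set c : ℝ := d * (Real.log t₀ + v) + d + u + 1 with hc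
  have hc1 : 1 ≤ c := by rw [hc]; linarith [show 0 ≤ d * (Real.log t₀ + v) + d + u by positivity]
  refine ⟨C * c, t₀, ⌈N₀⌉₊ + ⌈L⌉₊, by positivity, ht₀, fun n k j hn hn1 hk hkj => ?_⟩
  have hn1' : (1:ℝ) ≤ n := by exact_mod_cast hn1
  have hlog2 : Real.log 2 ≤ 1 := by linarith [Real.log_two_lt_d9]
  have hlog2' : 0 ≤ Real.log 2 := Real.log_nonneg one_le_two
  set t : ℕ := t₀ * 2 ^ (v * n) with ht
  have htpos : 0 < t := by positivity
  have : Nonempty (Fin t) := ⟨⟨0, htpos⟩⟩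
  have hLn : L ≤ 2 ^ n := by
    have h1 : (⌈L⌉₊ : ℝ) ≤ n := by exact_mod_cast (by omega : ⌈L⌉₊ ≤ n)
    have h2 : (n : ℝ) ≤ 2 ^ n := by exact_mod_cast Nat.lt_two_pow_self.le
    exact (Nat.le_ceil L).trans (h1.trans h2)
  have hpown : (2:ℝ) ^ ((k - j) * d) ≤ 2 ^ (n * d) :=
    pow_le_pow_right₀ one_le_two (Nat.mul_le_mul_right _ (by omega))
  have h := hmatch (Fin d → Fin t) _ _ (hsys (2 ^ (v * n)) (by positivity))
    (2 ^ ((k - j) * d)) (1 / 2 ^ (u * n)) (c * n) ?_ (by positivity) ?_ ?_ ?_ ?_ ?_ ?_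
  · have hΔ : C * (1 / 2 ^ (u * n)) ≤ C * c / 2 ^ (u * n) := by
      rw [← mul_div_assoc, mul_one]
      gcongr
      exact le_mul_of_one_le_right hC.le hc1
    have hexp : C * (((2 ^ ((k - j) * d) : ℕ) : ℝ)) ^ ((1 / 2 : ℝ) ^ (d + 1)) * (c * n) ≤
        C * c * n * 2 ^ (k - j) := by
      have h1 : (((2 ^ ((k - j) * d) : ℕ) : ℝ)) ^ ((1 / 2 : ℝ) ^ (d + 1)) ≤ 2 ^ (k - j) := by
        have h2 : (((2 ^ ((k - j) * d) : ℕ) : ℝ)) = ((2:ℝ) ^ (k - j)) ^ (d : ℝ) := by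
          rw [Real.rpow_natCast, ← pow_mul]; push_cast; rfl
        rw [h2, ← Real.rpow_mul (by positivity)]
        conv_rhs => rw [← Real.rpow_one ((2:ℝ) ^ (k - j))]
        refine Real.rpow_le_rpow_of_exponent_le (one_le_pow₀ one_le_two) ?_
        rw [one_div, inv_pow, ← div_eq_mul_inv, div_le_one (by positivity)]
        exact_mod_cast (Nat.lt_two_pow_self (n := d)).le.trans
          (Nat.pow_le_pow_right two_pos (Nat.le_succ d))
      calc _ ≤ C * 2 ^ (k - j) * (c * n) := by gcongr
        _ = _ := by ring
    refine (Real.exp_le_exp.2 (neg_le_neg hexp)).trans (h.trans ?_)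
    exact measureReal_mono (fun x (hx : _ ≤ _) => hx.trans hΔ)
      (measure_ne_top (poisProd _) _)
  · refine Nat.ceil_le.1 (le_trans (by omega : _ ≤ ⌈N₀⌉₊ + ⌈L⌉₊) (hkj.trans (Nat.pow_le_pow_right two_pos ?_)))
    exact Nat.le_mul_of_pos_right _ hd
  · rw [div_le_one (by positivity)]
    exact one_le_pow₀ one_le_two
  · push_cast
    rw [div_mul_eq_mul_div, div_le_div_iff₀ (by positivity) (by positivity), one_mul]
    have e : (2:ℝ) ^ (v * n) = 2 ^ (u * n) * 2 ^ (n * d) * 2 ^ n := by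
      rw [← pow_add, ← pow_add, hv]; congr 1; ring
    have h1 : (1:ℝ) ≤ t₀ := by exact_mod_cast ht₀
    calc L * 2 ^ ((k - j) * d) * 2 ^ (u * n) ≤ 2 ^ n * 2 ^ (n * d) * 2 ^ (u * n) := by gcongr
      _ = 1 * 2 ^ (v * n) := by rw [e]; ring
      _ ≤ t₀ * 2 ^ (v * n) := by gcongr
  · have e : Real.log (Fintype.card (Fin d → Fin t)) = d * (Real.log t₀ + v * n * Real.log 2) := by
      simp only [Fintype.card_pi, Fintype.card_fin, Finset.prod_const, Finset.card_univ, ht,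
        Nat.cast_pow, Nat.cast_mul, Nat.cast_ofNat]
      rw [Real.log_pow, Real.log_mul (by positivity) (by positivity), Real.log_pow]
      push_cast
      ring
    rw [e]
    have h1 : Real.log t₀ ≤ Real.log t₀ * n := le_mul_of_one_le_right hlt0 hn1'
    have h2 : v * n * Real.log 2 ≤ v * n := mul_le_of_le_one_right (by positivity) hlog2
    have h3 : (d:ℝ) * (Real.log t₀ + v * n * Real.log 2) ≤ d * (Real.log t₀ * n + v * n) := by
      gcongr
    have h4 : 0 ≤ ((d:ℝ) + u + 1) * n := by positivity
    rw [hc]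
    linarith
  · push_cast
    rw [Real.log_pow]
    have h1 : (((k - j) * d : ℕ) : ℝ) ≤ n * d := by
      exact_mod_cast Nat.mul_le_mul_right _ (by omega)
    have h2 : (((k - j) * d : ℕ) : ℝ) * Real.log 2 ≤ n * d :=
      (mul_le_of_le_one_right (by positivity) hlog2).trans h1
    have h3 : 0 ≤ (d * (Real.log t₀ + v) + u + 1) * n := by positivity
    rw [hc]
    linarith
  · rw [one_div, Real.log_inv, neg_neg, Real.log_pow]
    have h2 : ((u * n : ℕ) : ℝ) * Real.log 2 ≤ u * n := by
      rw [Nat.cast_mul]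
      exact mul_le_of_le_one_right (by positivity) hlog2
    have h3 : 0 ≤ (d * (Real.log t₀ + v) + d + 1) * n := by positivity
    rw [hc]
    linarith
  · exact one_le_mul_of_one_le_of_one_le hc1 hn1'

/-- Powers of `y = 2 ^ n` are counted: `1` for the factor `n`, `d + 1` for `2 ^ (n + j * d)`, `d`
for the volume of a cube, `1` for the constants. Against `y ^ (-(3 * d + 3))` this leaves `y ^
(-d)`. -/
lemma total_error_le {n j M t u : ℕ} {C C₂ : ℝ} (hC : 0 ≤ C) (hC₂ : 0 ≤ C₂)
    (hu : u = 3 * d + 3) (hj : j ≤ n) (hM : (2 / 2 ^ j : ℝ) ^ M ≤ 1 / 2 ^ (u * n))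
    (ht : (1 / t : ℝ) ≤ 1 / 2 ^ (u * n)) (hn : 4 ^ d * (C * (3 * C₂ + 2)) ≤ n) :
    n * 4 ^ d * 2 ^ (n + j * d) * (C * (C₂ / 2 ^ (u * n) + (2 ^ (n * d) + C₂ / 2 ^ (u * n)) *
      ((2 / 2 ^ j) ^ M + 1 / t))) ≤ (1 / 2 ^ n : ℝ) ^ d := by
  set y : ℝ := 2 ^ n with hy
  have hy1 : 1 ≤ y := one_le_pow₀ one_le_two
  have hny : (n : ℝ) ≤ y := by
    rw [hy]; exact_mod_cast Nat.lt_two_pow_self.le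
  have e1 : (2:ℝ) ^ (u * n) = y ^ (3 * d + 3) := by rw [hy, ← pow_mul, hu, mul_comm]
  have e2 : (2:ℝ) ^ (n * d) = y ^ d := by rw [hy, ← pow_mul]
  have e3 : (2:ℝ) ^ (n + j * d) ≤ y ^ (d + 1) := by
    rw [hy, ← pow_mul]
    refine pow_le_pow_right₀ one_le_two ?_
    nlinarith [Nat.mul_le_mul_right d hj]
  rw [e1] at hM ht ⊢
  rw [e2]
  have hyd : 1 ≤ y ^ d := one_le_pow₀ hy1
  set w : ℝ := y ^ (3 * d + 3) with hw
  have hw1 : 1 ≤ w := one_le_pow₀ hy1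
  have h1 : C₂ / w ≤ C₂ := div_le_self hC₂ hw1
  have h2 : C₂ / w + (y ^ d + C₂ / w) * ((2 / 2 ^ j) ^ M + 1 / t) ≤
      (3 * C₂ + 2) * (y ^ d / w) := by
    calc C₂ / w + (y ^ d + C₂ / w) * ((2 / 2 ^ j) ^ M + 1 / t)
        ≤ C₂ / w + (y ^ d + C₂) * (1 / w + 1 / w) := by gcongr
      _ = (3 * C₂ + 2 * y ^ d) * (1 / w) := by ring
      _ ≤ (3 * C₂ * y ^ d + 2 * y ^ d) * (1 / w) := by
          refine mul_le_mul_of_nonneg_right ?_ (by positivity)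
          linarith [le_mul_of_one_le_right (by positivity : 0 ≤ 3 * C₂) hyd]
      _ = _ := by ring
  calc _ ≤ y * 4 ^ d * y ^ (d + 1) * (C * ((3 * C₂ + 2) * (y ^ d / w))) := by gcongr
    _ = 4 ^ d * (C * (3 * C₂ + 2)) * (y ^ (2 * d + 2) / w) := by
        rw [show 2 * d + 2 = 1 + (d + 1) + d by ring, pow_add, pow_add, pow_one]; ring
    _ ≤ y * (y ^ (2 * d + 2) / w) := by
        gcongr
        exact hn.trans hny
    _ = (1 / y) ^ d := by
        rw [hw, show 3 * d + 3 = (2 * d + 2) + 1 + d by ring, pow_add y _ d,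
          pow_add y (2 * d + 2) 1, pow_one, one_div, inv_pow]
        field_simp

end Parameters

/-! ### Total cost and conclusion -/

section Main

variable {d : ℕ}

/-- Up to constants `2 ^ (j * d)` is at most `R ^ (ε * d / 4)`, and one of the two factors `log R`
is absorbed in `R ^ (ε / 4)`. The exponents fit because `(d + 1) / 4 ≤ d - 2`, with equality at `d =
3`. -/
lemma dyadic_cost_le (hd : 3 ≤ d) {ε : ℝ} (hε : 0 < ε) {R : ℝ} (hR : 2 ≤ R) {n m j : ℕ}
    (hn : (n : ℝ) ≤ Real.log R / Real.log 2 + 1) (hm : (m : ℝ) ≤ ε * (Real.log R / Real.log 2) + 1)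
    (hj : 4 * j ≤ m) :
    (n : ℝ) * (n * 4 ^ d * 2 ^ (n + j * d)) ≤
      128 / ε * 8 ^ d * R ^ (1 + ((d : ℝ) - 2) * ε) * Real.log R := by
  have hR0 : 0 < R := by linarith
  have hl2 : 0 < Real.log 2 := Real.log_pos one_lt_two
  have hlR : Real.log 2 ≤ Real.log R := Real.log_le_log two_pos hR
  have hlR0 : 0 < Real.log R := hl2.trans_le hlR
  set X : ℝ := Real.log R / Real.log 2 with hX
  have hX1 : 1 ≤ X := by rw [hX, le_div_iff₀ hl2]; linarith
  have hRX : (2:ℝ) ^ X = R := Real.rpow_logb two_pos (by norm_num) hR0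
  have hX2 : X ≤ 2 * Real.log R := by
    rw [hX, div_le_iff₀ hl2]
    nlinarith [Real.log_two_gt_d9]
  have hn4 : (n : ℝ) ≤ 4 * Real.log R := by linarith
  have hlog : Real.log R ≤ R ^ (ε / 4) / (ε / 4) := Real.log_le_rpow_div hR0.le (by positivity)
  have h2n : (2:ℝ) ^ n ≤ 2 * R := by
    rw [← Real.rpow_natCast]
    refine (Real.rpow_le_rpow_of_exponent_le one_le_two hn).trans (le_of_eq ?_)
    rw [Real.rpow_add two_pos, hRX, Real.rpow_one, mul_comm]
  have h2j : (2:ℝ) ^ (j * d) ≤ 2 ^ d * R ^ (ε * d / 4) := by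
    rw [← Real.rpow_natCast, ← hRX, ← Real.rpow_mul two_pos.le, ← Real.rpow_natCast,
      ← Real.rpow_add two_pos]
    refine Real.rpow_le_rpow_of_exponent_le one_le_two ?_
    have hj' : (4:ℝ) * j ≤ m := by exact_mod_cast hj
    have hd0 : (0:ℝ) ≤ d := by positivity
    push_cast
    nlinarith [mul_le_mul_of_nonneg_right (hj'.trans hm) hd0]
  have hR1 : 1 ≤ R := by linarith
  have hexp : R * R ^ (ε * d / 4) * R ^ (ε / 4) ≤ R ^ (1 + ((d : ℝ) - 2) * ε) := by
    have e : R * R ^ (ε * d / 4) * R ^ (ε / 4) = R ^ (1 + ε * d / 4 + ε / 4) := by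
      rw [Real.rpow_add hR0, Real.rpow_add hR0, Real.rpow_one]
    rw [e]
    refine Real.rpow_le_rpow_of_exponent_le hR1 ?_
    have : (3:ℝ) ≤ d := by exact_mod_cast hd
    nlinarith
  calc (n : ℝ) * (n * 4 ^ d * 2 ^ (n + j * d))
      = n * n * (4 ^ d * (2 ^ n * 2 ^ (j * d))) := by rw [pow_add]; ring
    _ ≤ (4 * Real.log R) * (4 * (R ^ (ε / 4) / (ε / 4))) *
        (4 ^ d * ((2 * R) * (2 ^ d * R ^ (ε * d / 4)))) := by
        have : (n : ℝ) ≤ 4 * (R ^ (ε / 4) / (ε / 4)) := hn4.trans (by linarith)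
        gcongr
    _ = 128 / ε * 8 ^ d * (R * R ^ (ε * d / 4) * R ^ (ε / 4)) * Real.log R := by
        rw [show (8:ℝ) ^ d = 4 ^ d * 2 ^ d by rw [← mul_pow]; norm_num]
        field_simp
        ring
    _ ≤ _ := by gcongr

theorem exists_force_small_ball (hd : 3 ≤ d) {ε : ℝ} (hε : 0 < ε) (hε' : ε ≤ 1 / 2) :
    ∃ C : ℝ, 0 < C ∧
      ∀ (Ω : Type*) [MeasurableSpace Ω] (P : Measure Ω) [IsProbabilityMeasure P]
        (Z : Ω → Set (Space d)), IsStandardPoissonProcess P Z → ∀ R : ℝ, C ≤ R →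
          Real.exp (-(C * R ^ (1 + ((d : ℝ) - 2) * ε) * Real.log R)) ≤
            P.real {ω | ∀ x ∈ V₀ d ε R,
              ‖force (Z ω) (Vplus d R \ (2 : ℝ) • V₀ d ε R) x‖ ≤ 1 / R ^ d} := by
  have hd1 : 1 ≤ d := by omega
  set u : ℕ := 3 * d + 3 with hu
  -- Since `j - 1 ≥ ε * n / 16` for large `R`, this order makes the expansion error at most `2 ^ (-u
  -- n)`.
  set M : ℕ := ⌈16 * u / ε⌉₊ with hM
  obtain ⟨C₁, τ₀, hC₁, hτ, hprob⟩ := exists_prod_le_prob_force_le hd1 M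
  obtain ⟨C₂, t₀, n₀, hC₂, ht₀, hmatch⟩ := exists_prob_matching_ge hd1 (2 * M + 1) u
  set B : ℝ := 4 ^ d * (C₁ * (3 * C₂ + 2)) with hB
  have hB0 : 0 ≤ B := by positivity
  -- A lower bound for `log R / log 2`. Its terms give in turn `n₀ ≤ n`, `n₀ ≤ m`, the absorption of
  -- the constant `B` by `n`, `2 / 2 ^ j ≤ τ₀`, `j - 1 ≥ ε * n / 16`, and, with `ε ≤ 1 / 2`, `m ≤
  -- n`.
  set X₀ : ℝ := n₀ + n₀ / ε + B + (8 / τ₀ + 3) / ε + 14 / ε + 2 with hX₀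
  set C₃ : ℝ := C₂ * (128 / ε * 8 ^ d) with hC₃
  have hl2 : 0 < Real.log 2 := Real.log_pos one_lt_two
  refine ⟨C₃ + Real.exp (X₀ * Real.log 2) + 2, by positivity, fun Ω _ P _ Z hZ R hR => ?_⟩
  have hC₃0 : 0 ≤ C₃ := by positivity
  have hR2 : 2 ≤ R := by linarith [Real.exp_pos (X₀ * Real.log 2)]
  have hR0 : 0 < R := by linarith
  have hlR0 : 0 < Real.log R := Real.log_pos (by linarith)
  set X : ℝ := Real.log R / Real.log 2 with hX
  have hXX : X₀ ≤ X := by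
    rw [hX, le_div_iff₀ hl2, Real.le_log_iff_exp_le hR0]
    linarith
  have hX0 : 0 ≤ X := by positivity
  have g1 : (0:ℝ) ≤ n₀ := by positivity
  have g2 : 0 ≤ n₀ / ε := by positivity
  have g3 : 0 ≤ (8 / τ₀ + 3) / ε := by positivity
  have g4 : 0 ≤ 14 / ε := by positivity
  obtain ⟨n, hn⟩ : ∃ n : ℕ, p₁ R = n := Int.eq_ofNat_of_zero_le (Int.ceil_nonneg hX0)
  have hεX : ε * Real.log R / Real.log 2 = ε * X := by rw [hX, mul_div_assoc]
  obtain ⟨m, hm⟩ : ∃ m : ℕ, p₂ ε R = m := Int.eq_ofNat_of_zero_le (Int.ceil_nonneg (by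
    rw [hεX]; positivity))
  have hnX : X ≤ n := by
    have := Int.le_ceil X
    rw [show ⌈X⌉ = (n : ℤ) from hn] at this
    exact_mod_cast this
  have hnX' : (n : ℝ) < X + 1 := by
    have := Int.ceil_lt_add_one X
    rw [show ⌈X⌉ = (n : ℤ) from hn] at this
    exact_mod_cast this
  rw [p₂, hεX] at hm
  have hmX : ε * X ≤ m := by
    have := Int.le_ceil (ε * X)
    rw [hm] at this
    exact_mod_cast this
  have hmX' : (m : ℝ) < ε * X + 1 := by
    have := Int.ceil_lt_add_one (ε * X)
    rw [hm] at this
    exact_mod_cast this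
  -- Large enough for cubes to be smaller than their distance by a power of `R`, small enough for
  -- the number of cubes not to exceed the budget.
  set j : ℕ := m / 4 with hj
  have hj4 : 4 * j ≤ m := Nat.mul_div_le m 4
  have hjm : ((m : ℝ) - 3) / 4 ≤ j := by
    have : m ≤ 4 * j + 3 := by omega
    have : (m : ℝ) ≤ 4 * j + 3 := by exact_mod_cast this
    linarith
  have hmn : m ≤ n := by
    have : (m : ℝ) ≤ n := by nlinarith
    exact_mod_cast this
  have hn₀n : n₀ ≤ n := by
    have : (n₀ : ℝ) ≤ n := by linarith
    exact_mod_cast this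
  have hn₀m : n₀ ≤ m := by
    have : n₀ / ε ≤ X := by linarith
    rw [div_le_iff₀ hε, mul_comm] at this
    exact_mod_cast this.trans hmX
  have hn1 : 1 ≤ n := by
    have : (1 : ℝ) ≤ n := by linarith
    exact_mod_cast this
  have hjτ : 2 / 2 ^ j ≤ τ₀ := by
    have h1 : (8 / τ₀ + 3) / ε ≤ X := by linarith
    rw [div_le_iff₀ hε, mul_comm] at h1
    have h2 : 2 / τ₀ ≤ j := by
      have : 8 / τ₀ = 4 * (2 / τ₀) := by ring
      linarith
    have h3 : (j : ℝ) ≤ 2 ^ j := by exact_mod_cast Nat.lt_two_pow_self.le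
    have h4 := h2.trans h3
    rw [div_le_iff₀ hτ] at h4
    rw [div_le_iff₀ (by positivity)]
    linarith
  have hX14 : 14 ≤ ε * X := by
    have : 14 / ε ≤ X := by linarith
    rwa [div_le_iff₀ hε, mul_comm] at this
  have hMj : u * n ≤ (j - 1) * M := by
    have h1 : (16 * u / ε : ℝ) ≤ M := Nat.le_ceil _
    have hj1 : 1 ≤ j := by
      have : (1:ℝ) ≤ j := by linarith
      exact_mod_cast this
    have h2 : ε * n / 16 ≤ ((j - 1 : ℕ) : ℝ) := by
      rw [Nat.cast_sub hj1, Nat.cast_one]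
      nlinarith
    have h3 : ((u * n : ℕ) : ℝ) ≤ ((j - 1 : ℕ) : ℝ) * M := by
      calc ((u * n : ℕ) : ℝ) = ε * n / 16 * (16 * u / ε) := by push_cast; field_simp
        _ ≤ _ := by gcongr
    exact_mod_cast h3
  have hpow : (2 / 2 ^ j : ℝ) ^ M ≤ 1 / 2 ^ (u * n) := by
    have hj1 : 1 ≤ j := by
      have : (1:ℝ) ≤ j := by linarith
      exact_mod_cast this
    have e : (2 / 2 ^ j : ℝ) = 1 / 2 ^ (j - 1) := by
      obtain ⟨i, hi⟩ : ∃ i, j = i + 1 := ⟨j - 1, by omega⟩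
      rw [hi, Nat.add_sub_cancel, pow_succ]
      field_simp
    rw [e, div_pow, one_pow, ← pow_mul]
    exact one_div_le_one_div_of_le (by positivity) (pow_le_pow_right₀ one_le_two hMj)
  set t : ℕ := t₀ * 2 ^ ((u + d + 1) * n) with ht
  have htu : (1 / t : ℝ) ≤ 1 / 2 ^ (u * n) := by
    refine one_div_le_one_div_of_le (by positivity) ?_
    have h1 : 2 ^ (u * n) ≤ t := (Nat.pow_le_pow_right two_pos
      (Nat.mul_le_mul_right n (by omega))).trans (Nat.le_mul_of_pos_left _ ht₀)
    exact_mod_cast h1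
  have hmain := hprob P Z hZ n m j t (C₂ / 2 ^ (u * n)) (by positivity) (by omega) hjτ
    (by positivity)
  have herr := total_error_le (d := d) (t := t) (M := M) hC₁.le hC₂.le hu (by omega) hpow htu
    (by rw [← hB]; linarith)
  have hRn : R ≤ 2 ^ n := by
    have hRX : (2:ℝ) ^ X = R := Real.rpow_logb two_pos (by norm_num) hR0
    rw [← hRX, ← Real.rpow_natCast]
    exact Real.rpow_le_rpow_of_exponent_le one_le_two hnX
  have herr' : (1 / 2 ^ n : ℝ) ^ d ≤ 1 / R ^ d := by
    rw [div_pow, one_pow]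
    gcongr
  have hcost := dyadic_cost_le hd hε hR2 hnX'.le hmX'.le hj4
  have hV₀ : V₀ d ε R = box d (2 ^ n) (2 ^ (2 * m)) := by
    rw [V₀, hn, p₂, hεX, hm]
    norm_cast
  have hVp : Vplus d R = box d (2 ^ (n + 1)) (2 ^ (n + 1)) := by
    rw [Vplus, hn]
    norm_cast
  rw [hV₀, hVp]
  have hprod : Real.exp (-(C₃ * R ^ (1 + ((d : ℝ) - 2) * ε) * Real.log R)) ≤
      ∏ p ∈ shells d m j n, (cellLaw d t p.1 j).real
        (matching d (2 * M + 1) t p.1 j (C₂ / 2 ^ (u * n))) := by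
    calc _ ≤ Real.exp (∑ p ∈ shells d m j n, -(C₂ * n * 2 ^ (p.1 - j))) := by
          rw [Real.exp_le_exp, Finset.sum_neg_distrib, neg_le_neg_iff, ← Finset.mul_sum]
          have h := mul_le_mul_of_nonneg_left (sum_shells_le hd1 (m := m) (n := n)
            (by omega : j ≤ m)) (by positivity : 0 ≤ C₂ * n)
          refine h.trans ?_
          calc _ = C₂ * (n * (n * 4 ^ d * 2 ^ (n + j * d))) := by ring
            _ ≤ C₂ * _ := mul_le_mul_of_nonneg_left hcost hC₂.le
            _ = _ := by rw [hC₃]; ring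
      _ = ∏ p ∈ shells d m j n, Real.exp (-(C₂ * n * 2 ^ (p.1 - j))) := Real.exp_sum _ _
      _ ≤ _ := Finset.prod_le_prod (fun _ _ => (Real.exp_pos _).le) fun p hp => by
          rw [shells, Finset.mem_sigma, Finset.mem_Icc] at hp
          refine hmatch n p.1 j hn₀n hn1 hp.1.2 ?_
          -- Levels exceed `2 * m` and `j ≤ m`, so even the smallest cubes have side at least `2 ^
          -- m` and contain enough points.
          exact (hn₀m.trans (by omega : m ≤ p.1 - j)).trans Nat.lt_two_pow_self.le
  have hfinal : -((C₃ + Real.exp (X₀ * Real.log 2) + 2) * R ^ (1 + ((d : ℝ) - 2) * ε) *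
      Real.log R) ≤ -(C₃ * R ^ (1 + ((d : ℝ) - 2) * ε) * Real.log R) := by
    rw [neg_le_neg_iff]
    gcongr
    linarith [Real.exp_pos (X₀ * Real.log 2)]
  refine (Real.exp_le_exp.2 hfinal).trans (hprod.trans (hmain.trans ?_))
  exact measureReal_mono (fun ω hω x hx => (hω x hx).trans (herr.trans herr'))
    (measure_ne_top _ _)

end Main

end GravSmallBall

theorem mainTheorem6 (d : ℕ) (hd : 3 ≤ d) (ε : ℝ) (hε : 0 < ε)
    (hε' : ε < 1 / (2 * ((d : ℝ) - 2))) :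
    ∃ C : ℝ, 0 < C ∧
      ∀ (Ω : Type*) [MeasurableSpace Ω] (P : Measure Ω) [IsProbabilityMeasure P]
        (Z : Ω → Set (GravSmallBall.Space d)),
        GravSmallBall.IsStandardPoissonProcess P Z →
        ∀ R : ℝ, C ≤ R →
          Real.exp (-(C * R ^ (1 + ((d : ℝ) - 2) * ε) * Real.log R)) ≤
            P.real {ω | ∀ x ∈ GravSmallBall.V₀ d ε R,
              ‖GravSmallBall.force (Z ω)
                  (GravSmallBall.Vplus d R \ (2 : ℝ) • GravSmallBall.V₀ d ε R) x‖
                ≤ 1 / R ^ d} := by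
  have h3 : (3:ℝ) ≤ d := by exact_mod_cast hd
  -- As `d - 2 ≥ 1`, the hypothesis on `ε` gives `ε ≤ 1 / 2`, which is all that is needed.
  exact GravSmallBall.exists_force_small_ball hd hε
    (hε'.le.trans (one_div_le_one_div_of_le two_pos (by linarith)))
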